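/- Let $G$ be a finite simple undirected graph on $n$ vertices with $m$ edges that is $2$-vertex-connected (it is connected and no deletion of a vertex disconnects the rest), let $e$ be a designated root edge of $G$, and let every edge have a positive real weight. A cycle is a connected $2$-regular subgraph, and it is rooted if it contains $e$; the cycle space is the subspace of $\mathbb{F}_2^{E}$ spanned by the edge sets of cycles. A rooted cycle basis is a set of rooted cycles that is a basis of the cycle space; its weight is the sum of the weights of its cycles, where the weight of a cycle is the sum of the weights of its edges. There is a deterministic polynomial-time algorithm that, given such a graph as a list of its edges together with the root edge and the weights, computes a minimum-weight rooted cycle basis. More precisely: there are one program for a random access machine and one polynomial $p$ such that, on every such input, the program halts after at most $p(n+m)$ steps and stores only integers of size at most $p(n+m)$ in its memory; it uses the real edge weights only through exact comparisons of two sums of edge weights, each summand costing one step. It outputs a sequence $C_1,\dots,C_k$ of distinct rooted cycles such that: 1. $\{C_1,\dots,C_k\}$ is a rooted cycle basis whose weight is minimum among all rooted cycle bases of $G$. 2. The sequence is greedy: each $C_i$ has minimum weight among the rooted cycles that contain an edge not in $C_1\cup\dots\cup C_{i-1}$; among those of equal weight it uses as few edges outside $C_1\cup\dots\cup C_{i-1}$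 as possible; and every edge other than $e$ belongs to some $C_i$. 3. The basis is weakly fundamental in this order: each $C_i$ contains an edge that is in no earlier cycle. 4. Let $P_0$ be the path consisting of the edge $e$ and, for $i\ge 1$, let $P_i$ be the subgraph formed by the edges of $C_i$ that are different from $e$ and in no earlier cycle, with their endpoints. Then $P_0,P_1,\dots,P_k$ is an open ear decomposition of $G$: $P_0$ is a single edge, every $P_i$ with $i\ge1$ is a simple path with two distinct endpoints, both of which lie in earlier ears, while no interior vertex of $P_i$ lies in an earlier ear; every edge of $G$ lies in exactly one ear and every vertex in at least one. -/

import Mathlib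

namespace RootedCycleBasis

noncomputable section

/-! ### Cycles, the cycle space, cycle bases -/

section Graphs

variable {V : Type*} {G : SimpleGraph V}

/-- A graph is 2-vertex-connected (biconnected) if it is connected and no deletion of a vertex
disconnects the remaining graph. (A single edge counts as biconnected.) -/
def IsBiconnected (G : SimpleGraph V) : Prop :=
  G.Connected ∧ ∀ v : V, (G.induce {v}ᶜ).Preconnected

/-- A cycle is a connected 2-regular subgraph. -/
def IsCycle (C : G.Subgraph) : Prop :=
  C.Connected ∧ ∀ v ∈ C.verts, (C.neighborSet v).ncard = 2

/-- A cycle is rooted at the edge `e` if it contains `e`. -/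
def IsRootedCycle (e : Sym2 V) (C : G.Subgraph) : Prop :=
  IsCycle C ∧ e ∈ C.edgeSet

/-- The edge set of a subgraph, as a vector of the edge space `𝔽₂^E`. -/
def edgeVec (G : SimpleGraph V) (C : G.Subgraph) : G.edgeSet → ZMod 2 :=
  fun f => C.edgeSet.indicator 1 (f : Sym2 V)

/-- The cycle space: the subspace of the edge space spanned by the edge sets of cycles. -/
def cycleSpace (G : SimpleGraph V) : Submodule (ZMod 2) (G.edgeSet → ZMod 2) :=
  Submodule.span (ZMod 2) (edgeVec G '' {C | IsCycle C})

/-- A rooted cycle basis: a set of cycles, all containing `e`, that is a basis of the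
cycle space. -/
structure IsRootedCycleBasis (e : Sym2 V) (B : Set G.Subgraph) : Prop where
  rooted : ∀ C ∈ B, IsRootedCycle e C
  indep : LinearIndepOn (ZMod 2) (edgeVec G) B
  span_eq : Submodule.span (ZMod 2) (edgeVec G '' B) = cycleSpace G

/-- The weight of a subgraph: the sum of the weights of its edges. -/
def weight (w : Sym2 V → ℝ) (C : G.Subgraph) : ℝ :=
  ∑ᶠ f ∈ C.edgeSet, w f

/-- The weight of a set of cycles: the sum of the weights of its members. -/
def totalWeight (w : Sym2 V → ℝ) (B : Set G.Subgraph) : ℝ :=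
  ∑ᶠ C ∈ B, weight w C

/-- A rooted cycle basis whose weight is minimum among all rooted cycle bases. -/
def IsMinRootedCycleBasis (w : Sym2 V → ℝ) (e : Sym2 V) (B : Set G.Subgraph) : Prop :=
  IsRootedCycleBasis e B ∧
    ∀ B' : Set G.Subgraph, IsRootedCycleBasis e B' → totalWeight w B ≤ totalWeight w B'

/-! ### Greedy sequences and ear decompositions -/

/-- The edges of `D` that belong to none of the cycles before the `i`-th. -/
def newEdges {k : ℕ} (C : Fin k → G.Subgraph) (i : Fin k) (D : G.Subgraph) : Set (Sym2 V) :=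
  {f | f ∈ D.edgeSet ∧ ∀ j < i, f ∉ (C j).edgeSet}

/-- In this order, each cycle contains an edge that is not in any earlier cycle. -/
def IsWeaklyFundamental {k : ℕ} (C : Fin k → G.Subgraph) : Prop :=
  ∀ i, (newEdges C i (C i)).Nonempty

/-- The possible results of the greedy method: each cycle is a shortest rooted cycle among those
that contain an edge not yet covered, ties being broken in favour of cycles that use as few new
edges as possible, until all edges are covered (the root edge counts as covered from the
start). -/
structure IsGreedySequence (w : Sym2 V → ℝ) (e : Sym2 V) {k : ℕ}
    (C : Fin k → G.Subgraph) : Prop where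
  rooted : ∀ i, IsRootedCycle e (C i)
  new : ∀ i, (newEdges C i (C i)).Nonempty
  shortest : ∀ i (D : G.Subgraph), IsRootedCycle e D → (newEdges C i D).Nonempty →
    weight w (C i) ≤ weight w D
  tie : ∀ i (D : G.Subgraph), IsRootedCycle e D → (newEdges C i D).Nonempty →
    weight w (C i) = weight w D → (newEdges C i (C i)).ncard ≤ (newEdges C i D).ncard
  covers : ∀ f ∈ G.edgeSet, f ≠ e → ∃ i, f ∈ (C i).edgeSet

/-- The subgraph of `G` formed by the edges of `G` in `S` and their endpoints. -/
def ofEdges (G : SimpleGraph V) (S : Set (Sym2 V)) : G.Subgraph where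
  verts := {v | ∃ u, G.Adj v u ∧ s(v, u) ∈ S}
  Adj u v := G.Adj u v ∧ s(u, v) ∈ S
  adj_sub h := h.1
  edge_vert h := ⟨_, h⟩
  symm := ⟨fun u v h => ⟨h.1.symm, by rw [Sym2.eq_swap]; exact h.2⟩⟩

/-- A simple path with endpoints `a` and `b`: a connected subgraph in which `a` and `b` have
degree one and all other vertices have degree two. -/
structure IsSimplePath (P : G.Subgraph) (a b : V) : Prop where
  connected : P.Connected
  ne : a ≠ b
  deg_left : (P.neighborSet a).ncard = 1
  deg_right : (P.neighborSet b).ncard = 1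
  deg_interior : ∀ v ∈ P.verts, v ≠ a → v ≠ b → (P.neighborSet v).ncard = 2

/-- An open ear decomposition of `G` with ears `P 0, …, P k`. -/
structure IsOpenEarDecomposition {k : ℕ} (P : Fin (k + 1) → G.Subgraph) : Prop where
  first : ∃ (u v : V) (h : G.Adj u v), P 0 = G.subgraphOfAdj h
  ear : ∀ i, 0 < i → ∃ a b, IsSimplePath (P i) a b ∧
    (∃ j < i, a ∈ (P j).verts) ∧ (∃ j < i, b ∈ (P j).verts) ∧
    ∀ v ∈ (P i).verts, v ≠ a → v ≠ b → ∀ j < i, v ∉ (P j).verts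
  edge_partition : ∀ f ∈ G.edgeSet, ∃! i, f ∈ (P i).edgeSet
  vert_cover : ∀ v : V, ∃ i, v ∈ (P i).verts

/-- The root edge, followed by the sets of edges that the successive cycles add to it. -/
def ears (e : Sym2 V) {k : ℕ} (C : Fin k → G.Subgraph) : Fin (k + 1) → G.Subgraph :=
  Fin.cons (ofEdges G {e}) (fun i => ofEdges G (newEdges C i (C i) \ {e}))

end Graphs

/-! ### The machine model

A random access machine, programmed by structured programs. Its memory consists of arrays of
words (natural numbers that stay below a given bound). The edge weights, which are real numbers,
are not stored in memory: they can be used only through exact comparisons of two sums of weights,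
each summand being charged one step. -/

/-- `s a i` is the content of cell `i` of array `a`. -/
abbrev Mem := ℕ → ℕ → ℕ

/-- Arithmetic expressions; `get a i` reads cell `i` of array `a`. -/
inductive Expr where
  | const (k : ℕ)
  | get (a : ℕ) (i : Expr)
  | add (x y : Expr)
  | sub (x y : Expr)
  | mul (x y : Expr)

/-- The value of an expression (subtraction is truncated at `0`). -/
def Expr.eval (s : Mem) : Expr → ℕ
  | const k => k
  | get a i => s a (i.eval s)
  | add x y => x.eval s + y.eval s
  | sub x y => x.eval s - y.eval s
  | mul x y => x.eval s * y.eval s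

/-- The number of steps for evaluating an expression. -/
def Expr.cost : Expr → ℕ
  | const _ => 1
  | get _ i => i.cost + 1
  | add x y => x.cost + y.cost + 1
  | sub x y => x.cost + y.cost + 1
  | mul x y => x.cost + y.cost + 1

/-- Tests. `weightLe a x b y` compares the total weight of the edges whose indices are in the
first `x` cells of array `a` with that of the edges whose indices are in the first `y` cells of
array `b`. -/
inductive Test where
  | le (x y : Expr)
  | weightLe (a : ℕ) (x : Expr) (b : ℕ) (y : Expr)
  | not (q : Test)
  | and (q r : Test)

/-- The truth of a test, for the weights `wt` of the edges (by index). -/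
def Test.Holds (wt : ℕ → ℝ) (s : Mem) : Test → Prop
  | le x y => x.eval s ≤ y.eval s
  | weightLe a x b y =>
      ∑ i ∈ Finset.range (x.eval s), wt (s a i) ≤ ∑ i ∈ Finset.range (y.eval s), wt (s b i)
  | not q => ¬ q.Holds wt s
  | and q r => q.Holds wt s ∧ r.Holds wt s

/-- The number of steps for evaluating a test. -/
def Test.cost (s : Mem) : Test → ℕ
  | le x y => x.cost + y.cost + 1
  | weightLe _ x _ y => x.cost + y.cost + x.eval s + y.eval s + 1
  | not q => q.cost s + 1
  | and q r => q.cost s + r.cost s + 1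

/-- Programs; `assign a i x` stores the value of `x` in cell `i` of array `a`. -/
inductive Cmd where
  | skip
  | assign (a : ℕ) (i x : Expr)
  | seq (c d : Cmd)
  | ite (q : Test) (c d : Cmd)
  | loop (q : Test) (c : Cmd)

/-- `Exec wt W c s t s'`: started in memory `s`, with edge weights `wt` and word bound `W`, the
program `c` halts after exactly `t` steps in memory `s'`, and every value and every address that
it writes on the way is at most `W`. -/
inductive Exec (wt : ℕ → ℝ) (W : ℕ) : Cmd → Mem → ℕ → Mem → Prop where
  | skip (s : Mem) : Exec wt W Cmd.skip s 1 s
  | assign (a : ℕ) (i x : Expr) (s : Mem) (hi : i.eval s ≤ W) (hx : x.eval s ≤ W) :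
      Exec wt W (Cmd.assign a i x) s (i.cost + x.cost + 1)
        (Function.update s a (Function.update (s a) (i.eval s) (x.eval s)))
  | seq {c d : Cmd} {s s₁ s₂ : Mem} {t₁ t₂ : ℕ} (hc : Exec wt W c s t₁ s₁)
      (hd : Exec wt W d s₁ t₂ s₂) : Exec wt W (Cmd.seq c d) s (t₁ + t₂) s₂
  | ite_true {q : Test} {c d : Cmd} {s s₁ : Mem} {t : ℕ} (hq : q.Holds wt s)
      (hc : Exec wt W c s t s₁) : Exec wt W (Cmd.ite q c d) s (q.cost s + t) s₁
  | ite_false {q : Test} {c d : Cmd} {s s₁ : Mem} {t : ℕ} (hq : ¬ q.Holds wt s)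
      (hd : Exec wt W d s t s₁) : Exec wt W (Cmd.ite q c d) s (q.cost s + t) s₁
  | loop_done {q : Test} {c : Cmd} {s : Mem} (hq : ¬ q.Holds wt s) :
      Exec wt W (Cmd.loop q c) s (q.cost s) s
  | loop_step {q : Test} {c : Cmd} {s s₁ s₂ : Mem} {t₁ t₂ : ℕ} (hq : q.Holds wt s)
      (hc : Exec wt W c s t₁ s₁) (hl : Exec wt W (Cmd.loop q c) s₁ t₂ s₂) :
      Exec wt W (Cmd.loop q c) s (q.cost s + t₁ + t₂) s₂

/-! ### Input and output -/

/-- A list of the `m` edges of a graph with vertices `0, …, n - 1`, without repetition. -/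
structure EdgeList {n : ℕ} (G : SimpleGraph (Fin n)) where
  m : ℕ
  fst : Fin m → Fin n
  snd : Fin m → Fin n
  inj : Function.Injective fun j => s(fst j, snd j)
  range_eq : Set.range (fun j => s(fst j, snd j)) = G.edgeSet

namespace EdgeList

variable {n : ℕ} {G : SimpleGraph (Fin n)}

/-- The edge with a given index. -/
def edge (L : EdgeList G) (j : Fin L.m) : Sym2 (Fin n) := s(L.fst j, L.snd j)

/-- The weights by edge index, which the machine can compare sums of
(`0` at numbers that are not the index of an edge). -/
def wt (L : EdgeList G) (w : Sym2 (Fin n) → ℝ) (j : ℕ) : ℝ :=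
  if h : j < L.m then w (L.edge ⟨j, h⟩) else 0

/-- The initial memory: array `0` starts with `n`, `m` and the index of the root edge, arrays `1`
and `2` with the first and the second endpoints of the edges; all other cells are `0`. -/
def input (L : EdgeList G) (r : Fin L.m) : Mem := fun a i =>
  match a with
  | 0 => match i with
    | 0 => n
    | 1 => L.m
    | 2 => (r : ℕ)
    | _ => 0
  | 1 => if h : i < L.m then (L.fst ⟨i, h⟩ : ℕ) else 0
  | 2 => if h : i < L.m then (L.snd ⟨i, h⟩ : ℕ) else 0
  | _ => 0

/-- The final memory `s` describes the sequence `C` of `k` subgraphs: cell `0` of array `3`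
contains `k`, and array `4` is the incidence matrix, in which row `i` marks the edges
of `C i` by `1`. -/
def Outputs (L : EdgeList G) (s : Mem) {k : ℕ} (C : Fin k → G.Subgraph) : Prop :=
  s 3 0 = k ∧ ∀ (i : Fin k) (j : Fin L.m), L.edge j ∈ (C i).edgeSet ↔ s 4 (i * L.m + j) = 1

end EdgeList

end

end RootedCycleBasis

/-! The cycles are chosen greedily. The structural core is an exchange argument (`not_splitsNew`): a
vertex that a chosen cycle shares with an earlier one cannot have new edges on both sides of it,
along the path left after removing `e`. Otherwise, segments of the two paths between common vertices
could be exchanged, and the minimality of the two choices would give contradictory inequalities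
between segment weights. The rule for ties makes one of these inequalities strict. Hence the new
edges of each cycle form one path that meets the earlier cycles and the root edge exactly in its
ends (`exists_ear`), which is the ear decomposition.

An interior vertex of the last ear has only two usable edges, so a vector of even degrees supported
on the covered edges is constant on that ear. Adding a multiple of the last cycle removes the ear,
and by induction the vector lies in the span of the chosen cycles (`mem_span_of_isEven`).
Independence is triangularity with respect to new edges. For minimality, any other rooted basis is
sorted by weight. If its member number `i` were lighter than `C i`, then it and all members before
it would use covered edges only, putting `i + 1` independent vectors into the span of `i` cycles
(`isMinRootedCycleBasis_of_isBest`).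

To find a greedy choice, a cheapest rooted cycle is computed through each uncovered edge `xy` other
than `e = uv`. Such a cycle amounts to two disjoint paths between `{u, v}` and `{x, y}`, hence to a
permutation that fixes the unused vertices, moves along the paths and sends `x, y` back to `u, v`.
Such permutations exist by Hall's theorem and 2-connectivity, and a cheapest one has no superfluous
cycles, as edge costs are positive (`IsBestPerm.isRootedCycle`). Costs are lexicographic triples:
number of forbidden choices, weight, number of uncovered edges.

The assignment problem is solved row by row with Bellman-Ford alternating paths. As weights can only
enter comparisons of sums, no distances are stored: each path is kept as the permutation it
produces, and two paths with the same end are compared through the costs of their rows, the last row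
left out. The programs use loops over vertices or edges and store capped values only, so polynomial
time and space follow from their syntax (`Prg.exists_exec`), separately from correctness. -/

namespace RootedCycleBasis

noncomputable section

/-! ### Minimum-cost permutations by successive shortest paths -/

section Assignment

open Equiv Finset

variable {ι Γ : Type*} [Fintype ι] [DecidableEq ι] [AddCommGroup Γ] [LinearOrder Γ]
  [IsOrderedAddMonoid Γ]

/-- The cost of a permutation. -/
def permCost {M : Type*} [AddCommMonoid M] (c : ι → ι → M) (τ : Perm ι) : M := ∑ b, c b (τ b)

/-- The cost of a permutation without the row `z`. -/
def holeCost (c : ι → ι → Γ) (τ : Perm ι) (z : ι) : Γ := ∑ b ∈ univ.erase z, c b (τ b)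

omit [LinearOrder Γ] [IsOrderedAddMonoid Γ] in
theorem holeCost_add (c : ι → ι → Γ) (τ : Perm ι) (z : ι) :
    holeCost c τ z + c z (τ z) = permCost c τ := by
  rw [holeCost, permCost, add_comm, add_sum_erase univ (fun b => c b (τ b)) (mem_univ z)]

-- This is the effect of an arc from `y` to `z`: row `y` takes over the value of `z`, and `z`
-- becomes the row left out. Leaving out the last row turns the length of an alternating path into a
-- plain sum of costs, which is all that comparisons of sums can handle.
omit [LinearOrder Γ] [IsOrderedAddMonoid Γ] in
theorem holeCost_swap (c : ι → ι → Γ) (τ : Perm ι) {y z : ι} (h : y ≠ z) :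
    holeCost c (τ * swap y z) z + c z (τ z) = holeCost c τ y + c y (τ z) := by
  have e1 : holeCost c (τ * swap y z) z
      = c y (τ z) + ∑ b ∈ (univ.erase z).erase y, c b (τ b) := by
    rw [holeCost, ← add_sum_erase (univ.erase z) _ (show y ∈ univ.erase z by simp [h])]
    congr 1
    · simp
    · refine sum_congr rfl fun b hb => ?_
      simp only [mem_erase] at hb
      simp [swap_apply_of_ne_of_ne hb.1 hb.2.1]
  have e2 : holeCost c τ y = c z (τ z) + ∑ b ∈ (univ.erase z).erase y, c b (τ b) := by
    rw [holeCost, ← add_sum_erase (univ.erase y) _ (show z ∈ univ.erase y by simp [h.symm]),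
      erase_right_comm]
  rw [e1, e2]; abel

/-- `AltPath σ p k z τ`: the permutation `τ` arises from `σ` by shifting the values along a simple
path of `k` arcs from `p` to `z`; the row `z` receives the value of the row `p`. -/
inductive AltPath (σ : Perm ι) (p : ι) : ℕ → ι → Perm ι → Prop
  | zero : AltPath σ p 0 p σ
  | step {k : ℕ} {y z : ι} {τ : Perm ι} : AltPath σ p k y τ → z ≠ p → τ z = σ z →
      AltPath σ p (k + 1) z (τ * swap y z)

namespace AltPath

variable {σ τ : Perm ι} {p y z : ι} {k : ℕ}

omit [Fintype ι] in
theorem apply_end (h : AltPath σ p k z τ) : τ z = σ p := by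
  induction h with
  | zero => rfl
  | step h _ _ ih => simpa using ih

omit [Fintype ι] in
theorem ne_of_step (h : AltPath σ p k y τ) (hz : z ≠ p) (hzσ : τ z = σ z) : y ≠ z := by
  rintro rfl
  exact hz (σ.injective (hzσ.symm.trans h.apply_end))

/-- Each step changes a row that still has its old value and never restores one. This is the
simplicity of the path, and it bounds the number of rounds needed. -/
theorem le_card (h : AltPath σ p k z τ) : k ≤ #{b ∈ univ.erase p | τ b ≠ σ b} := by
  induction h with
  | zero => simp
  | @step k y z τ h hz hzσ ih =>
    have hyz := h.ne_of_step hz hzσ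
    refine lt_of_le_of_lt ih (card_lt_card ?_)
    rw [ssubset_iff]
    refine ⟨z, by simp [hzσ], ?_⟩
    intro b hb
    rw [mem_insert] at hb
    rcases hb with rfl | hb
    · rw [mem_filter, mem_erase, Perm.mul_apply, swap_apply_right, h.apply_end]
      exact ⟨⟨hz, mem_univ _⟩, fun h' => hz (σ.injective h').symm⟩
    · rw [mem_filter] at hb ⊢
      refine ⟨hb.1, ?_⟩
      rw [Perm.mul_apply]
      rcases eq_or_ne b y with rfl | hby
      · rw [swap_apply_left, hzσ]
        exact fun h' => hyz (σ.injective h').symm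
      · rcases eq_or_ne b z with rfl | hbz
        · exact absurd hzσ hb.2
        · rw [swap_apply_of_ne_of_ne hby hbz]; exact hb.2

theorem lt_card (h : AltPath σ p k z τ) : k < Fintype.card ι :=
  calc k ≤ #{b ∈ univ.erase p | τ b ≠ σ b} := h.le_card
    _ ≤ #(univ.erase p) := card_le_card (filter_subset _ _)
    _ < Fintype.card ι := by
      rw [card_erase_of_mem (mem_univ p), card_univ]
      exact Nat.sub_lt (Fintype.card_pos_iff.2 ⟨p⟩) one_pos

-- If the path already visits `z`, an arc from its end `y` back to `z` splits it into the prefix up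
-- to `z`, which is `τ₁`, and a closed alternating cycle, which is `ρ`. The cost identity says that
-- path and prefix differ by the cycle.
omit [LinearOrder Γ] [IsOrderedAddMonoid Γ] in
theorem exists_prefix (c : ι → ι → Γ) (h : AltPath σ p k y τ) (hz : z ≠ p) (hzσ : τ z ≠ σ z) :
    ∃ j ≤ k, ∃ τ₁ ρ : Perm ι, AltPath σ p j z τ₁ ∧ ρ y = σ z ∧ ρ p = σ p ∧
      (∀ b, τ b = σ b → ρ b = σ b) ∧
      holeCost c τ₁ z + holeCost c ρ y = holeCost c τ y + holeCost c σ z := by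
  induction h with
  | zero => exact absurd rfl hzσ
  | @step k x y τ h hy hyσ ih =>
    have hxy := h.ne_of_step hy hyσ
    rcases eq_or_ne z y with rfl | hzy
    · exact ⟨k + 1, le_rfl, _, σ, h.step hy hyσ, rfl, rfl, fun _ _ => rfl, rfl⟩
    have hzτ : τ z ≠ σ z := by
      rcases eq_or_ne z x with rfl | hzx
      · rw [h.apply_end]; exact fun h' => hz (σ.injective h').symm
      · rwa [Perm.mul_apply, swap_apply_of_ne_of_ne hzx hzy] at hzσ
    obtain ⟨j, hj, τ₁, ρ, h₁, hρx, hρp, hρ, hcost⟩ := ih hzτ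
    have hρy := hρ y hyσ
    have hpx : p ≠ x := by
      rintro rfl
      exact hz (σ.injective (hρx.symm.trans hρp))
    -- The prefix is unchanged, and the cycle grows by the new end `y` of the path.
    refine ⟨j, by omega, τ₁, ρ * swap x y, h₁, by simpa using hρx, ?_, ?_, ?_⟩
    · rw [Perm.mul_apply, swap_apply_of_ne_of_ne hpx hy.symm, hρp]
    · intro b hb
      rcases eq_or_ne b x with rfl | hbx
      · rw [Perm.mul_apply, swap_apply_left, hyσ] at hb
        exact absurd (σ.injective hb).symm hxy
      rcases eq_or_ne b y with rfl | hby
      · rw [Perm.mul_apply, swap_apply_right, h.apply_end] at hb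
        exact absurd (σ.injective hb).symm hy
      · rw [Perm.mul_apply, swap_apply_of_ne_of_ne hbx hby] at hb ⊢
        exact hρ b hb
    · have e1 := holeCost_swap c τ hxy
      have e2 := holeCost_swap c ρ hxy
      rw [hyσ] at e1
      rw [hρy] at e2
      have e1' := eq_sub_of_add_eq e1
      have e2' := eq_sub_of_add_eq e2
      rw [e1', e2']
      have := eq_sub_of_add_eq hcost
      rw [this]; abel

/-- If no alternating cycle avoiding `p` has negative cost, then an alternating path followed by an
arc to one of its own vertices can be replaced by a prefix. -/
theorem exists_shortcut {c : ι → ι → Γ}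
    (hσ : ∀ τ : Perm ι, τ p = σ p → permCost c σ ≤ permCost c τ)
    (h : AltPath σ p k y τ) (hz : z ≠ p) (hzσ : τ z ≠ σ z) :
    ∃ j ≤ k, ∃ τ₁ : Perm ι, AltPath σ p j z τ₁ ∧
      holeCost c τ₁ z + c z (σ z) ≤ holeCost c τ y + c y (σ z) := by
  obtain ⟨j, hj, τ₁, ρ, h₁, hρy, hρp, -, hcost⟩ := h.exists_prefix c hz hzσ
  refine ⟨j, hj, τ₁, h₁, ?_⟩
  have h2 := hσ ρ hρp
  rw [← holeCost_add c σ z, ← holeCost_add c ρ y, hρy] at h2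
  have h3 : holeCost c τ₁ z + holeCost c ρ y + (holeCost c σ z + c z (σ z)) ≤
      holeCost c τ y + holeCost c σ z + (holeCost c ρ y + c y (σ z)) := by
    rw [hcost]; exact add_le_add_right h2 _
  have e1 : holeCost c τ₁ z + holeCost c ρ y + (holeCost c σ z + c z (σ z)) =
    (holeCost c ρ y + holeCost c σ z) + (holeCost c τ₁ z + c z (σ z)) := by abel
  have e2 : holeCost c τ y + holeCost c σ z + (holeCost c ρ y + c y (σ z)) =
    (holeCost c ρ y + holeCost c σ z) + (holeCost c τ y + c y (σ z)) := by abel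
  rw [e1, e2] at h3
  exact le_of_add_le_add_left h3

/-- Alternating paths are as good as arbitrary permutations. -/
theorem exists_le_holeCost {c : ι → ι → Γ}
    (hσ : ∀ τ : Perm ι, τ p = σ p → permCost c σ ≤ permCost c τ) (τ : Perm ι) (hz : τ z = σ p) :
    ∃ k τ₁, AltPath σ p k z τ₁ ∧ holeCost c τ₁ z ≤ holeCost c τ z := by
  induction hN : #{b | τ b ≠ σ b} using Nat.strong_induction_on generalizing τ z with
  | _ N ih =>
    rcases eq_or_ne z p with rfl | hzp
    · refine ⟨0, σ, .zero, ?_⟩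
      have := hσ τ hz
      rw [← holeCost_add c σ z, ← holeCost_add c τ z, hz] at this
      exact le_of_add_le_add_right this
    -- Row `y` holds the old value of `z`. Undoing this last arc restores row `z`, so fewer rows
    -- differ from `σ` and the induction applies with end `y`.
    obtain ⟨y, hy⟩ := τ.surjective (σ z)
    have hyz : y ≠ z := by
      rintro rfl
      exact hzp (σ.injective (hy.symm.trans hz))
    have hlt : #{b | (τ * swap y z) b ≠ σ b} < N := by
      rw [← hN]
      refine card_lt_card ?_
      rw [ssubset_iff]
      refine ⟨z, by rw [mem_filter, Perm.mul_apply, swap_apply_right]; simp [hy], ?_⟩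
      intro b hb
      rw [mem_insert, mem_filter] at hb
      simp only [mem_filter, mem_univ, true_and] at hb ⊢
      rcases hb with rfl | hb
      · rw [hz]; exact fun h' => hzp (σ.injective h').symm
      rcases eq_or_ne b y with rfl | hby
      · rw [hy]; exact fun h' => hyz (σ.injective h').symm
      rcases eq_or_ne b z with rfl | hbz
      · rw [hz]; exact fun h' => hzp (σ.injective h').symm
      · rwa [Perm.mul_apply, swap_apply_of_ne_of_ne hby hbz] at hb
    obtain ⟨k, τ₁, h₁, hc₁⟩ := ih _ hlt (τ * swap y z) (z := y) (by simpa using hz) rfl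
    have e1 := holeCost_swap c (τ * swap y z) hyz
    have e0 : τ * swap y z * swap y z = τ := by simp [mul_assoc]
    have e2 : (τ * swap y z) z = σ z := by simpa using hy
    rw [e0, e2] at e1
    have key : holeCost c τ₁ y + c y (σ z) ≤ holeCost c τ z + c z (σ z) := by
      rw [e1]; exact add_le_add_left hc₁ _
    -- The path found for `y` can be extended by the arc to `z` if it does not visit `z` yet;
    -- otherwise its prefix up to `z` is at least as good.
    by_cases hτ₁ : τ₁ z = σ z
    · refine ⟨_, _, h₁.step hzp hτ₁, ?_⟩
      have e3 := holeCost_swap c τ₁ hyz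
      rw [hτ₁] at e3
      rw [← e3] at key
      exact le_of_add_le_add_right key
    · obtain ⟨j, -, τ₂, h₂, hc₂⟩ := h₁.exists_shortcut hσ hzp hτ₁
      exact ⟨j, τ₂, h₂, le_of_add_le_add_right (hc₂.trans key)⟩

end AltPath

/-- One round of the Bellman-Ford method: `D'` is obtained from `D` by relaxing all arcs. -/
def IsRelaxation (c : ι → ι → Γ) (σ : Perm ι) (p : ι) (D D' : ι → Perm ι) : Prop :=
  ∀ z, (D' z = D z ∨ ∃ y, D y z = σ z ∧ z ≠ p ∧ D' z = D y * swap y z) ∧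
    holeCost c (D' z) z ≤ holeCost c (D z) z ∧
    ∀ y, D y z = σ z → z ≠ p → holeCost c (D' z) z ≤ holeCost c (D y * swap y z) z

/-- Each `D z` is an alternating path to `z` of at most `k` arcs, and best among these. -/
def IsShortest (c : ι → ι → Γ) (σ : Perm ι) (p : ι) (k : ℕ) (D : ι → Perm ι) : Prop :=
  ∀ z, (∃ j ≤ k, AltPath σ p j z (D z)) ∧
    ∀ j ≤ k, ∀ τ, AltPath σ p j z τ → holeCost c (D z) z ≤ holeCost c τ z

-- The start of Bellman-Ford with paths of at most one arc. For `z = p` the transposition is trivial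
-- and represents the empty path.
omit [IsOrderedAddMonoid Γ] in
theorem isShortest_swap (c : ι → ι → Γ) (σ : Perm ι) (p : ι) :
    IsShortest c σ p 1 (fun z => σ * swap p z) := by
  intro z
  rcases eq_or_ne z p with rfl | hz
  · refine ⟨⟨0, by omega, by simp only [swap_self]; exact .zero⟩, ?_⟩
    intro j _ τ h
    cases h with
    | zero => simp only [swap_self]; rfl
    | step _ h _ => exact absurd rfl h
  · refine ⟨⟨1, le_rfl, AltPath.step .zero hz rfl⟩, ?_⟩
    intro j hj τ h
    cases h with
    | zero => exact absurd rfl hz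
    | @step k y _ τ h _ _ =>
      obtain rfl : k = 0 := by omega
      cases h; rfl

/-- The Bellman-Ford step. Replacing the path to `y` by the stored one may produce a path that
already visits `z`, so that the arc to `z` cannot be appended. In that case `exists_shortcut`
supplies a prefix ending at `z` that is no more expensive and that `D z` has already beaten. -/
theorem IsShortest.relax {c : ι → ι → Γ} {σ : Perm ι} {p : ι} {k : ℕ} {D D' : ι → Perm ι}
    (hσ : ∀ τ : Perm ι, τ p = σ p → permCost c σ ≤ permCost c τ)
    (hD : IsShortest c σ p k D) (h : IsRelaxation c σ p D D') :
    IsShortest c σ p (k + 1) D' := by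
  intro z
  obtain ⟨h1, h2, h3⟩ := h z
  refine ⟨?_, ?_⟩
  · rcases h1 with h1 | ⟨y, hy, hz, h1⟩
    · obtain ⟨j, hj, hp⟩ := (hD z).1
      exact ⟨j, by omega, h1 ▸ hp⟩
    · obtain ⟨j, hj, hp⟩ := (hD y).1
      exact ⟨j + 1, by omega, h1 ▸ hp.step hz hy⟩
  · intro j hj τ hτ
    cases hτ with
    | zero => exact h2.trans ((hD _).2 0 (by omega) _ .zero)
    | @step j y _ τ hτ hz hzσ =>
      have hle := (hD y).2 j (by omega) τ hτ
      have hyz := hτ.ne_of_step hz hzσ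
      have e := holeCost_swap c τ hyz
      rw [hzσ] at e
      have key : holeCost c (D y) y + c y (σ z) ≤ holeCost c (τ * swap y z) z + c z (σ z) := by
        rw [e]; exact add_le_add_left hle _
      by_cases hy : D y z = σ z
      · have e' := holeCost_swap c (D y) hyz
        rw [hy] at e'
        rw [← e'] at key
        exact (h3 y hy hz).trans (le_of_add_le_add_right key)
      · obtain ⟨i, hi, hp⟩ := (hD y).1
        obtain ⟨l, hl, τ₁, hτ₁, hc⟩ := hp.exists_shortcut hσ hz hy
        exact h2.trans (((hD z).2 l (by omega) τ₁ hτ₁).trans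
          (le_of_add_le_add_right (hc.trans key)))

/-- If `z` is the row to which `τ` gives the value `σ p`, then `D z` makes the same choice in row
`z`, and it suffices to compare the remaining rows. -/
theorem IsShortest.permCost_le {c : ι → ι → Γ} {σ : Perm ι} {p : ι} {D : ι → Perm ι} {k : ℕ}
    (hσ : ∀ τ : Perm ι, τ p = σ p → permCost c σ ≤ permCost c τ)
    (hD : IsShortest c σ p k D) (hk : Fintype.card ι ≤ k) (τ : Perm ι) :
    ∃ z, permCost c (D z) ≤ permCost c τ := by
  obtain ⟨z, hz⟩ := τ.surjective (σ p)
  refine ⟨z, ?_⟩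
  obtain ⟨j, τ₁, h₁, hc⟩ := AltPath.exists_le_holeCost hσ τ hz
  obtain ⟨i, -, hi⟩ := (hD z).1
  rw [← holeCost_add c (D z) z, ← holeCost_add c τ z, hz, hi.apply_end]
  exact add_le_add_left (((hD z).2 j (h₁.lt_card.le.trans hk) τ₁ h₁).trans hc) _

end Assignment

end

end RootedCycleBasis

/-! ### Graph theory of greedy sequences: exchange, ears, cycle bases -/

namespace RootedCycleBasis

noncomputable section

/-! ### Rooted cycles as paths between the ends of the root edge -/

section Paths

open SimpleGraph

variable {V M : Type*} {G : SimpleGraph V} [AddCommMonoid M]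

/-- The sum of a function over the edges of a walk. -/
def pathSum (g : Sym2 V → M) {a b : V} (P : G.Walk a b) : M := (P.edges.map g).sum

@[simp] theorem pathSum_append (g : Sym2 V → M) {a b c : V} (P : G.Walk a b) (Q : G.Walk b c) :
    pathSum g (P.append Q) = pathSum g P + pathSum g Q := by
  simp [pathSum]

@[simp] theorem pathSum_reverse (g : Sym2 V → M) {a b : V} (P : G.Walk a b) :
    pathSum g P.reverse = pathSum g P := by
  simp [pathSum, List.sum_reverse]

@[simp] theorem pathSum_nil (g : Sym2 V → M) (a : V) :
    pathSum g (Walk.nil : G.Walk a a) = 0 := by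
  simp [pathSum]

@[simp] theorem pathSum_cons (g : Sym2 V → M) {a b c : V} (h : G.Adj a b) (P : G.Walk b c) :
    pathSum g (Walk.cons h P) = g s(a, b) + pathSum g P := by
  simp [pathSum]

theorem isPath_append_iff {a b c : V} (P : G.Walk a b) (Q : G.Walk b c) :
    (P.append Q).IsPath ↔
      P.IsPath ∧ Q.IsPath ∧ ∀ x ∈ P.support, x ∈ Q.support → x = b := by
  simp only [Walk.isPath_def, Walk.support_append, List.nodup_append]
  have hQ : Q.support = b :: Q.support.tail := Q.cons_tail_support.symm
  constructor
  · rintro ⟨h1, h2, h3⟩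
    have hb : b ∉ Q.support.tail := fun hb => h3 b P.end_mem_support b hb rfl
    refine ⟨h1, ?_, ?_⟩
    · rw [hQ]; exact List.nodup_cons.2 ⟨hb, h2⟩
    · intro x hx hxQ
      rw [hQ, List.mem_cons] at hxQ
      rcases hxQ with rfl | hxQ
      · rfl
      · exact absurd rfl (h3 x hx x hxQ)
  · rintro ⟨h1, h2, h3⟩
    rw [hQ, List.nodup_cons] at h2
    refine ⟨h1, h2.2, ?_⟩
    rintro x hx _ hxQ rfl
    obtain rfl := h3 x hx (List.mem_of_mem_tail hxQ)
    exact h2.1 hxQ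

/-- A path visits `b` only once, so `takeUntil` recovers the first part from the whole. -/
theorem append_injective {a b c : V} {P P' : G.Walk a b} {Q Q' : G.Walk b c}
    (hP : (P.append Q).IsPath) (h : P.append Q = P'.append Q') : P = P' ∧ Q = Q' := by
  classical
  have key : ∀ {P : G.Walk a b}, P.IsPath → P.takeUntil b P.end_mem_support = P := by
    intro P hP
    have h1 := P.take_spec P.end_mem_support
    have h2 := Walk.isPath_iff_nil.1 (hP.dropUntil P.end_mem_support)
    rw [← Walk.eq_nil_iff_nil] at h2
    rw [h2, Walk.append_nil] at h1
    exact h1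
  have hP' : (P'.append Q').IsPath := h ▸ hP
  have e : P = P' := by
    rw [← key hP.of_append_left, ← key hP'.of_append_left,
      ← Walk.takeUntil_append_of_mem_left P Q, ← Walk.takeUntil_append_of_mem_left P' Q']
    simp only [h]
  refine ⟨e, Walk.ext_support ?_⟩
  subst e
  have h3 := congrArg Walk.support h
  rw [Walk.support_append, Walk.support_append, List.append_cancel_left_eq] at h3
  rw [← Q.cons_tail_support, ← Q'.cons_tail_support, h3]

/-- The rooted cycle formed by a path and the root edge that joins its ends. -/
def closePath {u v : V} (h : G.Adj v u) (P : G.Walk u v) : G.Subgraph := (Walk.cons h P).toSubgraph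

theorem edgeSet_closePath {u v : V} (h : G.Adj v u) (P : G.Walk u v) :
    (closePath h P).edgeSet = {f | f = s(u, v) ∨ f ∈ P.edges} := by
  ext f
  rw [closePath, Walk.mem_edges_toSubgraph, Walk.edges_cons, List.mem_cons, Sym2.eq_swap]
  rfl

theorem verts_closePath {u v : V} (h : G.Adj v u) (P : G.Walk u v) :
    (closePath h P).verts = {x | x ∈ P.support} := by
  ext x
  rw [closePath, Walk.mem_verts_toSubgraph, Walk.support_cons, List.mem_cons]
  constructor
  · rintro (rfl | hx)
    exacts [P.end_mem_support, hx]
  · exact Or.inr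

theorem isRootedCycle_closePath {u v : V} (h : G.Adj v u) {P : G.Walk u v} (hP : P.IsPath)
    (he : s(u, v) ∉ P.edges) : IsRootedCycle s(u, v) (closePath h P) := by
  have hc : (Walk.cons h P).IsCycle := by
    rw [Walk.cons_isCycle_iff, Sym2.eq_swap]
    exact ⟨hP, he⟩
  refine ⟨⟨Walk.toSubgraph_connected _, fun x hx => ?_⟩, ?_⟩
  · exact hc.ncard_neighborSet_toSubgraph_eq_two ((Walk.mem_verts_toSubgraph _).1 hx)
  · rw [edgeSet_closePath]; exact Or.inl rfl

/-- A subgraph that is closed under adjacency in a connected subgraph is all of it. -/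
theorem eq_of_le_of_connected {K D : G.Subgraph} (hle : K ≤ D) (hD : D.Connected)
    (hK : K.verts.Nonempty) (h : ∀ x ∈ K.verts, ∀ y, D.Adj x y → K.Adj x y) : K = D := by
  obtain ⟨x₀, hx₀⟩ := hK
  have hv : ∀ y ∈ D.verts, y ∈ K.verts := by
    intro y hy
    obtain ⟨W⟩ := hD.coe.preconnected ⟨x₀, hle.1 hx₀⟩ ⟨y, hy⟩
    have : ∀ (a b : D.verts), D.coe.Walk a b → (a : V) ∈ K.verts → (b : V) ∈ K.verts := by
      intro a b W
      induction W with
      | nil => exact id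
      | cons hab _ ih => exact fun ha => ih (K.edge_vert (h _ ha _ hab).symm)
    exact this _ _ W hx₀
  refine le_antisymm hle ⟨hv, fun x y hxy => h x (hv x (D.edge_vert hxy)) y hxy⟩

/-- In a graph whose degrees are zero or two, the ends of a deleted edge remain connected; this
gives the path. Together with the root edge it is a 2-regular subgraph of `D`, hence closed under
adjacency in `D`, hence all of `D`. -/
theorem IsRootedCycle.exists_path [Finite V] {u v : V} (h : G.Adj v u) {D : G.Subgraph}
    (hD : IsRootedCycle s(u, v) D) :
    ∃ P : G.Walk u v, P.IsPath ∧ s(u, v) ∉ P.edges ∧ D = closePath h P := by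
  classical
  obtain ⟨⟨hconn, hdeg⟩, he⟩ := hD
  have hcyc : D.spanningCoe.IsCycles := by
    rintro x ⟨y, hy⟩
    exact hdeg x (D.edge_vert hy)
  have huv : D.spanningCoe.Adj u v := he
  obtain ⟨W⟩ := hcyc.reachable_deleteEdges huv
  have hle : D.spanningCoe.deleteEdges {s(u, v)} ≤ D.spanningCoe := deleteEdges_le _
  let P₁ := W.toPath.1.mapLe hle
  have hP₁ : P₁.IsPath := W.toPath.2.mapLe hle
  have he₁ : s(u, v) ∉ P₁.edges := by
    intro hmem
    rw [Walk.edges_mapLe_eq_edges] at hmem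
    have := Walk.edges_subset_edgeSet _ hmem
    rw [edgeSet_deleteEdges] at this
    exact this.2 rfl
  have hle₂ : D.spanningCoe ≤ G := D.spanningCoe_le
  let P := P₁.mapLe hle₂
  have hP : P.IsPath := hP₁.mapLe hle₂
  have heP : s(u, v) ∉ P.edges := by rwa [Walk.edges_mapLe_eq_edges]
  have hsub : ∀ f ∈ P.edges, f ∈ D.edgeSet := by
    intro f hf
    rw [Walk.edges_mapLe_eq_edges] at hf
    have := Walk.edges_subset_edgeSet _ hf
    rwa [Subgraph.edgeSet_spanningCoe] at this
  have hK := isRootedCycle_closePath h hP heP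
  refine ⟨P, hP, heP, (eq_of_le_of_connected ?_ hconn hK.1.1.nonempty ?_).symm⟩
  · have hadj : ∀ x y, (closePath h P).Adj x y → D.Adj x y := by
      intro x y hxy
      have hxy' : s(x, y) ∈ (closePath h P).edgeSet := hxy
      rw [edgeSet_closePath] at hxy'
      rcases hxy' with hxy' | hxy'
      · have : s(x, y) ∈ D.edgeSet := hxy' ▸ he
        exact this
      · exact hsub _ hxy'
    refine ⟨fun x hx => ?_, fun x y => hadj x y⟩
    have h2 := hK.1.2 x hx
    obtain ⟨y, hy⟩ := Set.nonempty_of_ncard_ne_zero (by rw [h2]; norm_num)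
    exact D.edge_vert (hadj x y hy)
  · intro x hx y hxy
    have h2 := hK.1.2 x hx
    have hsub' : (closePath h P).neighborSet x ⊆ D.neighborSet x := by
      intro z hz
      have hz' : s(x, z) ∈ (closePath h P).edgeSet := hz
      rw [edgeSet_closePath] at hz'
      rcases hz' with hz' | hz'
      · have : s(x, z) ∈ D.edgeSet := hz' ▸ he
        exact this
      · exact hsub _ hz'
    obtain ⟨z, hz⟩ := Set.nonempty_of_ncard_ne_zero (by rw [h2]; norm_num)
    have h3 := hdeg x (D.edge_vert (hsub' hz))
    have h4 := Set.eq_of_subset_of_ncard_le hsub' (by rw [h2, h3])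
    have : y ∈ (closePath h P).neighborSet x := h4 ▸ hxy
    exact this

theorem finsum_edgeSet_closePath {u v : V} (h : G.Adj v u) {P : G.Walk u v} (hP : P.IsPath)
    (he : s(u, v) ∉ P.edges) (g : Sym2 V → M) :
    ∑ᶠ f ∈ (closePath h P).edgeSet, g f = g s(u, v) + pathSum g P := by
  classical
  have hnd : (s(u, v) :: P.edges).Nodup := List.nodup_cons.2 ⟨he, hP.isTrail.edges_nodup⟩
  have : (closePath h P).edgeSet = ↑(s(u, v) :: P.edges).toFinset := by
    rw [edgeSet_closePath]; ext f; simp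
  rw [this, finsum_mem_coe_finset, List.sum_toFinset g hnd]
  simp [pathSum]

theorem ncard_sdiff_closePath {u v : V} (h : G.Adj v u) {P : G.Walk u v} (hP : P.IsPath)
    (he : s(u, v) ∉ P.edges) (S : Set (Sym2 V)) :
    ((closePath h P).edgeSet \ S).ncard =
      Sᶜ.indicator 1 s(u, v) + pathSum (Sᶜ.indicator (1 : Sym2 V → ℕ)) P := by
  classical
  rw [← finsum_edgeSet_closePath h hP he]
  have hfin : ((closePath h P).edgeSet \ S).Finite := by
    rw [edgeSet_closePath]
    refine Set.Finite.subset (List.finite_toSet (s(u, v) :: P.edges)) ?_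
    intro f hf
    simpa using hf.1
  rw [Set.ncard_eq_toFinset_card _ hfin, Finset.card_eq_sum_ones, ← finsum_mem_coe_finset,
    hfin.coe_toFinset, finsum_mem_def, finsum_mem_def]
  refine finsum_congr fun f => ?_
  by_cases hf : f ∈ (closePath h P).edgeSet <;> by_cases hS : f ∈ S <;> simp [hf, hS]

theorem exists_mem_edges_of_mem_support {a b x : V} {P : G.Walk a b} (hx : x ∈ P.support)
    (hab : a ≠ b) : ∃ f ∈ P.edges, x ∈ f := by
  rcases Walk.mem_support_iff_exists_mem_edges.1 hx with rfl | h
  · have hr : x ∈ P.reverse.support := by simp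
    cases hP : P.reverse with
    | nil => exact absurd rfl hab
    | @cons _ y _ h' Q =>
      refine ⟨s(x, y), ?_, Sym2.mem_mk_left _ _⟩
      have : s(x, y) ∈ P.reverse.edges := by rw [hP]; simp
      simpa using this
  · exact h

theorem mem_support_of_mem_mem_edges {a b x : V} {P : G.Walk a b} {f : Sym2 V}
    (hf : f ∈ P.edges) (hx : x ∈ f) : x ∈ P.support :=
  Walk.mem_support_iff_exists_mem_edges.2 (Or.inr ⟨f, hf, hx⟩)

end Paths

end

end RootedCycleBasis

namespace RootedCycleBasis

noncomputable section

/-! ### Segments of paths and their exchange -/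

section Segments

open SimpleGraph

variable {V : Type*} {G : SimpleGraph V} {u v a b : V}

/-- `T` is a segment of `P`, read in one direction or the other. -/
def IsSegment (P : G.Walk u v) (T : G.Walk a b) : Prop :=
  (∃ (A : G.Walk u a) (B : G.Walk b v), P = A.append (T.append B)) ∨
    ∃ (A : G.Walk u b) (B : G.Walk a v), P = A.append (T.reverse.append B)

theorem exists_isSegment {P : G.Walk u v} (ha : a ∈ P.support) (hb : b ∈ P.support) :
    ∃ T : G.Walk a b, IsSegment P T := by
  obtain ⟨A, B, rfl⟩ := Walk.mem_support_iff_exists_append.1 ha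
  rcases (Walk.mem_support_append_iff A B).1 hb with hb | hb
  · obtain ⟨A₁, A₂, rfl⟩ := Walk.mem_support_iff_exists_append.1 hb
    exact ⟨A₂.reverse, Or.inr ⟨A₁, B, by simp [Walk.append_assoc]⟩⟩
  · obtain ⟨B₁, B₂, rfl⟩ := Walk.mem_support_iff_exists_append.1 hb
    exact ⟨B₁, Or.inl ⟨A, B₂, rfl⟩⟩

namespace IsSegment

variable {P : G.Walk u v} {T : G.Walk a b}

theorem reverse (h : IsSegment P T) : IsSegment P T.reverse := by
  rcases h with ⟨A, B, h⟩ | ⟨A, B, h⟩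
  · exact Or.inr ⟨A, B, by simpa using h⟩
  · exact Or.inl ⟨A, B, h⟩

theorem isPath (h : IsSegment P T) (hP : P.IsPath) : T.IsPath := by
  rcases h with ⟨A, B, rfl⟩ | ⟨A, B, rfl⟩
  · exact hP.of_append_right.of_append_left
  · exact T.isPath_reverse_iff.1 hP.of_append_right.of_append_left

theorem mem_support (h : IsSegment P T) {x : V} (hx : x ∈ T.support) : x ∈ P.support := by
  rcases h with ⟨A, B, rfl⟩ | ⟨A, B, rfl⟩ <;> simp [Walk.mem_support_append_iff, hx]

theorem mem_edges (h : IsSegment P T) {f : Sym2 V} (hf : f ∈ T.edges) : f ∈ P.edges := by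
  rcases h with ⟨A, B, rfl⟩ | ⟨A, B, rfl⟩ <;> simp [Walk.edges_append, hf]

theorem of_append {c : V} {T₁ : G.Walk a c} {T₂ : G.Walk c b} (h : IsSegment P (T₁.append T₂)) :
    IsSegment P T₁ ∧ IsSegment P T₂ := by
  rcases h with ⟨A, B, rfl⟩ | ⟨A, B, rfl⟩
  · exact ⟨Or.inl ⟨A, T₂.append B, by simp [Walk.append_assoc]⟩,
      Or.inl ⟨A.append T₁, B, by simp [Walk.append_assoc]⟩⟩
  · exact ⟨Or.inr ⟨A.append T₂.reverse, B, by simp [Walk.append_assoc]⟩,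
      Or.inr ⟨A, T₁.reverse.append B, by simp [Walk.append_assoc]⟩⟩

end IsSegment

/-- Replacing a segment of a path by a detour that avoids the rest of the path. -/
theorem exists_splice {P : G.Walk u v} {T R : G.Walk a b} (hP : P.IsPath) (hT : IsSegment P T)
    (hR : R.IsPath) (hd : ∀ x ∈ R.support, x ∈ P.support → x = a ∨ x = b) (hab : a ≠ b) :
    ∃ P' : G.Walk u v, P'.IsPath ∧ (∀ f ∈ P'.edges, f ∈ P.edges ∨ f ∈ R.edges) ∧
      a ∈ P'.support ∧ b ∈ P'.support ∧
      ∀ {M : Type} [AddCommMonoid M] (g : Sym2 V → M),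
        pathSum g P' + pathSum g T = pathSum g P + pathSum g R := by
  wlog h : ∃ (A : G.Walk u a) (B : G.Walk b v), P = A.append (T.append B) generalizing a b
  · have h2 : ∃ (A : G.Walk u b) (B : G.Walk a v), P = A.append (T.reverse.append B) := by
      rcases hT with h' | h'
      · exact absurd h' h
      · exact h'
    obtain ⟨P', h3, h4, h5, h5', h6⟩ := this (T := T.reverse) (R := R.reverse) hT.reverse
      (R.isPath_reverse_iff.2 hR)
      (fun x hx hxP => (hd x (by simpa using hx) hxP).symm) hab.symm h2
    exact ⟨P', h3, by simpa using h4, h5', h5, fun g => by simpa using h6 g⟩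
  obtain ⟨A, B, rfl⟩ := h
  rw [isPath_append_iff, isPath_append_iff] at hP
  obtain ⟨hA, ⟨hTp, hB, hTB⟩, hATB⟩ := hP
  refine ⟨A.append (R.append B), ?_, ?_, ?_, ?_, ?_⟩
  · rw [isPath_append_iff, isPath_append_iff]
    refine ⟨hA, ⟨hR, hB, ?_⟩, ?_⟩
    · intro x hx hxB
      rcases hd x hx (by simp [Walk.mem_support_append_iff, hxB]) with rfl | rfl
      · exact hTB x T.start_mem_support hxB
      · rfl
    · intro x hx hxB
      rcases (Walk.mem_support_append_iff _ _).1 hxB with hxR | hxB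
      · rcases hd x hxR (by simp [Walk.mem_support_append_iff, hx]) with rfl | rfl
        · rfl
        · exact hATB x hx (by simp [Walk.mem_support_append_iff])
      · exact hATB x hx (by simp [Walk.mem_support_append_iff, hxB])
  · intro f hf
    simp only [Walk.edges_append, List.mem_append] at hf ⊢
    tauto
  · simp [Walk.mem_support_append_iff]
  · simp [Walk.mem_support_append_iff]
  · intro M _ g
    simp only [pathSum_append]
    abel

theorem pathSum_pos {w : Sym2 V → ℝ} (hw : ∀ f ∈ G.edgeSet, 0 < w f) (T : G.Walk a b)
    (hab : a ≠ b) : 0 < pathSum w T := by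
  have hnn : ∀ {c d : V} (T : G.Walk c d), 0 ≤ pathSum w T := by
    intro c d T
    refine List.sum_nonneg fun x hx => ?_
    obtain ⟨f, hf, rfl⟩ := List.mem_map.1 hx
    exact (hw f (T.edges_subset_edgeSet hf)).le
  cases T with
  | nil => exact absurd rfl hab
  | cons h T =>
    rw [pathSum_cons]
    exact add_pos_of_pos_of_nonneg (hw _ h) (hnn T)

theorem pathSum_nonneg {w : Sym2 V → ℝ} (hw : ∀ f ∈ G.edgeSet, 0 < w f) (T : G.Walk a b) :
    0 ≤ pathSum w T := by
  refine List.sum_nonneg fun x hx => ?_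
  obtain ⟨f, hf, rfl⟩ := List.mem_map.1 hx
  exact (hw f (T.edges_subset_edgeSet hf)).le

open Classical in
/-- The weight of the part of a path before a vertex. -/
def prefixSum (w : Sym2 V → ℝ) (P : G.Walk u v) (x : V) : ℝ :=
  if hx : x ∈ P.support then pathSum w (P.takeUntil x hx) else 0

theorem prefixSum_append (w : Sym2 V → ℝ) {x : V} {A : G.Walk u x} {B : G.Walk x v}
    (hP : (A.append B).IsPath) : prefixSum w (A.append B) x = pathSum w A := by
  classical
  have hx : x ∈ (A.append B).support := by simp [Walk.mem_support_append_iff]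
  rw [prefixSum, dif_pos hx]
  congr 1
  exact (append_injective hP ((A.append B).take_spec hx).symm).1.symm

/-- The weight of a segment depends on its ends only, so a lightest segment can be found by
minimizing over pairs of vertices. -/
theorem IsSegment.pathSum_eq {w : Sym2 V → ℝ} (hw : ∀ f ∈ G.edgeSet, 0 < w f) {P : G.Walk u v}
    {T : G.Walk a b} (hP : P.IsPath) (hT : IsSegment P T) :
    pathSum w T = |prefixSum w P b - prefixSum w P a| := by
  have hnn := pathSum_nonneg hw T
  rcases hT with ⟨A, B, rfl⟩ | ⟨A, B, rfl⟩
  · have h1 := prefixSum_append w hP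
    rw [Walk.append_assoc] at hP
    have h2 := prefixSum_append w hP
    rw [← Walk.append_assoc] at h2
    rw [h1, h2, pathSum_append, add_sub_cancel_left, abs_of_nonneg hnn]
  · have h1 := prefixSum_append w hP
    rw [Walk.append_assoc] at hP
    have h2 := prefixSum_append w hP
    rw [← Walk.append_assoc] at h2
    rw [h1, h2, pathSum_append, pathSum_reverse, sub_add_cancel_left, abs_neg, abs_of_nonneg hnn]

/-- The number of edges of a walk outside `S`. -/
abbrev newCount (S : Set (Sym2 V)) (P : G.Walk a b) : ℕ :=
  pathSum (Sᶜ.indicator (1 : Sym2 V → ℕ)) P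

theorem newCount_pos {S : Set (Sym2 V)} {P : G.Walk a b} :
    0 < newCount S P ↔ ∃ f ∈ P.edges, f ∉ S := by
  rw [Nat.pos_iff_ne_zero, ne_eq, newCount, pathSum, List.sum_eq_zero_iff]
  simp

/-- `x` splits `P` into two parts that both have edges outside `S`. -/
def SplitsNew (S : Set (Sym2 V)) (P : G.Walk u v) (x : V) : Prop :=
  ∃ (A : G.Walk u x) (B : G.Walk x v), P = A.append B ∧ 0 < newCount S A ∧ 0 < newCount S B

theorem splitsNew_append {S : Set (Sym2 V)} {x : V} {A : G.Walk u x} {B : G.Walk x v}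
    (hP : (A.append B).IsPath) :
    SplitsNew S (A.append B) x ↔ 0 < newCount S A ∧ 0 < newCount S B := by
  constructor
  · rintro ⟨A', B', h, h'⟩
    obtain ⟨rfl, rfl⟩ := append_injective hP h
    exact h'
  · exact fun h => ⟨A, B, rfl, h⟩

/-- All new edges lie on one side of `a`, and since `b` has new edges on both sides, that side must
be the one containing `T`. The part between `a` and `b` therefore holds some new edges, and those
beyond `b` are missing from it. -/
theorem IsSegment.newCount_lt {S : Set (Sym2 V)} {P : G.Walk u v} {T : G.Walk a b} (hP : P.IsPath)
    (hT : IsSegment P T) (ha : ¬ SplitsNew S P a) (hb : SplitsNew S P b) :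
    0 < newCount S T ∧ newCount S T < newCount S P := by
  rcases hT with ⟨A, B, rfl⟩ | ⟨A, B, rfl⟩
  · rw [splitsNew_append hP] at ha
    rw [Walk.append_assoc] at hP hb
    rw [splitsNew_append hP] at hb
    simp only [newCount, pathSum_append] at ha hb ⊢
    omega
  · rw [splitsNew_append hP] at hb
    rw [Walk.append_assoc] at hP ha
    rw [splitsNew_append hP] at ha
    simp only [newCount, pathSum_append, pathSum_reverse] at ha hb ⊢
    omega

/-- A vertex strictly inside a segment cuts off a strictly lighter segment. -/
theorem IsSegment.exists_lt {w : Sym2 V → ℝ} (hw : ∀ f ∈ G.edgeSet, 0 < w f) {P : G.Walk u v}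
    {T : G.Walk a b} (hT : IsSegment P T) {x : V} (hx : x ∈ T.support) (hxa : x ≠ a)
    (hxb : x ≠ b) :
    (∃ T₁ : G.Walk a x, IsSegment P T₁ ∧ pathSum w T₁ < pathSum w T) ∧
      ∃ T₂ : G.Walk x b, IsSegment P T₂ ∧ pathSum w T₂ < pathSum w T := by
  obtain ⟨T₁, T₂, rfl⟩ := Walk.mem_support_iff_exists_append.1 hx
  have h1 := pathSum_pos hw T₁ hxa.symm
  have h2 := pathSum_pos hw T₂ hxb
  refine ⟨⟨T₁, hT.of_append.1, ?_⟩, ⟨T₂, hT.of_append.2, ?_⟩⟩ <;> rw [pathSum_append] <;> linarith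

/-- The exchange argument behind the ear property: a vertex that two shortest paths share
cannot split the new edges of the later one. -/
theorem not_splitsNew {w : Sym2 V → ℝ} (hw : ∀ f ∈ G.edgeSet, 0 < w f) {S : Set (Sym2 V)}
    {e : Sym2 V} {P Q : G.Walk u v} (hP : P.IsPath) (hQ : Q.IsPath) (heP : e ∉ P.edges)
    (heQ : e ∉ Q.edges) (hQS : ∀ f ∈ Q.edges, f ∈ S)
    (hPmin : ∀ P' : G.Walk u v, P'.IsPath → e ∉ P'.edges → 0 < newCount S P' →
      pathSum w P ≤ pathSum w P' ∧ (pathSum w P = pathSum w P' → newCount S P ≤ newCount S P'))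
    (hQmin : ∀ Q' : G.Walk u v, Q'.IsPath → e ∉ Q'.edges →
      (∃ x ∈ Q'.support, x ∈ Q.support ∧ SplitsNew S P x) → pathSum w Q ≤ pathSum w Q')
    {x : V} (hxQ : x ∈ Q.support) : ¬ SplitsNew S P x := by
  classical
  intro hx
  have hxP : x ∈ P.support := by
    obtain ⟨A, B, rfl, -⟩ := hx
    simp [Walk.mem_support_append_iff]
  have hu : ¬ SplitsNew S P u := by
    have : SplitsNew S (Walk.nil.append P) u ↔ _ := splitsNew_append (by simpa using hP)
    rw [Walk.nil_append] at this
    rw [this]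
    simp
  -- Pairs of common vertices of which only the second splits the new edges. The point of the mixed
  -- condition is that a further common vertex inside a segment forms such a pair with one of the
  -- two ends, so a lightest segment on either path meets the other path in its ends only.
  let F : Finset (V × V) := {q ∈ P.support.toFinset ×ˢ P.support.toFinset |
    q.1 ∈ Q.support ∧ q.2 ∈ Q.support ∧ ¬ SplitsNew S P q.1 ∧ SplitsNew S P q.2}
  have memF : ∀ a b, (a, b) ∈ F ↔ (a ∈ P.support ∧ b ∈ P.support) ∧
      a ∈ Q.support ∧ b ∈ Q.support ∧ ¬ SplitsNew S P a ∧ SplitsNew S P b := by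
    intro a b; simp [F]
  have hF : F.Nonempty :=
    ⟨(u, x), (memF _ _).2 ⟨⟨P.start_mem_support, hxP⟩, Q.start_mem_support, hxQ, hu, hx⟩⟩
  obtain ⟨⟨a, b⟩, hab, habmin⟩ :=
    F.exists_min_image (fun q => |prefixSum w P q.2 - prefixSum w P q.1|) hF
  obtain ⟨⟨a', b'⟩, hab', habmin'⟩ :=
    F.exists_min_image (fun q => |prefixSum w Q q.2 - prefixSum w Q q.1|) hF
  have hmem := (memF a b).1 hab
  have hmem' := (memF a' b').1 hab'
  have hne : a ≠ b := by rintro rfl; exact hmem.2.2.2.1 hmem.2.2.2.2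
  have hne' : a' ≠ b' := by rintro rfl; exact hmem'.2.2.2.1 hmem'.2.2.2.2
  have segQ : ∀ {a b}, (a, b) ∈ F → ∃ T : G.Walk a b, IsSegment Q T := fun h =>
    exists_isSegment ((memF _ _).1 h).2.1 ((memF _ _).1 h).2.2.1
  have segP : ∀ {a b}, (a, b) ∈ F → ∃ T : G.Walk a b, IsSegment P T := fun h =>
    exists_isSegment ((memF _ _).1 h).1.1 ((memF _ _).1 h).1.2
  obtain ⟨TP, hTP⟩ := segP hab
  obtain ⟨TQ, hTQ⟩ := segQ hab
  obtain ⟨TP', hTP'⟩ := segP hab'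
  obtain ⟨TQ', hTQ'⟩ := segQ hab'
  -- the lightest segment of `P` between such vertices can replace a segment of `Q`
  have h1 : pathSum w TQ ≤ pathSum w TP := by
    obtain ⟨Q', h3, h4, -, h5, h6⟩ := exists_splice hQ hTQ (hTP.isPath hP) (fun y hy hyQ => by
      by_contra! hyab
      obtain ⟨⟨T₁, hT₁, hlt₁⟩, T₂, hT₂, hlt₂⟩ := hTP.exists_lt hw hy hyab.1 hyab.2
      by_cases hyS : SplitsNew S P y
      · have := habmin (a, y)
          ((memF _ _).2 ⟨⟨hmem.1.1, hTP.mem_support hy⟩, hmem.2.1, hyQ, hmem.2.2.2.1, hyS⟩)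
        simp only [← hTP.pathSum_eq hw hP, ← hT₁.pathSum_eq hw hP] at this
        exact absurd this (not_le.2 hlt₁)
      · have := habmin (y, b)
          ((memF _ _).2 ⟨⟨hTP.mem_support hy, hmem.1.2⟩, hyQ, hmem.2.2.1, hyS, hmem.2.2.2.2⟩)
        simp only [← hTP.pathSum_eq hw hP, ← hT₂.pathSum_eq hw hP] at this
        exact absurd this (not_le.2 hlt₂)) hne
    have h7 := hQmin Q' h3 (fun he => (h4 e he).elim heQ fun h => heP (hTP.mem_edges h))
      ⟨b, h5, hmem.2.2.1, hmem.2.2.2.2⟩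
    have h8 := h6 w
    linarith
  -- the lightest segment of `Q` between such vertices can replace a segment of `P`
  have h2 : pathSum w TP' < pathSum w TQ' := by
    obtain ⟨P', h3, h4, -, h5, h6⟩ := exists_splice hP hTP' (hTQ'.isPath hQ) (fun y hy hyP => by
      by_contra! hyab
      obtain ⟨⟨T₁, hT₁, hlt₁⟩, T₂, hT₂, hlt₂⟩ := hTQ'.exists_lt hw hy hyab.1 hyab.2
      by_cases hyS : SplitsNew S P y
      · have := habmin' (a', y)
          ((memF _ _).2 ⟨⟨hmem'.1.1, hyP⟩, hmem'.2.1, hTQ'.mem_support hy, hmem'.2.2.2.1, hyS⟩)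
        simp only [← hTQ'.pathSum_eq hw hQ, ← hT₁.pathSum_eq hw hQ] at this
        exact absurd this (not_le.2 hlt₁)
      · have := habmin' (y, b')
          ((memF _ _).2 ⟨⟨hyP, hmem'.1.2⟩, hTQ'.mem_support hy, hmem'.2.2.1, hyS, hmem'.2.2.2.2⟩)
        simp only [← hTQ'.pathSum_eq hw hQ, ← hT₂.pathSum_eq hw hQ] at this
        exact absurd this (not_le.2 hlt₂)) hne'
    -- The removed segment of `P` has some but not all new edges, while the segment of `Q` that
    -- replaces it has none. So `P'` is still a competitor of `P` and has fewer new edges; by the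
    -- rule for ties it must be strictly heavier.
    have h9 := hTP'.newCount_lt hP hmem'.2.2.2.1 hmem'.2.2.2.2
    have h0 : newCount S TQ' = 0 := by
      by_contra h0
      obtain ⟨f, hf, hfS⟩ := newCount_pos.1 (Nat.pos_of_ne_zero h0)
      exact hfS (hQS f (hTQ'.mem_edges hf))
    have h10 := h6 (Sᶜ.indicator (1 : Sym2 V → ℕ))
    have h7 := hPmin P' h3 (fun he => (h4 e he).elim heP fun h => heQ (hTQ'.mem_edges h))
      (by simp only [newCount] at *; omega)
    have h8 := h6 w
    rcases h7.1.lt_or_eq with hlt | heq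
    · linarith
    · have := h7.2 heq
      simp only [newCount] at *
      omega
  -- The inequalities close up to a strict cycle: `TP ≤ TP' < TQ' ≤ TQ ≤ TP` in weight.
  have h3 := habmin (a', b') hab'
  have h4 := habmin' (a, b) hab
  simp only [← hTP.pathSum_eq hw hP, ← hTP'.pathSum_eq hw hP, ← hTQ.pathSum_eq hw hQ,
    ← hTQ'.pathSum_eq hw hQ] at h3 h4
  linarith

end Segments

end

end RootedCycleBasis

namespace RootedCycleBasis

noncomputable section

/-! ### Greedy sequences add one ear at a time -/

section Greedy

open SimpleGraph

variable {V : Type*} {G : SimpleGraph V}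

/-- `D` is a possible choice of the greedy method when the edges in `S` are covered. -/
structure IsBest (w : Sym2 V → ℝ) (e : Sym2 V) (S : Set (Sym2 V)) (D : G.Subgraph) : Prop where
  rooted : IsRootedCycle e D
  new : (D.edgeSet \ S).Nonempty
  shortest : ∀ D' : G.Subgraph, IsRootedCycle e D' → (D'.edgeSet \ S).Nonempty →
    weight w D ≤ weight w D'
  tie : ∀ D' : G.Subgraph, IsRootedCycle e D' → (D'.edgeSet \ S).Nonempty →
    weight w D = weight w D' → (D.edgeSet \ S).ncard ≤ (D'.edgeSet \ S).ncard

/-- The edges of the first `i` members of a sequence of subgraphs. -/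
def covered (C : ℕ → G.Subgraph) (i : ℕ) : Set (Sym2 V) := {f | ∃ j < i, f ∈ (C j).edgeSet}

/-- The vertices of the root edge and of the first `i` members of a sequence of subgraphs. -/
def coveredVerts (e : Sym2 V) (C : ℕ → G.Subgraph) (i : ℕ) : Set V :=
  {x | x ∈ e ∨ ∃ j < i, x ∈ (C j).verts}

theorem mem_coveredVerts_of_mem_covered {e : Sym2 V} {C : ℕ → G.Subgraph} {i : ℕ} {f : Sym2 V}
    (hf : f ∈ covered C i) {x : V} (hx : x ∈ f) : x ∈ coveredVerts e C i := by
  obtain ⟨j, hj, hf⟩ := hf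
  exact Or.inr ⟨j, hj, Subgraph.mem_verts_of_mem_edge hf hx⟩

section Path

variable {w : Sym2 V → ℝ} {S : Set (Sym2 V)} {u v : V} {P : G.Walk u v} (h : G.Adj v u)

theorem weight_closePath (hP : P.IsPath) (he : s(u, v) ∉ P.edges) :
    weight w (closePath h P) = w s(u, v) + pathSum w P :=
  finsum_edgeSet_closePath h hP he w

theorem closePath_diff_nonempty {f : Sym2 V} (hf : f ∈ P.edges) (hS : f ∉ S) :
    ((closePath h P).edgeSet \ S).Nonempty :=
  ⟨f, by rw [edgeSet_closePath]; exact Or.inr hf, hS⟩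

theorem IsBest.path_min (hP : P.IsPath) (he : s(u, v) ∉ P.edges)
    (hB : IsBest w s(u, v) S (closePath h P)) (P' : G.Walk u v) (hP' : P'.IsPath)
    (he' : s(u, v) ∉ P'.edges) (hnew : 0 < newCount S P') :
    pathSum w P ≤ pathSum w P' ∧ (pathSum w P = pathSum w P' → newCount S P ≤ newCount S P') := by
  obtain ⟨f, hf, hfS⟩ := newCount_pos.1 hnew
  have h1 := hB.shortest _ (isRootedCycle_closePath h hP' he') (closePath_diff_nonempty h hf hfS)
  have h2 := hB.tie _ (isRootedCycle_closePath h hP' he') (closePath_diff_nonempty h hf hfS)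
  rw [weight_closePath h hP he, weight_closePath h hP' he'] at h1 h2
  rw [ncard_sdiff_closePath h hP he, ncard_sdiff_closePath h hP' he'] at h2
  refine ⟨by linarith, fun heq => ?_⟩
  have := h2 (by rw [heq])
  simp only [newCount]
  omega

end Path

variable {w : Sym2 V → ℝ} {k : ℕ} {C : ℕ → G.Subgraph} {u v : V}

/-- The exchange argument needs `C j` to be no heavier than any competitor through a splitting
vertex `y`. By induction on `j`, no cycle before `C j` contains `y`. So an edge at `y` was uncovered
when `C j` was chosen, and the competitor was admissible then. -/
theorem not_splitsNew_of_mem_verts [Finite V] (hw : ∀ f ∈ G.edgeSet, 0 < w f) (h : G.Adj v u)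
    (hC : ∀ i < k, IsBest w s(u, v) (covered C i) (C i)) {i : ℕ} (hi : i < k) {P : G.Walk u v}
    (hP : P.IsPath) (he : s(u, v) ∉ P.edges) (hCP : C i = closePath h P) {j : ℕ} (hj : j < i)
    {x : V} (hx : x ∈ (C j).verts) : ¬ SplitsNew (covered C i) P x := by
  induction j using Nat.strong_induction_on generalizing x with
  | _ j ih =>
    obtain ⟨Q, hQ, heQ, hCQ⟩ := (hC j (hj.trans hi)).rooted.exists_path h
    have hBj := hC j (hj.trans hi)
    rw [hCQ] at hBj
    refine not_splitsNew hw hP hQ he heQ ?_ ?_ ?_ (x := x) ?_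
    · intro f hf
      exact ⟨j, hj, by rw [hCQ, edgeSet_closePath]; exact Or.inr hf⟩
    · exact IsBest.path_min h hP he (hCP ▸ hC i hi)
    · rintro Q' hQ' heQ' ⟨y, hy, hyQ, hyS⟩
      obtain ⟨f, hf, hyf⟩ := exists_mem_edges_of_mem_support hy h.ne'
      have hfS : f ∉ covered C j := by
        rintro ⟨l, hl, hfl⟩
        exact ih l hl (hl.trans hj) (Subgraph.mem_verts_of_mem_edge hfl hyf) hyS
      exact (IsBest.path_min h hQ heQ hBj Q' hQ' heQ' (newCount_pos.2 ⟨f, hf, hfS⟩)).1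
    · rw [hCQ, verts_closePath] at hx
      exact hx

/-- The new edges of a member of a greedy sequence form a path that meets the earlier members
exactly in its ends. -/
theorem exists_ear [Finite V] (hw : ∀ f ∈ G.edgeSet, 0 < w f) (h : G.Adj v u)
    (hC : ∀ i < k, IsBest w s(u, v) (covered C i) (C i)) {i : ℕ} (hi : i < k) :
    ∃ (a b : V) (R : G.Walk a b), R.IsPath ∧ a ≠ b ∧
      (∀ f, f ∈ R.edges ↔ f ∈ ((C i).edgeSet \ covered C i) \ {s(u, v)}) ∧
      a ∈ coveredVerts s(u, v) C i ∧ b ∈ coveredVerts s(u, v) C i ∧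
      ∀ x ∈ R.support, x ≠ a → x ≠ b → x ∉ coveredVerts s(u, v) C i := by
  obtain ⟨P, hP, he, hCP⟩ := (hC i hi).rooted.exists_path h
  have hnew : 0 < newCount (covered C i) P := by
    obtain ⟨f, hf, hfS⟩ := (hC i hi).new
    rw [hCP, edgeSet_closePath] at hf
    rcases hf with rfl | hf
    -- The root edge can be new only for `i = 0`, since `C 0` contains it. Then nothing is covered
    -- and every edge of `P` is new.
    · obtain ⟨f, hf, -⟩ := exists_mem_edges_of_mem_support P.start_mem_support h.ne'
      refine newCount_pos.2 ⟨f, hf, ?_⟩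
      rintro ⟨j, hj, -⟩
      exact hfS ⟨0, by omega, (hC 0 (by omega)).rooted.2⟩
    · exact newCount_pos.2 ⟨f, hf, hfS⟩
  have hsplit : ∀ x ∈ coveredVerts s(u, v) C i, ¬ SplitsNew (covered C i) P x := by
    rintro x (hx | ⟨j, hj, hx⟩)
    · rcases Sym2.mem_iff.1 hx with rfl | rfl
      · have : SplitsNew (covered C i) (Walk.nil.append P) x ↔ _ :=
          splitsNew_append (by simpa using hP)
        rw [Walk.nil_append] at this
        rw [this]; simp
      · have : SplitsNew (covered C i) (P.append Walk.nil) x ↔ _ :=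
          splitsNew_append (by simpa using hP)
        rw [Walk.append_nil] at this
        rw [this]; simp
    · exact not_splitsNew_of_mem_verts hw h hC hi hP he hCP hj hx
  -- the shortest middle part that contains all new edges and has covered ends
  let good : ℕ → Prop := fun l => ∃ (a b : V) (A : G.Walk u a) (R : G.Walk a b) (B : G.Walk b v),
    P = A.append (R.append B) ∧ newCount (covered C i) A = 0 ∧ newCount (covered C i) B = 0 ∧
    a ∈ coveredVerts s(u, v) C i ∧ b ∈ coveredVerts s(u, v) C i ∧ R.length = l
  have hgood : ∃ l, good l := ⟨_, u, v, .nil, P, .nil, by simp, by simp [newCount],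
    by simp [newCount], Or.inl (by simp), Or.inl (by simp), rfl⟩
  classical
  obtain ⟨a, b, A, R, B, rfl, hA, hB, ha, hb, hl⟩ := Nat.find_spec hgood
  have hmin : ∀ {l}, good l → R.length ≤ l := fun hg => hl ▸ Nat.find_min' hgood hg
  have hR : R.IsPath := hP.of_append_right.of_append_left
  have hRnew : 0 < newCount (covered C i) R := by
    simp only [newCount, pathSum_append] at hnew hA hB ⊢
    omega
  have hab : a ≠ b := by
    rintro rfl
    rw [Walk.isPath_iff_nil, ← Walk.eq_nil_iff_nil] at hR
    rw [hR] at hRnew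
    simp [newCount] at hRnew
  -- A covered interior vertex does not split the new edges, so one of the two sides has none and
  -- can be cut off, against the minimal length of `R`.
  have hint : ∀ x ∈ R.support, x ≠ a → x ≠ b → x ∉ coveredVerts s(u, v) C i := by
    intro x hx hxa hxb hxC
    obtain ⟨R₁, R₂, rfl⟩ := Walk.mem_support_iff_exists_append.1 hx
    have hlen₁ : 0 < R₁.length := Nat.pos_of_ne_zero fun h0 => hxa (Walk.eq_of_length_eq_zero h0).symm
    have hlen₂ : 0 < R₂.length := Nat.pos_of_ne_zero fun h0 => hxb (Walk.eq_of_length_eq_zero h0)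
    have e1 : A.append ((R₁.append R₂).append B) = (A.append R₁).append (R₂.append B) := by
      simp [Walk.append_assoc]
    have h1 := hsplit x hxC
    have hP' := hP
    rw [e1] at hP' h1
    rw [splitsNew_append hP'] at h1
    by_cases h2 : newCount (covered C i) (A.append R₁) = 0
    · have := hmin (l := R₂.length) ⟨x, b, A.append R₁, R₂, B, e1, h2, hB, hxC, hb, rfl⟩
      rw [Walk.length_append] at this
      omega
    · have h3 : newCount (covered C i) (R₂.append B) = 0 := by omega
      have := hmin (l := R₁.length) ⟨a, x, A, R₁, R₂.append B, by simp [Walk.append_assoc],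
        hA, h3, ha, hxC, rfl⟩
      rw [Walk.length_append] at this
      omega
  -- A covered edge has covered ends, so on `R` it could only join `a` and `b`. As `R` is a path, it
  -- would then be all of `R`, which would leave no new edge.
  have hRS : ∀ f ∈ R.edges, f ∉ covered C i := by
    intro f hf hfS
    have hfab : f = s(a, b) := by
      induction f using Sym2.ind with
      | _ c d =>
        have hcd : G.Adj c d := R.edges_subset_edgeSet hf
        have hend : ∀ x ∈ s(c, d), x = a ∨ x = b := by
          intro x hx
          by_contra! hx'
          exact hint x (mem_support_of_mem_mem_edges hf hx) hx'.1 hx'.2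
            (mem_coveredVerts_of_mem_covered hfS hx)
        rcases hend c (by simp) with rfl | rfl <;> rcases hend d (by simp) with rfl | rfl
        · exact absurd rfl hcd.ne
        · rfl
        · exact Sym2.eq_swap
        · exact absurd rfl hcd.ne
    subst hfab
    cases R with
    | nil => exact hab rfl
    | @cons _ a₁ _ haa₁ R' =>
      rw [Walk.cons_isPath_iff] at hR
      rw [Walk.edges_cons, List.mem_cons] at hf
      rcases hf with hf | hf
      · obtain rfl : b = a₁ := by
          rcases Sym2.eq_iff.1 hf with ⟨-, h1⟩ | ⟨-, h1⟩
          exacts [h1, absurd h1.symm hab]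
        have h0 := Walk.isPath_iff_nil.1 hR.1
        rw [← Walk.eq_nil_iff_nil] at h0
        subst h0
        obtain ⟨g, hg, hgS⟩ := newCount_pos.1 hRnew
        simp only [Walk.edges_cons, Walk.edges_nil, List.mem_singleton] at hg
        exact hgS (hg ▸ hfS)
      · exact hR.2 (mem_support_of_mem_mem_edges hf (Sym2.mem_mk_left _ _))
  refine ⟨a, b, R, hR, hab, fun f => ⟨fun hf => ?_, fun hf => ?_⟩, ha, hb, hint⟩
  · have hfP : f ∈ (A.append (R.append B)).edges := by simp [Walk.edges_append, hf]
    refine ⟨⟨?_, hRS f hf⟩, ?_⟩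
    · rw [hCP, edgeSet_closePath]
      exact Or.inr hfP
    · rintro rfl
      exact he hfP
  · obtain ⟨⟨hf, hfS⟩, hfe⟩ := hf
    rw [hCP, edgeSet_closePath] at hf
    rcases hf with hf | hf
    · exact absurd hf hfe
    simp only [Walk.edges_append, List.mem_append] at hf
    rcases hf with hf | hf | hf
    · exact absurd (newCount_pos.2 ⟨f, hf, hfS⟩) (by omega)
    · exact hf
    · exact absurd (newCount_pos.2 ⟨f, hf, hfS⟩) (by omega)

end Greedy

end

end RootedCycleBasis

namespace RootedCycleBasis

noncomputable section

/-! ### Open ear decompositions from greedy sequences -/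

section EarDecomposition

open SimpleGraph

variable {V : Type*} {G : SimpleGraph V}

theorem ofEdges_eq_toSubgraph {a b : V} (R : G.Walk a b) (hab : a ≠ b) {S : Set (Sym2 V)}
    (hS : ∀ f, f ∈ R.edges ↔ f ∈ S) : ofEdges G S = R.toSubgraph := by
  have hadj : ∀ x y, (ofEdges G S).Adj x y ↔ R.toSubgraph.Adj x y := by
    intro x y
    rw [Walk.adj_toSubgraph_iff_mem_edges, hS]
    exact ⟨fun h => h.2, fun h => ⟨R.edges_subset_edgeSet ((hS _).2 h), h⟩⟩
  ext x y
  · constructor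
    · rintro ⟨y, hy⟩
      exact R.toSubgraph.edge_vert ((hadj x y).1 hy)
    · intro hx
      obtain ⟨f, hf, hxf⟩ :=
        exists_mem_edges_of_mem_support ((Walk.mem_verts_toSubgraph _).1 hx) hab
      obtain ⟨y, rfl⟩ := hxf
      exact ⟨y, R.edges_subset_edgeSet hf, (hS _).1 hf⟩
  · exact hadj x y

theorem edgeSet_ofEdges (S : Set (Sym2 V)) : (ofEdges G S).edgeSet = G.edgeSet ∩ S := by
  ext f
  induction f using Sym2.ind with
  | _ x y => rfl

theorem mem_verts_ofEdges {S : Set (Sym2 V)} {x : V} :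
    x ∈ (ofEdges G S).verts ↔ ∃ f ∈ G.edgeSet ∩ S, x ∈ f := by
  constructor
  · rintro ⟨y, h⟩
    exact ⟨s(x, y), h, Sym2.mem_mk_left _ _⟩
  · rintro ⟨f, hf, y, rfl⟩
    exact ⟨y, hf⟩

theorem isSimplePath_toSubgraph {a b : V} {R : G.Walk a b} (hR : R.IsPath) (hab : a ≠ b) :
    IsSimplePath R.toSubgraph a b where
  connected := R.toSubgraph_connected
  ne := hab
  deg_left := by
    rw [hR.neighborSet_toSubgraph_startpoint (Walk.not_nil_of_ne hab), Set.ncard_singleton]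
  deg_right := by
    rw [hR.neighborSet_toSubgraph_endpoint (Walk.not_nil_of_ne hab), Set.ncard_singleton]
  deg_interior := by
    intro x hx hxa hxb
    obtain ⟨i, rfl, hi⟩ := Walk.mem_support_iff_exists_getVert.1 ((Walk.mem_verts_toSubgraph _).1 hx)
    refine hR.ncard_neighborSet_toSubgraph_internal_eq_two ?_ ?_
    · rintro rfl
      simp at hxa
    · refine lt_of_le_of_ne hi ?_
      rintro rfl
      simp at hxb

variable {w : Sym2 V → ℝ} {k : ℕ} {C : ℕ → G.Subgraph}

theorem newEdges_eq (C : ℕ → G.Subgraph) (i : Fin k) (D : G.Subgraph) :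
    newEdges (fun i : Fin k => C i) i D = D.edgeSet \ covered C i := by
  ext f
  simp only [newEdges, covered, Set.mem_ofPred_eq, Set.mem_sdiff, not_exists, not_and]
  refine and_congr_right fun _ => ⟨fun h j hj => h ⟨j, hj.trans i.2⟩ hj, fun h j hj => h j hj⟩

theorem exists_first_of_mem_covered {i : ℕ} {f : Sym2 V} (hf : f ∈ covered C i) :
    ∃ j < i, f ∈ (C j).edgeSet \ covered C j := by
  classical
  have hex : ∃ j, j < i ∧ f ∈ (C j).edgeSet := hf
  refine ⟨Nat.find hex, (Nat.find_spec hex).1, (Nat.find_spec hex).2, ?_⟩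
  rintro ⟨j, hj, hfj⟩
  exact Nat.find_min hex hj ⟨hj.trans (Nat.find_spec hex).1, hfj⟩

theorem ears_zero (e : Sym2 V) (C : Fin k → G.Subgraph) : ears e C 0 = ofEdges G {e} := rfl

theorem ears_succ (e : Sym2 V) (C : ℕ → G.Subgraph) (i : Fin k) :
    ears e (fun i : Fin k => C i) i.succ =
      ofEdges G (((C i).edgeSet \ covered C i) \ {e}) := by
  rw [ears, Fin.cons_succ, newEdges_eq]

/-- Each edge of an earlier cycle other than `e` belongs to the ear of the first cycle containing
it. Hence the earlier ears have the same vertices as the root edge together with the earlier cycles.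
-/
theorem exists_mem_ears_iff {e : Sym2 V} (he : e ∈ G.edgeSet)
    (hC : ∀ i < k, IsBest w e (covered C i) (C i)) (i : Fin k) (x : V) :
    x ∈ coveredVerts e C i ↔ ∃ j < i.succ, x ∈ (ears e (fun i : Fin k => C i) j).verts := by
  constructor
  · have h0 : x ∈ e → ∃ j < i.succ, x ∈ (ears e (fun i : Fin k => C i) j).verts := fun hx =>
      ⟨0, Fin.succ_pos i, by rw [ears_zero, mem_verts_ofEdges]; exact ⟨e, ⟨he, rfl⟩, hx⟩⟩
    rintro (hx | ⟨j, hj, hx⟩)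
    · exact h0 hx
    · have h2 := (hC j (hj.trans i.2)).rooted.1.2 x hx
      obtain ⟨y, hy⟩ := Set.nonempty_of_ncard_ne_zero (by rw [h2]; norm_num)
      have hf : s(x, y) ∈ (C j).edgeSet := hy
      by_cases hfe : s(x, y) = e
      · exact h0 (hfe ▸ Sym2.mem_mk_left _ _)
      · obtain ⟨l, hl, hfl⟩ := exists_first_of_mem_covered (i := j + 1) ⟨j, by omega, hf⟩
        refine ⟨Fin.succ ⟨l, by omega⟩, ?_, ?_⟩
        · rw [Fin.succ_lt_succ_iff, Fin.lt_def]
          exact Nat.lt_of_le_of_lt (Nat.le_of_lt_succ hl) hj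
        · rw [ears_succ, mem_verts_ofEdges]
          exact ⟨s(x, y), ⟨(C j).edgeSet_subset hf, hfl, hfe⟩, Sym2.mem_mk_left _ _⟩
  · rintro ⟨j, hj, hx⟩
    induction j using Fin.cases with
    | zero =>
      rw [ears_zero, mem_verts_ofEdges] at hx
      obtain ⟨f, ⟨-, rfl⟩, hx⟩ := hx
      exact Or.inl hx
    | succ j =>
      rw [ears_succ, mem_verts_ofEdges] at hx
      obtain ⟨f, ⟨-, hf, -⟩, hx⟩ := hx
      exact Or.inr ⟨j, Fin.succ_lt_succ_iff.1 hj, Subgraph.mem_verts_of_mem_edge hf.1 hx⟩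

variable {u v : V}

theorem isOpenEarDecomposition_ears [Finite V] (hG : G.Connected) (h : G.Adj u v)
    (hw : ∀ f ∈ G.edgeSet, 0 < w f)
    (hC : ∀ i < k, IsBest w s(u, v) (covered C i) (C i))
    (hcov : ∀ f ∈ G.edgeSet, f ≠ s(u, v) → f ∈ covered C k) :
    IsOpenEarDecomposition (ears s(u, v) fun i : Fin k => C i) := by
  have hpart : ∀ f ∈ G.edgeSet,
      ∃! i, f ∈ (ears s(u, v) (fun i : Fin k => C i) i).edgeSet := by
    intro f hf
    by_cases hfe : f = s(u, v)
    · refine ⟨0, ?_, ?_⟩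
      · simp only [ears_zero, edgeSet_ofEdges]
        exact ⟨hf, hfe⟩
      · intro i hi
        induction i using Fin.cases with
        | zero => rfl
        | succ i =>
          simp only [ears_succ, edgeSet_ofEdges] at hi
          exact absurd hfe hi.2.2
    · obtain ⟨j, hj, hfj⟩ := exists_first_of_mem_covered (hcov f hf hfe)
      refine ⟨Fin.succ ⟨j, hj⟩, ?_, ?_⟩
      · simp only [ears_succ, edgeSet_ofEdges]
        exact ⟨hf, hfj, hfe⟩
      · intro i hi
        induction i using Fin.cases with
        | zero =>
          simp only [ears_zero, edgeSet_ofEdges] at hi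
          exact absurd hi.2 hfe
        | succ i =>
          simp only [ears_succ, edgeSet_ofEdges] at hi
          rw [Fin.succ_inj, Fin.ext_iff]
          rcases lt_trichotomy (i : ℕ) j with hij | hij | hij
          · exact absurd ⟨_, hij, hi.2.1.1⟩ hfj.2
          · exact hij
          · exact absurd ⟨_, hij, hfj.1⟩ hi.2.1.2
  refine ⟨⟨u, v, h, ?_⟩, ?_, hpart, ?_⟩
  · rw [ears_zero, ofEdges_eq_toSubgraph (Walk.cons h Walk.nil) h.ne (by simp)]
    exact Walk.toSubgraph_cons_nil_eq_subgraphOfAdj h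
  · intro i hi
    induction i using Fin.cases with
    | zero => exact absurd hi (lt_irrefl _)
    | succ i =>
      obtain ⟨a, b, R, hR, hab, hRe, ha, hb, hint⟩ := exists_ear hw h.symm hC i.2
      rw [ears_succ, ofEdges_eq_toSubgraph R hab hRe]
      refine ⟨a, b, isSimplePath_toSubgraph hR hab, (exists_mem_ears_iff h hC i a).1 ha,
        (exists_mem_ears_iff h hC i b).1 hb, fun x hx hxa hxb j hj hxj => ?_⟩
      exact hint x ((Walk.mem_verts_toSubgraph _).1 hx) hxa hxb
        ((exists_mem_ears_iff h hC i x).2 ⟨j, hj, hxj⟩)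
  · intro x
    obtain ⟨y, hy⟩ : ∃ y, G.Adj x y := by
      by_cases hxu : x = u
      · exact ⟨v, hxu ▸ h⟩
      · obtain ⟨W⟩ := hG.preconnected x u
        cases W with
        | nil => exact absurd rfl hxu
        | cons hxy _ => exact ⟨_, hxy⟩
    obtain ⟨i, hi, -⟩ := hpart s(x, y) hy
    exact ⟨i, Subgraph.mem_verts_of_mem_edge hi (Sym2.mem_mk_left _ _)⟩

theorem isGreedySequence_of_isBest {e : Sym2 V}
    (hC : ∀ i < k, IsBest w e (covered C i) (C i))
    (hcov : ∀ f ∈ G.edgeSet, f ≠ e → f ∈ covered C k) :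
    IsGreedySequence w e fun i : Fin k => C i where
  rooted i := (hC i i.2).rooted
  new i := by rw [newEdges_eq]; exact (hC i i.2).new
  shortest i D := by rw [newEdges_eq]; exact (hC i i.2).shortest D
  tie i D := by rw [newEdges_eq, newEdges_eq]; exact (hC i i.2).tie D
  covers f hf hfe := by
    obtain ⟨j, hj, hfj⟩ := hcov f hf hfe
    exact ⟨⟨j, hj⟩, hfj⟩

end EarDecomposition

/-! ### Greedy sequences are minimum rooted cycle bases -/

section Basis

open SimpleGraph

variable {V : Type*} {G : SimpleGraph V}

/-- The extension of a vector of the edge space by `0`. -/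
def edgeExt (x : G.edgeSet → ZMod 2) (f : Sym2 V) : ZMod 2 :=
  open Classical in if h : f ∈ G.edgeSet then x ⟨f, h⟩ else 0

theorem edgeExt_add (x y : G.edgeSet → ZMod 2) (f : Sym2 V) :
    edgeExt (x + y) f = edgeExt x f + edgeExt y f := by
  unfold edgeExt; split_ifs <;> simp

theorem edgeExt_smul (c : ZMod 2) (x : G.edgeSet → ZMod 2) (f : Sym2 V) :
    edgeExt (c • x) f = c * edgeExt x f := by
  unfold edgeExt; split_ifs <;> simp

theorem edgeExt_coe (x : G.edgeSet → ZMod 2) (f : G.edgeSet) : edgeExt x f = x f := by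
  unfold edgeExt; rw [dif_pos f.2]

theorem edgeExt_edgeVec (C : G.Subgraph) (f : Sym2 V) :
    edgeExt (edgeVec G C) f = C.edgeSet.indicator 1 f := by
  unfold edgeExt
  split_ifs with h
  · rfl
  · rw [Set.indicator_of_notMem fun hf => h (C.edgeSet_subset hf)]

variable [Fintype V]

/-- A vector of the edge space has even degree at every vertex. -/
def IsEven (x : G.edgeSet → ZMod 2) : Prop := ∀ a : V, ∑ b, edgeExt x s(a, b) = 0

theorem isEven_edgeVec {C : G.Subgraph} (hC : IsCycle C) : IsEven (edgeVec G C) := by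
  classical
  intro a
  have h1 : ∑ b, edgeExt (edgeVec G C) s(a, b) = ((C.neighborSet a).ncard : ZMod 2) := by
    rw [Set.ncard_eq_toFinset_card', Finset.card_eq_sum_ones, Nat.cast_sum,
      ← Finset.sum_filter_add_sum_filter_not Finset.univ (fun b => b ∈ (C.neighborSet a).toFinset)]
    rw [Finset.sum_eq_zero (s := Finset.univ.filter fun b => ¬ _), add_zero]
    · refine Finset.sum_congr (by ext; simp) fun b hb => ?_
      rw [edgeExt_edgeVec, Set.indicator_of_mem]
      · simp
      · simpa using hb
    · intro b hb
      rw [edgeExt_edgeVec, Set.indicator_of_notMem]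
      simpa using hb
  rw [h1]
  by_cases ha : a ∈ C.verts
  · rw [hC.2 a ha]; rfl
  · have : C.neighborSet a = ∅ := by
      ext b
      simp only [Subgraph.mem_neighborSet, Set.mem_empty_iff_false, iff_false]
      exact fun hb => ha (C.edge_vert hb)
    rw [this]; simp

theorem isEven_of_mem_cycleSpace {x : G.edgeSet → ZMod 2} (hx : x ∈ cycleSpace G) : IsEven x := by
  induction hx using Submodule.span_induction with
  | mem x hx =>
    obtain ⟨C, hC, rfl⟩ := hx
    exact isEven_edgeVec hC
  | zero =>
    intro a
    refine Finset.sum_eq_zero fun b _ => ?_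
    unfold edgeExt; split_ifs <;> rfl
  | add x y _ _ hx hy =>
    intro a
    simp only [edgeExt_add, Finset.sum_add_distrib, hx a, hy a, add_zero]
  | smul c x _ hx =>
    intro a
    simp only [edgeExt_smul, ← Finset.mul_sum, hx a, mul_zero]

theorem linearIndependent_of_triangular {K E : Type*} [Field K] {k : ℕ} (x : Fin k → E → K)
    (f : Fin k → E) (h1 : ∀ i, x i (f i) ≠ 0) (h0 : ∀ i j, j < i → x j (f i) = 0) :
    LinearIndependent K x := by
  rw [Fintype.linearIndependent_iff]
  intro g hg
  by_contra! hne
  obtain ⟨i₀, hi₀⟩ := hne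
  classical
  let T : Finset (Fin k) := {i | g i ≠ 0}
  have hT : T.Nonempty := ⟨i₀, by simpa [T] using hi₀⟩
  have hmem := T.max'_mem hT
  set i := T.max' hT with hi
  have h2 := congrFun hg (f i)
  rw [Finset.sum_apply, Finset.sum_eq_single i] at h2
  · simp only [Pi.smul_apply, smul_eq_mul, Pi.zero_apply, mul_eq_zero] at h2
    rcases h2 with h2 | h2
    · simp only [T, Finset.mem_filter, Finset.mem_univ, true_and] at hmem
      exact hmem h2
    · exact h1 i h2
  · intro j _ hj
    rcases lt_or_gt_of_ne hj with hlt | hgt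
    · simp [h0 i j hlt]
    · have : g j = 0 := by
        by_contra hgj
        exact absurd (T.le_max' j (by simpa [T] using hgj)) (not_le.2 hgt)
      simp [this]
  · intro h; exact absurd (Finset.mem_univ i) h

variable {w : Sym2 V → ℝ} {k : ℕ} {C : ℕ → G.Subgraph} {u v : V}

/-- At an interior vertex only the two edges of the path can be in the support, and even degree
makes their coefficients equal. Equality propagates along the path. -/
theorem edgeExt_eq_on_ear {x : G.edgeSet → ZMod 2} (hx : IsEven x) {a b : V} {R : G.Walk a b}
    (hR : R.IsPath)
    (hsupp : ∀ y ∈ R.support, y ≠ a → y ≠ b → ∀ z, edgeExt x s(y, z) ≠ 0 → s(y, z) ∈ R.edges)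
    {f g : Sym2 V} (hf : f ∈ R.edges) (hg : g ∈ R.edges) : edgeExt x f = edgeExt x g := by
  have key : ∀ i, i < R.length → edgeExt x s(R.getVert i, R.getVert (i + 1)) =
      edgeExt x s(R.getVert 0, R.getVert 1) := by
    intro i
    induction i with
    | zero => intro _; rfl
    | succ i ih =>
      intro hi
      rw [← ih (by omega)]
      have hinj := hR.getVert_injOn
      have hne : ∀ {p q : ℕ}, p ≤ R.length → q ≤ R.length → p ≠ q → R.getVert p ≠ R.getVert q :=
        fun hp hq hpq h => hpq (hinj hp hq h)
      have h1 := hx (R.getVert (i + 1))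
      have ha : R.getVert (i + 1) ≠ a := by
        conv_rhs => rw [← R.getVert_zero]
        exact hne (by omega) (by omega) (by omega)
      have hb : R.getVert (i + 1) ≠ b := by
        conv_rhs => rw [← R.getVert_length]
        exact hne (by omega) (by omega) (by omega)
      have h2 := hsupp _ (R.getVert_mem_support (i + 1)) ha hb
      have hns := hR.neighborSet_toSubgraph_internal (i := i + 1) (by omega) hi
      rw [Nat.add_sub_cancel] at hns
      classical
      rw [← Finset.sum_subset (Finset.subset_univ {R.getVert i, R.getVert (i + 1 + 1)}),
        Finset.sum_pair (hne (by omega) (by omega) (by omega))] at h1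
      · rw [CharTwo.add_eq_zero] at h1
        rw [← h1, Sym2.eq_swap]
      · intro z _ hz
        by_contra h0
        have h3 : z ∈ R.toSubgraph.neighborSet (R.getVert (i + 1)) := by
          rw [Subgraph.mem_neighborSet, Walk.adj_toSubgraph_iff_mem_edges]
          exact h2 z h0
        rw [hns] at h3
        simp only [Finset.mem_insert, Finset.mem_singleton] at hz
        exact hz h3
  have key' : ∀ {f}, f ∈ R.edges → edgeExt x f = edgeExt x s(R.getVert 0, R.getVert 1) := by
    intro f hf
    induction f using Sym2.ind with
    | _ y z =>
      rw [← Walk.adj_toSubgraph_iff_mem_edges, Walk.toSubgraph_adj_iff] at hf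
      obtain ⟨i, hi, hlt⟩ := hf
      rw [← hi]
      exact key i hlt
  rw [key' hf, key' hg]

/-- The ears are peeled off from the last one backwards. This carries both the spanning property
and, through its restriction to the first `i` cycles, the minimality of the weight. -/
theorem mem_span_of_isEven (h : G.Adj u v) (hw : ∀ f ∈ G.edgeSet, 0 < w f)
    (hC : ∀ i < k, IsBest w s(u, v) (covered C i) (C i)) {i : ℕ} (hi : i ≤ k)
    {x : G.edgeSet → ZMod 2} (hx : IsEven x)
    (hsupp : ∀ f, edgeExt x f ≠ 0 → f = s(u, v) ∨ f ∈ covered C i) :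
    x ∈ Submodule.span (ZMod 2) (edgeVec G '' (C '' Set.Iio i)) := by
  induction i generalizing x with
  | zero =>
    have h0 : ∀ f, edgeExt x f = 0 := by
      intro f
      by_contra hf
      have hf' : f = s(u, v) := by
        rcases hsupp f hf with h | ⟨j, hj, -⟩
        exacts [h, absurd hj (by omega)]
      -- Only the root edge can be left in the support, and a single edge has odd degree at `u`.
      have h1 := hx u
      rw [Finset.sum_eq_single v] at h1
      · exact hf (hf' ▸ h1)
      · intro z _ hz
        by_contra hz'
        rcases hsupp _ hz' with h | ⟨j, hj, -⟩
        · rcases Sym2.eq_iff.1 h with ⟨-, h2⟩ | ⟨h2, h3⟩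
          · exact hz h2
          · exact hz (h3.trans h2)
        · exact absurd hj (by omega)
      · intro h; exact absurd (Finset.mem_univ v) h
    have : x = 0 := by
      ext f
      rw [← edgeExt_coe x f, h0]; rfl
    rw [this]
    exact Submodule.zero_mem _
  | succ i ih =>
    obtain ⟨a, b, R, hR, hab, hRe, -, -, hint⟩ := exists_ear hw h.symm hC (i := i) (by omega)
    obtain ⟨f₀, hf₀, -⟩ := exists_mem_edges_of_mem_support R.start_mem_support hab
    have hconst : ∀ f ∈ R.edges, edgeExt x f = edgeExt x f₀ := by
      intro f hf
      refine edgeExt_eq_on_ear hx hR ?_ hf hf₀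
      intro y hy hya hyb z hz
      have hyC := hint y hy hya hyb
      have hne : s(y, z) ≠ s(u, v) := fun h' => hyC (Or.inl (h' ▸ Sym2.mem_mk_left _ _))
      have hnc : s(y, z) ∉ covered C i := fun h' =>
        hyC (mem_coveredVerts_of_mem_covered h' (Sym2.mem_mk_left _ _))
      rcases hsupp _ hz with h' | ⟨j, hj, h'⟩
      · exact absurd h' hne
      · rcases Nat.lt_succ_iff_lt_or_eq.1 hj with hj | rfl
        · exact absurd ⟨j, hj, h'⟩ hnc
        · exact (hRe _).2 ⟨⟨h', hnc⟩, hne⟩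
    have hcyc := isEven_edgeVec (hC i (by omega)).rooted.1
    have hmono : Submodule.span (ZMod 2) (edgeVec G '' (C '' Set.Iio i)) ≤
        Submodule.span (ZMod 2) (edgeVec G '' (C '' Set.Iio (i + 1))) :=
      Submodule.span_mono (Set.image_mono (Set.image_mono (Set.Iio_subset_Iio (by omega))))
    have hmem : edgeVec G (C i) ∈
        Submodule.span (ZMod 2) (edgeVec G '' (C '' Set.Iio (i + 1))) :=
      Submodule.subset_span ⟨_, ⟨i, by simp, rfl⟩, rfl⟩
    -- In characteristic two this cancels the common value on the last ear; the other edges of `C i`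
    -- are covered earlier or equal to the root edge.
    have hy := ih (by omega) (x := x + edgeExt x f₀ • edgeVec G (C i)) (by
      intro a
      simp only [edgeExt_add, edgeExt_smul, Finset.sum_add_distrib, ← Finset.mul_sum, hx a,
        hcyc a, mul_zero, add_zero]) (by
      intro f hf
      by_contra! hf'
      rw [edgeExt_add, edgeExt_smul, edgeExt_edgeVec] at hf
      by_cases hfR : f ∈ R.edges
      · rw [hconst f hfR, Set.indicator_of_mem ((hRe f).1 hfR).1.1] at hf
        exact hf (by rw [Pi.one_apply, mul_one]; exact CharTwo.add_self_eq_zero _)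
      · have hfC : f ∉ (C i).edgeSet := fun h' => hfR ((hRe f).2 ⟨⟨h', hf'.2⟩, hf'.1⟩)
        rw [Set.indicator_of_notMem hfC, mul_zero, add_zero] at hf
        rcases hsupp f hf with h' | ⟨j, hj, h'⟩
        · exact hf'.1 h'
        · rcases Nat.lt_succ_iff_lt_or_eq.1 hj with hj | rfl
          · exact hf'.2 ⟨j, hj, h'⟩
          · exact hfC h')
    have h1 := Submodule.sub_mem _ (hmono hy)
      (Submodule.smul_mem _ (edgeExt x f₀) hmem)
    rwa [add_sub_cancel_right] at h1

omit [Fintype V] in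
theorem injective_of_isBest {e : Sym2 V} (hC : ∀ i < k, IsBest w e (covered C i) (C i)) :
    Function.Injective fun i : Fin k => C i := by
  have key : ∀ i j : Fin k, i < j → C i ≠ C j := by
    intro i j hij heq
    obtain ⟨f, hf, hfj⟩ := (hC j j.2).new
    exact hfj ⟨i, hij, heq ▸ hf⟩
  intro i j hij
  rcases lt_trichotomy i j with h | h | h
  · exact absurd hij (key i j h)
  · exact h
  · exact absurd hij.symm (key j i h)

omit [Fintype V] in
theorem linearIndependent_of_isBest {e : Sym2 V}
    (hC : ∀ i < k, IsBest w e (covered C i) (C i)) :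
    LinearIndependent (ZMod 2) fun i : Fin k => edgeVec G (C i) := by
  choose f hf using fun i : Fin k => (hC i i.2).new
  refine linearIndependent_of_triangular _
    (fun i => ⟨f i, (C i).edgeSet_subset (hf i).1⟩) (fun i => ?_) (fun i j hij => ?_)
  · simp [edgeVec, (hf i).1]
  · have : f i ∉ (C j).edgeSet := fun h' => (hf i).2 ⟨j, hij, h'⟩
    simp [edgeVec, this]

theorem isRootedCycleBasis_of_isBest (h : G.Adj u v) (hw : ∀ f ∈ G.edgeSet, 0 < w f)
    (hC : ∀ i < k, IsBest w s(u, v) (covered C i) (C i))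
    (hcov : ∀ f ∈ G.edgeSet, f ≠ s(u, v) → f ∈ covered C k) :
    IsRootedCycleBasis s(u, v) (Set.range fun i : Fin k => C i) where
  rooted := by
    rintro _ ⟨i, rfl⟩
    exact (hC i i.2).rooted
  indep := (linearIndepOn_range_iff (injective_of_isBest hC) _).2 (linearIndependent_of_isBest hC)
  span_eq := by
    refine le_antisymm (Submodule.span_mono (Set.image_mono ?_)) fun x hx => ?_
    · rintro _ ⟨i, rfl⟩
      exact (hC i i.2).rooted.1
    · have := mem_span_of_isEven h hw hC le_rfl (isEven_of_mem_cycleSpace hx) (by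
        intro f hf
        by_contra! hf'
        refine hf'.2 (hcov f ?_ hf'.1)
        by_contra hfG
        exact hf (by unfold edgeExt; rw [dif_neg hfG]))
      refine Submodule.span_mono (Set.image_mono ?_) this
      rintro _ ⟨i, hi, rfl⟩
      exact ⟨⟨i, hi⟩, rfl⟩

/-- All bases have `k` members. With the other basis sorted by weight, the comparison even holds
member by member, by a count of dimensions. -/
theorem isMinRootedCycleBasis_of_isBest (h : G.Adj u v) (hw : ∀ f ∈ G.edgeSet, 0 < w f)
    (hC : ∀ i < k, IsBest w s(u, v) (covered C i) (C i))
    (hcov : ∀ f ∈ G.edgeSet, f ≠ s(u, v) → f ∈ covered C k) :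
    IsMinRootedCycleBasis w s(u, v) (Set.range fun i : Fin k => C i) := by
  classical
  have hB := isRootedCycleBasis_of_isBest h hw hC hcov
  refine ⟨hB, fun B' hB' => ?_⟩
  have hinj := injective_of_isBest hC
  have : Fintype B' := Fintype.ofFinite _
  have hli : LinearIndependent (ZMod 2) fun D : B' => edgeVec G D := hB'.indep
  have hcard : Fintype.card B' = k := by
    have h1 := finrank_span_eq_card hli
    have h2 := finrank_span_eq_card (linearIndependent_of_isBest hC)
    rw [Fintype.card_fin] at h2
    have e1 : Set.range (fun D : B' => edgeVec G D) = edgeVec G '' B' := by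
      ext x; simp
    have e2 : Set.range (fun i : Fin k => edgeVec G (C i)) =
        edgeVec G '' Set.range fun i : Fin k => C i := by
      ext x; simp
    rw [e1, hB'.span_eq] at h1
    rw [e2, hB.span_eq] at h2
    exact h1.symm.trans h2
  let q : Fin k ≃ B' := (Fintype.equivFinOfCardEq hcard).symm
  let D : Fin k → B' := fun i => q (Tuple.sort (fun i => weight w (q i : G.Subgraph)) i)
  have hmono : Monotone fun i => weight w (D i : G.Subgraph) :=
    Tuple.monotone_sort fun i => weight w (q i : G.Subgraph)
  have hDinj : Function.Injective fun i => (D i : G.Subgraph) :=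
    Subtype.val_injective.comp (q.injective.comp (Equiv.injective _))
  have hDrange : Set.range (fun i => (D i : G.Subgraph)) = B' := by
    ext x
    constructor
    · rintro ⟨i, rfl⟩; exact (D i).2
    · intro hx
      refine ⟨(Tuple.sort fun i => weight w (q i : G.Subgraph)).symm (q.symm ⟨x, hx⟩), ?_⟩
      simp [D]
  have hle : ∀ i : Fin k, weight w (C i) ≤ weight w (D i : G.Subgraph) := by
    intro i
    by_contra! hlt
    -- These cycles are lighter than `C i`, so by the greedy choice none of them has an edge that is
    -- uncovered at step `i`.
    have hsub : ∀ j : Fin (i + 1), edgeVec G (D ⟨j, by omega⟩ : G.Subgraph) ∈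
        Submodule.span (ZMod 2) (edgeVec G '' (C '' Set.Iio i)) := by
      intro j
      have hrc := hB'.rooted _ (D ⟨j, by omega⟩).2
      refine mem_span_of_isEven h hw hC i.2.le (isEven_edgeVec hrc.1) fun f hf => Or.inr ?_
      by_contra hfC
      rw [edgeExt_edgeVec, Set.indicator_apply_ne_zero] at hf
      have h1 := (hC i i.2).shortest _ hrc ⟨f, hf.1, hfC⟩
      have h2 := hmono (show (⟨j, by omega⟩ : Fin k) ≤ i from Nat.le_of_lt_succ j.2)
      simp only at h2
      linarith
    have hli' : LinearIndependent (ZMod 2)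
        fun j : Fin (i + 1) => edgeVec G (D ⟨j, by omega⟩ : G.Subgraph) := by
      refine hli.comp (fun j : Fin (i + 1) => D ⟨j, by omega⟩) fun j l hjl => ?_
      have := hDinj (congrArg Subtype.val hjl)
      rw [Fin.ext_iff] at this ⊢
      exact this
    have h1 := finrank_span_eq_card hli'
    rw [Fintype.card_fin] at h1
    have h2 : Submodule.span (ZMod 2) (Set.range
        fun j : Fin (i + 1) => edgeVec G (D ⟨j, by omega⟩ : G.Subgraph)) ≤
        Submodule.span (ZMod 2) (edgeVec G '' (C '' Set.Iio i)) := by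
      rw [Submodule.span_le]
      rintro _ ⟨j, rfl⟩
      exact hsub j
    have h3 := Submodule.finrank_mono h2
    have h4 := finrank_span_finset_le_card (R := ZMod 2)
      (((Finset.range i).image C).image (edgeVec G))
    have h5 : ((((Finset.range i).image C).image (edgeVec G) : Finset _) : Set _) =
        edgeVec G '' (C '' Set.Iio i) := by
      ext x; simp
    rw [h5] at h4
    have h6 : (((Finset.range i).image C).image (edgeVec G)).card ≤ i :=
      Finset.card_image_le.trans (Finset.card_image_le.trans (by simp))
    rw [h1] at h3
    exact absurd (h3.trans (h4.trans h6)) (by omega)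
  have e1 : totalWeight w (Set.range fun i : Fin k => C i) = ∑ i : Fin k, weight w (C i) := by
    rw [totalWeight, finsum_mem_range hinj, finsum_eq_sum_of_fintype]
  have e2 : totalWeight w B' = ∑ i : Fin k, weight w (D i : G.Subgraph) := by
    rw [totalWeight, ← finsum_eq_sum_of_fintype, ← finsum_mem_range hDinj, hDrange]
  rw [e1, e2]
  exact Finset.sum_le_sum fun i _ => hle i

end Basis

end

end RootedCycleBasis

/-! ### The cheapest rooted cycle through an edge as an assignment problem -/

namespace RootedCycleBasis

noncomputable section

/-! ### Rooted cycles through an edge as permutations -/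

section CyclePerm

open SimpleGraph Equiv

variable {V : Type*} [Fintype V] [DecidableEq V] {G : SimpleGraph V}

/-- The values that are allowed for a permutation that encodes two disjoint paths from the ends
`u`, `v` of the root edge to the ends `x`, `y` of the target edge: the targets are sent back to the
roots, and every other vertex is fixed or sent to a neighbour. -/
def IsArc (G : SimpleGraph V) (u v x y a b : V) : Prop :=
  if a = x ∨ a = y then b = u ∨ b = v else b = a ∨ G.Adj a b

/-- The cost of an arc; the rows of the targets account for the target edge and the root edge. -/
def arcCost {M : Type*} [Zero M] (h : Sym2 V → M) (u v x y a b : V) : M :=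
  if a = x then h s(x, y) else if a = y then h s(u, v) else if b = a then 0 else h s(a, b)

/-! #### Existence -/

-- A walk from `p` to `q` that avoids `d` has to leave `A`; in this form 2-connectivity enters
-- Hall's condition.
omit [Fintype V] [DecidableEq V] in
theorem IsBiconnected.exists_adj_boundary (hG : IsBiconnected G) {A : Set V} {p q d : V}
    (hp : p ∈ A) (hq : q ∉ A) (hpd : p ≠ d) (hqd : q ≠ d) :
    ∃ a ∈ A, ∃ b ∉ A, b ≠ d ∧ G.Adj a b := by
  obtain ⟨W⟩ := hG.2 d ⟨p, hpd⟩ ⟨q, hqd⟩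
  obtain ⟨D, -, h1, h2⟩ := W.exists_boundary_dart {z | (z : V) ∈ A} hp hq
  exact ⟨D.fst, h1, D.snd, h2, D.snd.2, D.adj⟩

/-- Hall's theorem takes the place of Menger's theorem. The rows in `A` that are not targets can
stay fixed, so they reach themselves. For each target row in `A`, one more column is needed, and it
is either a root or a vertex through which paths leave `A'`. -/
theorem IsBiconnected.exists_arcPerm (hG : IsBiconnected G) {u v x y : V} (huv : u ≠ v)
    (hxy : x ≠ y) : ∃ τ : Perm V, ∀ a, IsArc G u v x y a (τ a) := by
  classical
  obtain ⟨τ, hτ, hr⟩ := (Fintype.all_card_le_filter_rel_iff_exists_injective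
    (IsArc G u v x y)).1 (by
      intro A
      set N : Finset V := {b | ∃ a ∈ A, IsArc G u v x y a b} with hN
      have memN : ∀ {b}, b ∈ N ↔ ∃ a ∈ A, IsArc G u v x y a b := by intro b; simp [N]
      set A' := (A.erase x).erase y with hA'
      have memA' : ∀ {a}, a ∈ A' ↔ a ≠ y ∧ a ≠ x ∧ a ∈ A := by intro a; simp [A']
      have hx' : x ∉ A' := fun h => (memA'.1 h).2.1 rfl
      have hy' : y ∉ A' := fun h => (memA'.1 h).1 rfl
      have hsub : A' ⊆ N := by
        intro a ha
        rw [memA'] at ha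
        exact memN.2 ⟨a, ha.2.2, by rw [IsArc, if_neg (by tauto)]; exact Or.inl rfl⟩
      have hadj : ∀ {a b}, a ∈ A' → G.Adj a b → b ∈ N := by
        intro a b ha hab
        rw [memA'] at ha
        exact memN.2 ⟨a, ha.2.2, by rw [IsArc, if_neg (by tauto)]; exact Or.inr hab⟩
      have one : ∀ {b}, b ∈ N → b ∉ A' → A'.card + 1 ≤ N.card := by
        intro b hb hbA
        rw [← Finset.card_insert_of_notMem hbA]
        exact Finset.card_le_card (Finset.insert_subset hb hsub)
      have two : ∀ {b c}, b ∈ N → b ∉ A' → c ∈ N → c ∉ A' → b ≠ c → A'.card + 2 ≤ N.card := by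
        intro b c hb hbA hc hcA hbc
        have : b ∉ insert c A' := by simp [hbc, hbA]
        have e : (insert b (insert c A')).card = A'.card + 2 := by
          rw [Finset.card_insert_of_notMem this, Finset.card_insert_of_notMem hcA]
        rw [← e]
        exact Finset.card_le_card (Finset.insert_subset hb (Finset.insert_subset hc hsub))
      have roots : x ∈ A ∨ y ∈ A → u ∈ N ∧ v ∈ N := by
        rintro (h | h)
        · exact ⟨memN.2 ⟨x, h, by simp [IsArc]⟩, memN.2 ⟨x, h, by simp [IsArc]⟩⟩
        · exact ⟨memN.2 ⟨y, h, by simp [IsArc]⟩, memN.2 ⟨y, h, by simp [IsArc]⟩⟩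
      have other : ∀ d, ∃ q ∉ A', q ≠ d := by
        intro d
        by_cases h : x = d
        · exact ⟨y, hy', fun h' => hxy (h.trans h'.symm)⟩
        · exact ⟨x, hx', h⟩
      have single : x ∈ A ∨ y ∈ A → A'.card + 1 ≤ N.card := by
        intro h
        obtain ⟨hu, hv⟩ := roots h
        by_cases hu' : u ∈ A'
        · by_cases hv' : v ∈ A'
          · obtain ⟨a, ha, b, hb, -, hab⟩ := hG.exists_adj_boundary (A := A') hu' hx' huv
              (fun h => hx' (h ▸ hv'))
            exact one (hadj ha hab) hb
          · exact one hv hv'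
        · exact one hu hu'
      by_cases hxA : x ∈ A <;> by_cases hyA : y ∈ A
      · have hcard : A.card = A'.card + 2 := by
          rw [hA', Finset.card_erase_of_mem (Finset.mem_erase.2 ⟨hxy.symm, hyA⟩),
            Finset.card_erase_of_mem hxA]
          have : 1 < A.card := Finset.one_lt_card.2 ⟨x, hxA, y, hyA, hxy⟩
          omega
        rw [hcard]
        obtain ⟨hu, hv⟩ := roots (Or.inl hxA)
        -- Given one extra column `d`, a second one comes from leaving `A'` in the graph without
        -- `d`, towards a target different from `d`.
        have step : ∀ {p d}, p ∈ A' → p ≠ d → d ∈ N → d ∉ A' → A'.card + 2 ≤ N.card := by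
          intro p d hp hpd hd hdA
          obtain ⟨q, hq, hqd⟩ := other d
          obtain ⟨a, ha, b, hb, hbd, hab⟩ := hG.exists_adj_boundary (A := A') hp hq hpd hqd
          exact two (hadj ha hab) hb hd hdA hbd
        by_cases hu' : u ∈ A'
        · by_cases hv' : v ∈ A'
          · obtain ⟨a, ha, b, hb, -, hab⟩ := hG.exists_adj_boundary (A := A') hu' hx' huv
              (fun h => hx' (h ▸ hv'))
            exact step (d := b) hu' (by rintro rfl; exact hb hu') (hadj ha hab) hb
          · exact step hu' huv hv hv'
        · by_cases hv' : v ∈ A'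
          · exact step hv' huv.symm hu hu'
          · exact two hu hu' hv hv' huv
      · have hcard : A.card = A'.card + 1 := by
          rw [hA', Finset.erase_eq_of_notMem (a := y) (by simp [hyA]),
            Finset.card_erase_of_mem hxA]
          have := Finset.card_pos.2 ⟨x, hxA⟩
          omega
        rw [hcard]
        exact single (Or.inl hxA)
      · have hcard : A.card = A'.card + 1 := by
          rw [hA', Finset.erase_eq_of_notMem (a := x) hxA, Finset.card_erase_of_mem hyA]
          have := Finset.card_pos.2 ⟨y, hyA⟩
          omega
        rw [hcard]
        exact single (Or.inr hyA)
      · have : A = A' := by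
          rw [hA', Finset.erase_eq_of_notMem (a := x) hxA, Finset.erase_eq_of_notMem hyA]
        exact Finset.card_le_card (this ▸ hsub))
  exact ⟨Equiv.ofBijective τ (Finite.injective_iff_bijective.1 hτ), hr⟩

/-! #### From cycles to permutations -/

-- The permutation moves every vertex one step along the path and the end back to the start. It is
-- assembled from transpositions along the path.
omit [Fintype V] in
theorem exists_walkPerm {a b : V} (A : G.Walk a b) (hA : A.IsPath) :
    ∃ τ : Perm V, τ b = a ∧ (∀ z ∉ A.support, τ z = z) ∧
      (∀ z ∈ A.support, z ≠ b → G.Adj z (τ z)) ∧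
      ∀ {M : Type} [AddCommMonoid M] (h : Sym2 V → M),
        ∑ z ∈ A.support.toFinset.erase b, h s(z, τ z) = pathSum h A := by
  induction A with
  | nil => exact ⟨1, rfl, by simp, by simp, by simp⟩
  | @cons a a' b haa' A ih =>
    rw [Walk.cons_isPath_iff] at hA
    obtain ⟨τ, h1, h2, h3, h4⟩ := ih hA.1
    have hab : a ≠ b := fun h => hA.2 (h ▸ A.end_mem_support)
    have hτa : τ a = a := h2 a hA.2
    have key : ∀ z, z ≠ a → z ≠ b → (swap a a' * τ) z = τ z := by
      intro z hza hzb
      rw [Perm.mul_apply, swap_apply_of_ne_of_ne]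
      · exact fun h => hza (τ.injective (h.trans hτa.symm))
      · exact fun h => hzb (τ.injective (h.trans h1.symm))
    have ka : (swap a a' * τ) a = a' := by rw [Perm.mul_apply, hτa, swap_apply_left]
    refine ⟨swap a a' * τ, by rw [Perm.mul_apply, h1, swap_apply_right], ?_, ?_, ?_⟩
    · intro z hz
      rw [Walk.support_cons, List.mem_cons, not_or] at hz
      rw [key z hz.1 (fun h => hz.2 (h ▸ A.end_mem_support)), h2 z hz.2]
    · intro z hz hzb
      by_cases hza : z = a
      · rw [hza, ka]; exact haa'
      · rw [key z hza hzb]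
        rw [Walk.support_cons, List.mem_cons] at hz
        exact h3 z (hz.resolve_left hza) hzb
    · intro M _ h
      rw [Walk.support_cons, List.toFinset_cons, Finset.erase_insert_of_ne hab,
        Finset.sum_insert (by simp [hA.2]), ka, pathSum_cons, ← h4 h]
      congr 1
      refine Finset.sum_congr rfl fun z hz => ?_
      rw [Finset.mem_erase, List.mem_toFinset] at hz
      rw [key z (fun h => hA.2 (h ▸ hz.2)) hz.1]

omit [Fintype V] [DecidableEq V] in
theorem exists_append_of_mem_edges {u v : V} {P : G.Walk u v} {f : Sym2 V} (hf : f ∈ P.edges) :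
    ∃ (c d : V) (A : G.Walk u c) (h : G.Adj c d) (B : G.Walk d v),
      P = A.append (Walk.cons h B) ∧ f = s(c, d) := by
  induction P with
  | nil => simp at hf
  | @cons u a v h P ih =>
    rw [Walk.edges_cons, List.mem_cons] at hf
    rcases hf with rfl | hf
    · exact ⟨u, a, .nil, h, P, rfl, rfl⟩
    · obtain ⟨c, d, A, hcd, B, rfl, hf'⟩ := ih hf
      exact ⟨c, d, .cons h A, hcd, B, rfl, hf'⟩

/-- Removing the root edge and the target edge from the cycle leaves two disjoint paths, one
starting at `u` and one at `v`. Rotating along both gives the permutation; its cost is that of the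
cycle since the two target rows pay for the removed edges. -/
theorem IsRootedCycle.exists_arcPerm {u v x y : V} (huv : G.Adj u v) (hxy : G.Adj x y)
    (hne : s(x, y) ≠ s(u, v)) {D : G.Subgraph} (hD : IsRootedCycle s(u, v) D)
    (hf : s(x, y) ∈ D.edgeSet) :
    ∃ τ : Perm V, (∀ a, IsArc G u v x y a (τ a)) ∧
      ∀ {M : Type} [AddCommMonoid M] (h : Sym2 V → M),
        permCost (arcCost h u v x y) τ = ∑ᶠ f ∈ D.edgeSet, h f := by
  obtain ⟨P, hP, he, rfl⟩ := hD.exists_path huv.symm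
  rw [edgeSet_closePath] at hf
  obtain ⟨c, d, A, hcd, B, rfl, hfcd⟩ := exists_append_of_mem_edges (hf.resolve_left hne)
  have hP' := hP
  rw [isPath_append_iff, Walk.cons_isPath_iff] at hP'
  obtain ⟨hA, ⟨hB, hcB⟩, hAB⟩ := hP'
  have hdisj : ∀ z ∈ A.support, z ∉ B.support := by
    intro z hz hzB
    have := hAB z hz (by simp [hzB])
    exact hcB (this ▸ hzB)
  obtain ⟨τ₁, h11, h12, h13, h14⟩ := exists_walkPerm A hA
  obtain ⟨τ₂, h21, h22, h23, h24⟩ := exists_walkPerm B.reverse (B.isPath_reverse_iff.2 hB)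
  simp only [Walk.support_reverse, List.mem_reverse, List.toFinset_reverse, pathSum_reverse]
    at h22 h23 h24
  have kA : ∀ z ∈ A.support, (τ₁ * τ₂) z = τ₁ z := by
    intro z hz
    rw [Perm.mul_apply, h22 z (hdisj z hz)]
  have kB : ∀ z ∉ A.support, (τ₁ * τ₂) z = τ₂ z := by
    intro z hz
    rw [Perm.mul_apply]
    by_cases hzB : z ∈ B.support
    · have : τ₂ z ∈ B.support := by
        by_contra h
        rw [τ₂.injective (h22 _ h)] at h
        exact h hzB
      exact h12 _ fun h => hdisj _ h this
    · rw [h22 z hzB, h12 z hz]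
  have hcA : c ∈ A.support := A.end_mem_support
  have hdB : d ∈ B.support := B.start_mem_support
  have hdA : d ∉ A.support := fun h => hdisj d h hdB
  have hcases : (c = x ∧ d = y) ∨ (c = y ∧ d = x) := by
    rcases Sym2.eq_iff.1 hfcd with ⟨h1, h2⟩ | ⟨h1, h2⟩
    · exact Or.inl ⟨h1.symm, h2.symm⟩
    · exact Or.inr ⟨h2.symm, h1.symm⟩
  have htarget : ∀ z, (z = x ∨ z = y) ↔ (z = c ∨ z = d) := by
    intro z
    rcases hcases with ⟨rfl, rfl⟩ | ⟨rfl, rfl⟩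
    · rfl
    · exact or_comm
  refine ⟨τ₁ * τ₂, fun z => ?_, fun {M} _ h => ?_⟩
  · rw [IsArc]
    split_ifs with hz
    · rw [htarget] at hz
      rcases hz with rfl | rfl
      · rw [kA _ hcA]; exact Or.inl h11
      · rw [kB _ hdA]; exact Or.inr h21
    · rw [htarget, not_or] at hz
      by_cases hzA : z ∈ A.support
      · rw [kA z hzA]; exact Or.inr (h13 z hzA hz.1)
      · rw [kB z hzA]
        by_cases hzB : z ∈ B.support
        · exact Or.inr (h23 z hzB hz.2)
        · exact Or.inl (h22 z hzB)
  · rw [finsum_edgeSet_closePath huv.symm hP he, pathSum_append, pathSum_cons, ← hfcd,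
      ← h14 h, ← h24 h]
    have hgen : ∀ z, z ≠ c → z ≠ d → arcCost h u v x y z ((τ₁ * τ₂) z) =
        if (τ₁ * τ₂) z = z then 0 else h s(z, (τ₁ * τ₂) z) := by
      intro z hzc hzd
      have := (htarget z).not.2 (by tauto)
      rw [not_or] at this
      rw [arcCost, if_neg this.1, if_neg this.2]
    -- Either target may come first on the path. The costs of the target rows do not depend on the
    -- column, so both cases give the same total.
    have hcd' : arcCost h u v x y c ((τ₁ * τ₂) c) + arcCost h u v x y d ((τ₁ * τ₂) d) =
        h s(u, v) + h s(x, y) := by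
      rcases hcases with ⟨rfl, rfl⟩ | ⟨rfl, rfl⟩
      · simp [arcCost, hxy.ne.symm, add_comm]
      · simp [arcCost, hxy.ne.symm]
    have eA : ∑ z ∈ A.support.toFinset.erase c, h s(z, τ₁ z) =
        ∑ z ∈ A.support.toFinset.erase c, arcCost h u v x y z ((τ₁ * τ₂) z) := by
      refine Finset.sum_congr rfl fun z hz => ?_
      rw [Finset.mem_erase, List.mem_toFinset] at hz
      rw [hgen z hz.1 (fun h => hdA (h ▸ hz.2)), kA z hz.2, if_neg (h13 z hz.2 hz.1).ne']
    have eB : ∑ z ∈ B.support.toFinset.erase d, h s(z, τ₂ z) =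
        ∑ z ∈ B.support.toFinset.erase d, arcCost h u v x y z ((τ₁ * τ₂) z) := by
      refine Finset.sum_congr rfl fun z hz => ?_
      rw [Finset.mem_erase, List.mem_toFinset] at hz
      have hzA : z ∉ A.support := fun h => hdisj z h hz.2
      rw [hgen z (fun h => hcB (h ▸ hz.2)) hz.1, kB z hzA, if_neg (h23 z hz.2 hz.1).ne']
    have htot : permCost (arcCost h u v x y) (τ₁ * τ₂) =
        ∑ z ∈ A.support.toFinset, arcCost h u v x y z ((τ₁ * τ₂) z) +
        ∑ z ∈ B.support.toFinset, arcCost h u v x y z ((τ₁ * τ₂) z) := by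
      rw [permCost, ← Finset.sum_union]
      · refine (Finset.sum_subset (Finset.subset_univ _) fun z _ hz => ?_).symm
        simp only [Finset.mem_union, List.mem_toFinset, not_or] at hz
        rw [hgen z (fun h => hz.1 (h ▸ hcA)) (fun h => hz.2 (h ▸ hdB)), kB z hz.1,
          if_pos (h22 z hz.2)]
      · rw [Finset.disjoint_left]
        intro z hz hz'
        rw [List.mem_toFinset] at hz hz'
        exact hdisj z hz hz'
    rw [htot, ← Finset.add_sum_erase _ _ (List.mem_toFinset.2 hcA),
      ← Finset.add_sum_erase _ _ (List.mem_toFinset.2 hdB), ← eA, ← eB, add_add_add_comm, hcd']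
    abel

end CyclePerm

end

end RootedCycleBasis

namespace RootedCycleBasis

noncomputable section

/-! ### From cheapest permutations back to rooted cycles -/

section PermCycle

open SimpleGraph Equiv

variable {V Γ : Type*} [Fintype V] [DecidableEq V] {G : SimpleGraph V} {u v x y : V}

/-- The edges that a permutation uses, with the target edge and the root edge. -/
def permEdges (u v x y : V) (τ : Perm V) : Set (Sym2 V) :=
  {f | f = s(u, v) ∨ f = s(x, y) ∨ ∃ a, a ≠ x ∧ a ≠ y ∧ τ a ≠ a ∧ f = s(a, τ a)}

/-- A cheapest permutation encoding two disjoint paths. -/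
structure IsBestPerm [AddCommGroup Γ] [LinearOrder Γ] (G : SimpleGraph V) (g : Sym2 V → Γ)
    (u v x y : V) (τ : Perm V) : Prop where
  arc : ∀ a, IsArc G u v x y a (τ a)
  le : ∀ τ' : Perm V, (∀ a, IsArc G u v x y a (τ' a)) →
    permCost (arcCost g u v x y) τ ≤ permCost (arcCost g u v x y) τ'

variable [AddCommGroup Γ] [LinearOrder Γ] [IsOrderedAddMonoid Γ] {g : Sym2 V → Γ} {τ : Perm V}

/-- Outside an invariant set that contains the targets, a cheapest permutation is trivial. -/
theorem IsBestPerm.apply_eq_self (hg : ∀ f ∈ G.edgeSet, 0 < g f)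
    (hτ : IsBestPerm G g u v x y τ) {K : Set V} (hK : ∀ z, z ∈ K ↔ τ z ∈ K) (hx : x ∈ K)
    (hy : y ∈ K) {z : V} (hz : z ∉ K) : τ z = z := by
  classical
  by_contra hne
  -- Making `τ` the identity outside `K` keeps it admissible and saves the positive cost of every
  -- row moved there.
  let τ' : Perm V := Perm.ofSubtype (τ.subtypePerm (p := fun z => z ∈ K) fun z => (hK z).symm)
  have h1 : ∀ a ∈ K, τ' a = τ a := by
    intro a ha
    simp only [τ']
    rw [Perm.ofSubtype_apply_of_mem _ ha]
    rfl
  have h2 : ∀ a ∉ K, τ' a = a := fun a ha => Perm.ofSubtype_apply_of_not_mem _ ha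
  have hnt : ∀ a ∉ K, a ≠ x ∧ a ≠ y := by
    intro a ha
    exact ⟨fun h => ha (h ▸ hx), fun h => ha (h ▸ hy)⟩
  have hle := hτ.le τ' (by
    intro a
    by_cases ha : a ∈ K
    · rw [h1 a ha]; exact hτ.arc a
    · have := hnt a ha
      rw [h2 a ha, IsArc, if_neg (by tauto)]
      exact Or.inl rfl)
  have hpos : ∀ a ∉ K, τ a ≠ a → 0 < arcCost g u v x y a (τ a) := by
    intro a ha hne
    have h3 := hnt a ha
    have h4 := hτ.arc a
    rw [IsArc, if_neg (by tauto)] at h4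
    rw [arcCost, if_neg h3.1, if_neg h3.2, if_neg hne]
    exact hg _ (h4.resolve_left hne)
  have hzero : ∀ a ∉ K, arcCost g u v x y a a = 0 := by
    intro a ha
    rw [arcCost, if_neg (hnt a ha).1, if_neg (hnt a ha).2, if_pos rfl]
  refine absurd hle (not_le.2 ?_)
  refine Finset.sum_lt_sum (fun a _ => ?_) ⟨z, Finset.mem_univ z, ?_⟩
  · by_cases ha : a ∈ K
    · rw [h1 a ha]
    · rw [h2 a ha, hzero a ha]
      by_cases hne : τ a = a
      · rw [hne, hzero a ha]
      · exact (hpos a ha hne).le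
  · rw [h2 z hz, hzero z hz]
    exact hpos z hz hne

/-- The edges of a cheapest permutation form a rooted cycle through the target edge. -/
theorem IsBestPerm.isRootedCycle (hg : ∀ f ∈ G.edgeSet, 0 < g f) (huv : G.Adj u v)
    (hxy : G.Adj x y) (hne : s(x, y) ≠ s(u, v)) (hτ : IsBestPerm G g u v x y τ) :
    IsRootedCycle s(u, v) (ofEdges G (permEdges u v x y τ)) ∧
      (ofEdges G (permEdges u v x y τ)).edgeSet = permEdges u v x y τ ∧
      ∀ {M : Type} [AddCommMonoid M] (h : Sym2 V → M),
        permCost (arcCost h u v x y) τ = ∑ᶠ f ∈ permEdges u v x y τ, h f := by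
  classical
  set F := permEdges u v x y τ with hF
  set D := ofEdges G F with hD
  have hτx : τ x = u ∨ τ x = v := by
    have := hτ.arc x
    rwa [IsArc, if_pos (Or.inl rfl)] at this
  have hτy : τ y = u ∨ τ y = v := by
    have := hτ.arc y
    rwa [IsArc, if_pos (Or.inr rfl)] at this
  have hτxy : τ x ≠ τ y := fun h => hxy.ne (τ.injective h)
  have hroot : ∀ {a}, τ a = u ∨ τ a = v → a = x ∨ a = y := by
    intro a ha
    have : τ a = τ x ∨ τ a = τ y := by
      rcases hτx with h1 | h1 <;> rcases hτy with h2 | h2 <;> rcases ha with h3 | h3 <;>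
        rw [h1, h2, h3] <;> simp_all
    rcases this with h | h
    · exact Or.inl (τ.injective h)
    · exact Or.inr (τ.injective h)
  have htgt : ∀ {a}, a = x ∨ a = y → τ a = u ∨ τ a = v := by
    rintro a (rfl | rfl)
    exacts [hτx, hτy]
  have hFG : F ⊆ G.edgeSet := by
    rintro f (rfl | rfl | ⟨a, hax, hay, hne, rfl⟩)
    · exact huv
    · exact hxy
    · have := hτ.arc a
      rw [IsArc, if_neg (by tauto)] at this
      exact this.resolve_left hne
  have hDF : D.edgeSet = F := by
    rw [hD, edgeSet_ofEdges]
    exact Set.inter_eq_right.2 hFG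
  have hDadj : ∀ {a b}, D.Adj a b ↔ s(a, b) ∈ F := by
    intro a b
    rw [← hDF]; rfl
  -- no cycles of length two
  have hinv : ∀ a, a ≠ x → a ≠ y → a ≠ u → a ≠ v → τ (τ a) = a → τ a = a := by
    intro a hax hay hau hav haa
    have hb : ¬ (τ a = x ∨ τ a = y) := by
      intro h
      have := htgt h
      rw [haa] at this
      tauto
    rw [not_or] at hb
    refine hτ.apply_eq_self hg (K := {a, τ a}ᶜ) (fun z => ?_) ?_ ?_ (z := a) (by simp)
    · simp only [Set.mem_compl_iff, Set.mem_insert_iff, Set.mem_singleton_iff, not_or]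
      constructor
      · rintro ⟨h1, h2⟩
        exact ⟨fun h => h2 (τ.injective (h.trans haa.symm)), fun h => h1 (τ.injective h)⟩
      · rintro ⟨h1, h2⟩
        exact ⟨fun h => h2 (by rw [h]), fun h => h1 (by rw [h, haa])⟩
    · simp [hax.symm, Ne.symm hb.1]
    · simp [hay.symm, Ne.symm hb.2]
  -- the two neighbours of a vertex
  let out : V → V := fun a => if a = x then y else if a = y then x else τ a
  let inn : V → V := fun a => if a = u then v else if a = v then u else τ.symm a
  have hout : ∀ {a}, a ≠ x → a ≠ y → out a = τ a := fun h1 h2 => by simp [out, h1, h2]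
  have hinn : ∀ {a}, a ≠ u → a ≠ v → inn a = τ.symm a := fun h1 h2 => by simp [inn, h1, h2]
  have hnbr : ∀ a b, D.Adj a b ↔ a ≠ b ∧ (b = out a ∨ b = inn a) := by
    intro a b
    rw [hDadj]
    constructor
    · intro hab
      refine ⟨(show G.Adj a b from hFG hab).ne, ?_⟩
      rcases hab with hab | hab | ⟨c, hcx, hcy, hne, hab⟩
      · rcases Sym2.eq_iff.1 hab with ⟨rfl, rfl⟩ | ⟨rfl, rfl⟩
        · exact Or.inr (by simp [inn])
        · exact Or.inr (by simp [inn, huv.ne.symm])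
      · rcases Sym2.eq_iff.1 hab with ⟨rfl, rfl⟩ | ⟨rfl, rfl⟩
        · exact Or.inl (by simp [out])
        · exact Or.inl (by simp [out, hxy.ne.symm])
      · rcases Sym2.eq_iff.1 hab with ⟨rfl, rfl⟩ | ⟨rfl, rfl⟩
        · exact Or.inl (hout hcx hcy).symm
        · refine Or.inr ?_
          have h1 : ¬ (τ b = u ∨ τ b = v) := fun h => (hroot h).elim hcx hcy
          rw [not_or] at h1
          rw [hinn h1.1 h1.2, Equiv.symm_apply_apply]
    · rintro ⟨hne', rfl | rfl⟩
      · by_cases hax : a = x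
        · subst hax; exact Or.inr (Or.inl (by simp [out]))
        by_cases hay : a = y
        · subst hay; exact Or.inr (Or.inl (by simp [out, hax, Sym2.eq_swap]))
        rw [hout hax hay] at hne' ⊢
        exact Or.inr (Or.inr ⟨a, hax, hay, hne'.symm, rfl⟩)
      · by_cases hau : a = u
        · subst hau; exact Or.inl (by simp [inn])
        by_cases hav : a = v
        · subst hav; exact Or.inl (by simp [inn, hau, Sym2.eq_swap])
        rw [hinn hau hav] at hne' ⊢
        have h1 : ¬ (τ.symm a = x ∨ τ.symm a = y) := by
          intro h
          have := htgt h
          rw [Equiv.apply_symm_apply] at this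
          tauto
        rw [not_or] at h1
        refine Or.inr (Or.inr ⟨τ.symm a, h1.1, h1.2, ?_, ?_⟩)
        · rw [Equiv.apply_symm_apply]; exact hne'
        · rw [Equiv.apply_symm_apply, Sym2.eq_swap]
  have hfix : ∀ a, τ a = a → a ≠ x ∧ a ≠ y → ∀ b, ¬ D.Adj a b := by
    intro a ha hnt b hab
    have hau : ¬ (a = u ∨ a = v) := by
      intro h
      have := hroot (a := a) (by rwa [ha])
      tauto
    rw [not_or] at hau
    rw [hnbr, hout hnt.1 hnt.2, hinn hau.1 hau.2, ha, (Equiv.symm_apply_eq τ).2 ha.symm] at hab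
    rcases hab.2 with h | h <;> exact hab.1 h.symm
  have hmoved : ∀ a ∈ D.verts, a ≠ x → a ≠ y → τ a ≠ a := by
    rintro a ⟨b, hab⟩ hax hay h
    exact hfix a h ⟨hax, hay⟩ b hab
  have hdeg : ∀ a ∈ D.verts, (D.neighborSet a).ncard = 2 := by
    intro a ha
    have hself : out a ≠ a ∧ inn a ≠ a := by
      constructor
      · by_cases hax : a = x
        · subst hax; simpa [out] using hxy.ne.symm
        by_cases hay : a = y
        · subst hay; simpa [out, hax] using hxy.ne
        rw [hout hax hay]; exact hmoved a ha hax hay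
      · by_cases hau : a = u
        · subst hau; simpa [inn] using huv.ne.symm
        by_cases hav : a = v
        · subst hav; simpa [inn, hau] using huv.ne
        rw [hinn hau hav]
        intro h
        have h' : τ a = a := ((Equiv.symm_apply_eq τ).1 h).symm
        by_cases hnt : a = x ∨ a = y
        · have := htgt hnt
          rw [h'] at this
          tauto
        · rw [not_or] at hnt
          exact hmoved a ha hnt.1 hnt.2 h'
    -- The neighbours of a vertex that is both root and target differ because the target edge is not
    -- the root edge. For a vertex that is only one of these, equality would contradict that the
    -- target rows are the ones with root values. At other vertices it would give a transposition,
    -- excluded by `hinv`.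
    have hne2 : out a ≠ inn a := by
      by_cases hau : a = u ∨ a = v
      · by_cases hax : a = x ∨ a = y
        · intro h
          apply hne
          have e1 : s(a, out a) = s(x, y) := by
            rcases hax with rfl | rfl
            · simp [out]
            · simp [out, hxy.ne.symm, Sym2.eq_swap]
          have e2 : s(a, inn a) = s(u, v) := by
            rcases hau with rfl | rfl
            · simp [inn]
            · simp [inn, huv.ne.symm, Sym2.eq_swap]
          rw [← e1, ← e2, h]
        · have hax' := not_or.1 hax
          rw [hout hax'.1 hax'.2]
          intro h
          apply hax
          apply hroot
          rw [h]
          rcases hau with rfl | rfl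
          · exact Or.inr (by simp [inn])
          · exact Or.inl (by simp [inn, huv.ne.symm])
      · have hau' := not_or.1 hau
        rw [hinn hau'.1 hau'.2]
        intro h
        by_cases hax : a = x ∨ a = y
        · have h1 : τ (out a) = a := by rw [h, Equiv.apply_symm_apply]
          have h2 : out a = x ∨ out a = y := by
            rcases hax with rfl | rfl
            · exact Or.inr (by simp [out])
            · exact Or.inl (by simp [out, hxy.ne.symm])
          have := htgt h2
          rw [h1] at this
          exact hau this
        · have hax' := not_or.1 hax
          rw [hout hax'.1 hax'.2] at h
          exact hmoved a ha hax'.1 hax'.2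
            (hinv a hax'.1 hax'.2 hau'.1 hau'.2 (by rw [h, Equiv.apply_symm_apply]))
    have : D.neighborSet a = {out a, inn a} := by
      ext b
      rw [Subgraph.mem_neighborSet, hnbr, Set.mem_insert_iff, Set.mem_singleton_iff]
      refine and_iff_right_of_imp ?_
      rintro (rfl | rfl)
      exacts [hself.1.symm, hself.2.symm]
    rw [this, Set.ncard_pair hne2]
  -- the component of the root edge is everything
  let K : Set V := {z | Relation.ReflTransGen D.Adj u z}
  have huK : u ∈ K := Relation.ReflTransGen.refl
  have hKadj : ∀ {a b}, a ∈ K → D.Adj a b → b ∈ K := fun ha hab => Relation.ReflTransGen.tail ha hab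
  have huvD : D.Adj u v := hDadj.2 (Or.inl rfl)
  have hxyD : D.Adj x y := hDadj.2 (Or.inr (Or.inl rfl))
  have hvK : v ∈ K := hKadj huK huvD
  have hstep : ∀ {a}, a ∈ K → a ≠ x → a ≠ y → τ a ∈ K := by
    intro a ha hax hay
    by_cases h : τ a = a
    · rwa [h]
    · exact hKadj ha (hDadj.2 (Or.inr (Or.inr ⟨a, hax, hay, h, rfl⟩)))
  -- On a finite set, an injective map into itself is onto, so forward invariance suffices.
  have himg : (∀ a ∈ K, τ a ∈ K) → ∀ a, a ∈ K ↔ τ a ∈ K := by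
    intro h a
    refine ⟨h a, fun ha => ?_⟩
    have h1 : τ '' K ⊆ K := by
      rintro _ ⟨b, hb, rfl⟩
      exact h b hb
    have h2 : τ '' K = K :=
      Set.eq_of_subset_of_ncard_le h1 (Set.ncard_image_of_injective K τ.injective).ge
    rw [← h2] at ha
    obtain ⟨b, hb, hba⟩ := ha
    exact τ.injective hba ▸ hb
  -- Without the targets, the component `K` of the roots would be invariant under `τ`; but `τ` maps
  -- `x` to a root, so `x` would lie in it.
  have hxyK : x ∈ K ∧ y ∈ K := by
    by_contra hnot
    have hxK : x ∉ K := fun h => hnot ⟨h, hKadj h hxyD⟩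
    have hyK : y ∉ K := fun h => hnot ⟨hKadj h hxyD.symm, h⟩
    have hcl := himg fun a ha => hstep ha (fun h => hxK (h ▸ ha)) (fun h => hyK (h ▸ ha))
    rcases hτx with h | h
    · exact hxK ((hcl x).2 (h ▸ huK))
    · exact hxK ((hcl x).2 (h ▸ hvK))
  have hKcl := himg fun a ha => by
    by_cases h : a = x ∨ a = y
    · rcases htgt h with h | h
      · exact h ▸ huK
      · exact h ▸ hvK
    · rw [not_or] at h
      exact hstep ha h.1 h.2
  have hvertsK : ∀ a ∈ D.verts, a ∈ K := by
    rintro a ⟨b, hab⟩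
    by_contra haK
    exact hfix a (hτ.apply_eq_self hg hKcl hxyK.1 hxyK.2 haK)
      ⟨fun h => haK (h ▸ hxyK.1), fun h => haK (h ▸ hxyK.2)⟩ b hab
  have hreach : ∀ a (ha : a ∈ D.verts), D.coe.Reachable ⟨u, D.edge_vert huvD⟩ ⟨a, ha⟩ := by
    have : ∀ a, Relation.ReflTransGen D.Adj u a →
        ∀ ha : a ∈ D.verts, D.coe.Reachable ⟨u, D.edge_vert huvD⟩ ⟨a, ha⟩ := by
      intro a h
      induction h with
      | refl => exact fun _ => Reachable.refl _
      | @tail b c _ hbc ih =>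
        intro hc
        refine (ih (D.edge_vert hbc)).trans (Adj.reachable ?_)
        exact hbc
    exact fun a ha => this a (hvertsK a ha) ha
  refine ⟨⟨⟨?_, hdeg⟩, ?_⟩, hDF, fun {M} _ h => ?_⟩
  · rw [Subgraph.connected_iff, Subgraph.preconnected_iff]
    exact ⟨fun a b => (hreach a a.2).symm.trans (hreach b b.2), ⟨u, D.edge_vert huvD⟩⟩
  · rw [hDF]; exact Or.inl rfl
  -- the cost of the permutation is the cost of the cycle
  · let φ : V → Sym2 V := fun a => if a = x then s(x, y) else if a = y then s(u, v) else s(a, τ a)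
    let Mv : Finset V := {a | a = x ∨ a = y ∨ τ a ≠ a}
    have hφ : φ '' Mv = F := by
      ext f
      constructor
      · rintro ⟨a, ha, rfl⟩
        by_cases hax : a = x
        · exact Or.inr (Or.inl (by simp [φ, hax]))
        by_cases hay : a = y
        · subst hay; exact Or.inl (by simp [φ, hax])
        simp only [Mv, Finset.coe_filter, Finset.mem_univ, true_and, Set.mem_ofPred_eq] at ha
        exact Or.inr (Or.inr ⟨a, hax, hay, by tauto, by simp [φ, hax, hay]⟩)
      · rintro (rfl | rfl | ⟨a, hax, hay, hne, rfl⟩)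
        · exact ⟨y, by simp [Mv], by simp [φ, hxy.ne.symm]⟩
        · exact ⟨x, by simp [Mv], by simp [φ]⟩
        · exact ⟨a, by simp [Mv, hne], by simp [φ, hax, hay]⟩
    have hφx : φ x = s(x, y) := by simp [φ]
    have hφy : φ y = s(u, v) := by simp [φ, hxy.ne.symm]
    have hφa : ∀ {a}, a ≠ x → a ≠ y → φ a = s(a, τ a) := fun h1 h2 => by simp [φ, h1, h2]
    have hnx : ∀ {a}, a ≠ x → a ≠ y → s(a, τ a) ≠ s(x, y) := by
      intro a h1 h2 h
      have : a ∈ s(x, y) := h ▸ Sym2.mem_mk_left _ _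
      rcases Sym2.mem_iff.1 this with h | h
      exacts [h1 h, h2 h]
    have hny : ∀ {a}, a ≠ x → a ≠ y → s(a, τ a) ≠ s(u, v) := by
      intro a h1 h2 h
      have : τ a ∈ s(u, v) := h ▸ Sym2.mem_mk_right _ _
      rcases hroot (Sym2.mem_iff.1 this) with h | h
      exacts [h1 h, h2 h]
    -- Different moved rows use different edges: only a transposition could use the same edge twice,
    -- and `hinv` rules it out.
    have hinj : Set.InjOn φ Mv := by
      intro a ha b hb hab
      simp only [Mv, Finset.coe_filter, Finset.mem_univ, true_and, Set.mem_ofPred_eq] at ha hb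
      by_cases hax : a = x
      · subst hax
        rw [hφx] at hab
        by_cases hbx : b = a
        · exact hbx.symm
        by_cases hby : b = y
        · subst hby; exact absurd (hab.trans hφy) hne
        · rw [hφa hbx hby] at hab
          exact absurd hab.symm (hnx hbx hby)
      by_cases hay : a = y
      · subst hay
        rw [hφy] at hab
        by_cases hby : b = a
        · exact hby.symm
        by_cases hbx : b = x
        · subst hbx; exact absurd (hab.trans hφx).symm hne
        · rw [hφa hbx hby] at hab
          exact absurd hab.symm (hny hbx hby)
      rw [hφa hax hay] at hab
      by_cases hbx : b = x
      · subst hbx; exact absurd (hab.trans hφx) (hnx hax hay)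
      by_cases hby : b = y
      · subst hby; exact absurd (hab.trans hφy) (hny hax hay)
      rw [hφa hbx hby] at hab
      rcases Sym2.eq_iff.1 hab with ⟨h1, -⟩ | ⟨h1, h2⟩
      · exact h1
      · have h3 : ¬ (a = u ∨ a = v) := by
          intro h'
          rw [h1] at h'
          rcases hroot h' with h' | h'
          exacts [hbx h', hby h']
        rw [not_or] at h3
        have h4 := hinv a hax hay h3.1 h3.2 (by rw [h2, ← h1])
        rw [← h2, h4]
    rw [← hφ, finsum_mem_image hinj, finsum_mem_coe_finset, permCost]
    rw [← Finset.sum_subset (Finset.subset_univ Mv)]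
    · refine Finset.sum_congr rfl fun a ha => ?_
      simp only [Mv, Finset.mem_filter, Finset.mem_univ, true_and] at ha
      rw [arcCost]
      split_ifs with h1 h2 h3
      · rw [h1, hφx]
      · rw [h2, hφy]
      · tauto
      · rw [hφa h1 h2]
    · intro a _ ha
      simp only [Mv, Finset.mem_filter, Finset.mem_univ, true_and, not_or, not_not] at ha
      rw [arcCost, if_neg ha.1, if_neg ha.2.1, if_pos ha.2.2]

end PermCycle

end

end RootedCycleBasis

/-! ### A language of polynomial-time programs and its compilation -/

namespace RootedCycleBasis

noncomputable section

/-! ### Programs with bounded loops -/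

/-- The bound for all values that bounded programs store. -/
def memBound (s : Mem) : ℕ := s 0 0 + s 0 1 + 2

/-- Storing one value. -/
def store (s : Mem) (a i x : ℕ) : Mem := Function.update s a (Function.update (s a) i x)

theorem store_of_ne (s : Mem) {a b : ℕ} (i x : ℕ) (h : b ≠ a) : store s a i x b = s b :=
  Function.update_of_ne h _ _

theorem store_self (s : Mem) (a i x : ℕ) : store s a i x a i = x := by simp [store]

theorem store_self_of_ne (s : Mem) (a x : ℕ) {i j : ℕ} (h : j ≠ i) :
    store s a i x a j = s a j := by simp [store, h]

/-- Programs whose loops run over the vertices (`k = 0`) or over the edges (`k = 1`); the counter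
of a loop is cell `0` of its own array. Stored values are cut off at `memBound`. -/
inductive Prg where
  | skip
  | set (a : ℕ) (i x : Expr)
  | seq (c d : Prg)
  | cond (q : Test) (c d : Prg)
  | loop (v k : ℕ) (c : Prg)

namespace Prg

/-- The memory after `i` rounds of a loop. -/
def iter (F : Mem → Mem) (v : ℕ) (s : Mem) : ℕ → Mem
  | 0 => store s v 0 0
  | i + 1 => store (F (iter F v s i)) v 0 (i + 1)

open Classical in
/-- The effect of a program. -/
def run (wt : ℕ → ℝ) : Prg → Mem → Mem
  | skip, s => s
  | set a i x, s => store s a (i.eval s) (min (x.eval s) (memBound s))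
  | seq c d, s => d.run wt (c.run wt s)
  | cond q c d, s => if q.Holds wt s then c.run wt s else d.run wt s
  | loop v k c, s => iter (c.run wt) v s (s 0 k)

/-- The arrays that a program writes. -/
def writes : Prg → List ℕ
  | skip => []
  | set a _ _ => [a]
  | seq c d => c.writes ++ d.writes
  | cond _ c d => c.writes ++ d.writes
  | loop v _ c => v :: c.writes

/-- The input arrays are read-only and loops do not change their counters. -/
def WF : Prg → Prop
  | skip => True
  | set a _ _ => 3 ≤ a
  | seq c d => c.WF ∧ d.WF
  | cond _ c d => c.WF ∧ d.WF
  | loop v k c => 3 ≤ v ∧ k ≤ 1 ∧ v ∉ c.writes ∧ c.WF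

/-- The smaller of `x` and the memory bound. -/
def capExpr (x : Expr) : Expr :=
  .sub x (.sub x (.add (.add (.get 0 (.const 0)) (.get 0 (.const 1))) (.const 2)))

/-- The translation to the random access machine. -/
def compile : Prg → Cmd
  | skip => .skip
  | set a i x => .assign a i (capExpr x)
  | seq c d => .seq c.compile d.compile
  | cond q c d => .ite q c.compile d.compile
  | loop v k c => .seq (.assign v (.const 0) (.const 0))
      (.loop (.le (.add (.get v (.const 0)) (.const 1)) (.get 0 (.const k)))
        (.seq c.compile (.assign v (.const 0) (.add (.get v (.const 0)) (.const 1)))))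

theorem run_frame (wt : ℕ → ℝ) (c : Prg) (s : Mem) {a : ℕ} (h : a ∉ c.writes) :
    c.run wt s a = s a := by
  induction c generalizing s with
  | skip => rfl
  | set b i x =>
    simp only [writes, List.mem_singleton] at h
    exact store_of_ne _ _ _ h
  | seq c d hc hd =>
    simp only [writes, List.mem_append, not_or] at h
    rw [run, hd _ h.2, hc _ h.1]
  | cond q c d hc hd =>
    simp only [writes, List.mem_append, not_or] at h
    rw [run]
    split_ifs
    exacts [hc _ h.1, hd _ h.2]
  | loop v k c hc =>
    simp only [writes, List.mem_cons, not_or] at h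
    rw [run]
    induction s 0 k with
    | zero => exact store_of_ne _ _ _ h.1
    | succ i ih => rw [iter, store_of_ne _ _ _ h.1, hc _ h.2, ih]

theorem WF.le_of_mem {c : Prg} (hc : c.WF) {a : ℕ} (ha : a ∈ c.writes) : 3 ≤ a := by
  induction c with
  | skip => simp [writes] at ha
  | set b i x => simp only [writes, List.mem_singleton] at ha; exact ha ▸ hc
  | seq c d h1 h2 =>
    rcases List.mem_append.1 ha with h | h
    exacts [h1 hc.1 h, h2 hc.2 h]
  | cond q c d h1 h2 =>
    rcases List.mem_append.1 ha with h | h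
    exacts [h1 hc.1 h, h2 hc.2 h]
  | loop v k c h1 =>
    rcases List.mem_cons.1 ha with h | h
    exacts [h ▸ hc.1, h1 hc.2.2.2 h]

theorem WF.run_zero {c : Prg} (hc : c.WF) (wt : ℕ → ℝ) (s : Mem) : c.run wt s 0 = s 0 :=
  c.run_frame wt s fun h => absurd (hc.le_of_mem h) (by omega)

theorem WF.memBound_run {c : Prg} (hc : c.WF) (wt : ℕ → ℝ) (s : Mem) :
    memBound (c.run wt s) = memBound s := by
  rw [memBound, hc.run_zero, memBound]

theorem memBound_store (s : Mem) {a : ℕ} (i x : ℕ) (h : 3 ≤ a) :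
    memBound (store s a i x) = memBound s := by
  rw [memBound, store_of_ne _ _ _ (by omega), memBound]

/-- All cells are within the bound. -/
def Bounded (s : Mem) : Prop := ∀ a i, s a i ≤ memBound s

theorem Bounded.store {s : Mem} (hs : Bounded s) {a i x : ℕ} (ha : 3 ≤ a) (hx : x ≤ memBound s) :
    Bounded (store s a i x) := by
  intro b j
  rw [memBound_store _ _ _ ha]
  by_cases hb : b = a
  · subst hb
    by_cases hj : j = i
    · subst hj; rwa [store_self]
    · rw [store_self_of_ne _ _ _ hj]; exact hs b j
  · rw [store_of_ne _ _ _ hb]; exact hs b j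

theorem Bounded.run {c : Prg} (hc : c.WF) (wt : ℕ → ℝ) {s : Mem} (hs : Bounded s) :
    Bounded (c.run wt s) := by
  induction c generalizing s with
  | skip => exact hs
  | set b i x => exact hs.store hc (min_le_right _ _)
  | seq c d h1 h2 => exact h2 hc.2 (h1 hc.1 hs)
  | cond q c d h1 h2 =>
    rw [Prg.run]
    split_ifs
    exacts [h1 hc.1 hs, h2 hc.2 hs]
  | loop v k c h1 =>
    have key : ∀ i ≤ s 0 k, Bounded (iter (c.run wt) v s i) ∧
        memBound (iter (c.run wt) v s i) = memBound s := by
      intro i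
      induction i with
      | zero => exact fun _ => ⟨hs.store hc.1 (Nat.zero_le _), memBound_store _ _ _ hc.1⟩
      | succ i ih =>
        intro hi
        obtain ⟨h2, h3⟩ := ih (by omega)
        have h4 := hc.2.2.2.memBound_run wt (iter (c.run wt) v s i)
        have h5 := hs 0 k
        exact ⟨(h1 hc.2.2.2 h2).store hc.1 (by omega),
          (memBound_store _ _ _ hc.1).trans (h4.trans h3)⟩
    exact (key _ le_rfl).1

theorem iter_frame {wt : ℕ → ℝ} {c : Prg} {v : ℕ} (s : Mem) (i : ℕ) {a : ℕ} (hv : a ≠ v)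
    (ha : a ∉ c.writes) : iter (c.run wt) v s i a = s a := by
  induction i with
  | zero => exact store_of_ne _ _ _ hv
  | succ i ih => rw [iter, store_of_ne _ _ _ hv, c.run_frame wt _ ha, ih]

theorem iter_counter (F : Mem → Mem) (v : ℕ) (s : Mem) (i : ℕ) : iter F v s i v 0 = i := by
  cases i <;> exact store_self _ _ _ _

/-! #### Resource bounds -/

open Polynomial

/-- Only stored values are capped; addresses and the numbers of summands in weight comparisons can
be larger, but remain polynomial. -/
theorem exists_expr_bound (x : Expr) :
    ∃ q : ℕ[X], ∀ s, Bounded s → x.eval s ≤ q.eval (memBound s) := by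
  induction x with
  | const k => exact ⟨C k, fun s _ => by simp [Expr.eval]⟩
  | get a i _ => exact ⟨X, fun s hs => by simpa [Expr.eval] using hs _ _⟩
  | add x y hx hy =>
    obtain ⟨p, hp⟩ := hx
    obtain ⟨q, hq⟩ := hy
    exact ⟨p + q, fun s hs => by simpa [Expr.eval] using add_le_add (hp s hs) (hq s hs)⟩
  | sub x y hx _ =>
    obtain ⟨p, hp⟩ := hx
    exact ⟨p, fun s hs => (Nat.sub_le _ _).trans (hp s hs)⟩
  | mul x y hx hy =>
    obtain ⟨p, hp⟩ := hx
    obtain ⟨q, hq⟩ := hy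
    exact ⟨p * q, fun s hs => by simpa [Expr.eval] using Nat.mul_le_mul (hp s hs) (hq s hs)⟩

theorem exists_test_bound (t : Test) :
    ∃ q : ℕ[X], ∀ s, Bounded s → t.cost s ≤ q.eval (memBound s) := by
  induction t with
  | le x y => exact ⟨C (x.cost + y.cost + 1), fun s _ => by simp [Test.cost]⟩
  | weightLe a x b y =>
    obtain ⟨p, hp⟩ := exists_expr_bound x
    obtain ⟨q, hq⟩ := exists_expr_bound y
    refine ⟨C (x.cost + y.cost + 1) + p + q, fun s hs => ?_⟩
    have h1 := hp s hs
    have h2 := hq s hs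
    simp only [Test.cost, eval_add, eval_C]
    omega
  | not t h =>
    obtain ⟨q, hq⟩ := h
    exact ⟨q + 1, fun s hs => by simpa [Test.cost] using hq s hs⟩
  | and t u ht hu =>
    obtain ⟨p, hp⟩ := ht
    obtain ⟨q, hq⟩ := hu
    refine ⟨p + q + 1, fun s hs => ?_⟩
    have h1 := hp s hs
    have h2 := hq s hs
    simp only [Test.cost, eval_add, eval_one]
    omega

theorem capExpr_eval (x : Expr) (s : Mem) : (capExpr x).eval s = min (x.eval s) (memBound s) := by
  simp only [capExpr, Expr.eval, memBound]
  omega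

/-- Bounded programs run in polynomial time and space. -/
theorem exists_exec {c : Prg} (hc : c.WF) :
    ∃ q : ℕ[X], ∀ (wt : ℕ → ℝ) (s : Mem) (W : ℕ), Bounded s → q.eval (memBound s) ≤ W →
      ∃ t ≤ q.eval (memBound s), Exec wt W c.compile s t (c.run wt s) := by
  induction c with
  | skip => exact ⟨1, fun wt s W _ _ => ⟨1, by simp, .skip s⟩⟩
  | set a i x =>
    obtain ⟨p, hp⟩ := exists_expr_bound i
    refine ⟨C (i.cost + (capExpr x).cost + 1) + p + X, fun wt s W hs hW => ?_⟩
    have h1 := hp s hs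
    simp only [eval_add, eval_C, eval_X] at hW ⊢
    refine ⟨i.cost + (capExpr x).cost + 1, by omega, ?_⟩
    have := Exec.assign (wt := wt) (W := W) a i (capExpr x) s (by omega) (by
      rw [capExpr_eval]; exact (min_le_right _ _).trans (by omega))
    rw [capExpr_eval] at this
    exact this
  | seq c d h1 h2 =>
    obtain ⟨p, hp⟩ := h1 hc.1
    obtain ⟨q, hq⟩ := h2 hc.2
    refine ⟨p + q, fun wt s W hs hW => ?_⟩
    simp only [eval_add] at hW ⊢
    obtain ⟨t₁, ht₁, e₁⟩ := hp wt s W hs (by omega)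
    have hb := hc.1.memBound_run wt s
    obtain ⟨t₂, ht₂, e₂⟩ := hq wt (c.run wt s) W (hs.run hc.1 wt) (by rw [hb]; omega)
    rw [hb] at ht₂
    exact ⟨t₁ + t₂, by omega, .seq e₁ e₂⟩
  | cond b c d h1 h2 =>
    obtain ⟨p, hp⟩ := h1 hc.1
    obtain ⟨q, hq⟩ := h2 hc.2
    obtain ⟨l, hl⟩ := exists_test_bound b
    refine ⟨l + p + q, fun wt s W hs hW => ?_⟩
    simp only [eval_add] at hW ⊢
    have h3 := hl s hs
    by_cases hb : b.Holds wt s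
    · obtain ⟨t, ht, e⟩ := hp wt s W hs (by omega)
      exact ⟨b.cost s + t, by omega, by rw [run, if_pos hb]; exact .ite_true hb e⟩
    · obtain ⟨t, ht, e⟩ := hq wt s W hs (by omega)
      exact ⟨b.cost s + t, by omega, by rw [run, if_neg hb]; exact .ite_false hb e⟩
  | loop v k c h1 =>
    obtain ⟨hv, hk, hvc, hwf⟩ := hc
    obtain ⟨p, hp⟩ := h1 hwf
    -- A round costs 7 steps for the test, the body, and 6 steps for the counter. The initial store
    -- costs 3 and the final test 7. The last `X` makes the word bound large enough for the counter.
    refine ⟨X * (C 14 + p) + C 10 + X, fun wt s W hs hW => ?_⟩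
    simp only [eval_add, eval_C, eval_X, eval_mul] at hW ⊢
    set N := s 0 k with hN
    set B := memBound s with hB
    have hNB : N ≤ B := hs 0 k
    have hNB' : N * (14 + p.eval B) ≤ B * (14 + p.eval B) := Nat.mul_le_mul_right _ hNB
    have hpW : p.eval B ≤ W ∨ N = 0 := by
      rcases Nat.eq_zero_or_pos N with h | h
      · exact Or.inr h
      · have : 1 * (14 + p.eval B) ≤ B * (14 + p.eval B) := Nat.mul_le_mul_right _ (by omega)
        exact Or.inl (by omega)
    have hit : ∀ i ≤ N, Bounded (iter (c.run wt) v s i) ∧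
        iter (c.run wt) v s i 0 = s 0 := by
      intro i hi
      have h0 : iter (c.run wt) v s i 0 = s 0 :=
        iter_frame s i (by omega) fun h => absurd (hwf.le_of_mem h) (by omega)
      refine ⟨?_, h0⟩
      induction i with
      | zero => exact hs.store hv (Nat.zero_le _)
      | succ i ih =>
        have h0' : iter (c.run wt) v s i 0 = s 0 :=
          iter_frame s i (by omega) fun h => absurd (hwf.le_of_mem h) (by omega)
        refine ((ih (by omega) h0').run hwf wt).store hv ?_
        rw [hwf.memBound_run, memBound, h0']
        change i + 1 ≤ B
        omega
    have hloop : ∀ d i, i + d = N → ∃ t ≤ d * (14 + p.eval B) + 7, Exec wt W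
        (.loop (.le (.add (.get v (.const 0)) (.const 1)) (.get 0 (.const k)))
          (.seq c.compile (.assign v (.const 0) (.add (.get v (.const 0)) (.const 1)))))
        (iter (c.run wt) v s i) t (iter (c.run wt) v s N) := by
      intro d
      induction d with
      | zero =>
        intro i hi
        obtain rfl : i = N := by omega
        refine ⟨_, ?_, .loop_done ?_⟩
        · simp [Test.cost, Expr.cost]
        · simp only [Test.Holds, Expr.eval, iter_counter]
          rw [(hit N le_rfl).2]
          omega
      | succ d ih =>
        intro i hi
        obtain ⟨hb, h0⟩ := hit i (by omega)
        have hbB : memBound (iter (c.run wt) v s i) = B := by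
          rw [memBound, h0]; rfl
        obtain ⟨t₁, ht₁, e₁⟩ := hp wt _ W hb (by rw [hbB]; rcases hpW with h | h <;> omega)
        rw [hbB] at ht₁
        obtain ⟨t₂, ht₂, e₂⟩ := ih (i + 1) (by omega)
        have hcnt : c.run wt (iter (c.run wt) v s i) v 0 = i := by
          rw [c.run_frame wt _ hvc, iter_counter]
        have e₃ := Exec.assign (wt := wt) (W := W) v (.const 0)
          (.add (.get v (.const 0)) (.const 1)) (c.run wt (iter (c.run wt) v s i))
          (Nat.zero_le _) (by simp only [Expr.eval, hcnt]; omega)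
        simp only [Expr.eval, hcnt] at e₃
        have hq : (Test.le (.add (.get v (.const 0)) (.const 1)) (.get 0 (.const k))).Holds wt
            (iter (c.run wt) v s i) := by
          simp only [Test.Holds, Expr.eval, iter_counter]
          rw [h0]
          omega
        refine ⟨_, ?_, .loop_step hq (.seq e₁ e₃) e₂⟩
        simp only [Test.cost, Expr.cost]
        rw [Nat.succ_mul]
        omega
    obtain ⟨t, ht, e⟩ := hloop N 0 (by omega)
    have e₀ := Exec.assign (wt := wt) (W := W) v (.const 0) (.const 0) s (Nat.zero_le _)
      (Nat.zero_le _)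
    refine ⟨_, ?_, .seq e₀ e⟩
    simp only [Expr.cost]
    omega

/-! #### Reasoning about loops -/

/-- The increment of the counter changes array `v` only, so the invariant has to be shown for every
memory that agrees with the result of the body elsewhere. The arrays that the loop does not write
are known throughout. -/
theorem run_loop_induction (wt : ℕ → ℝ) {v k : ℕ} {c : Prg} (s : Mem)
    (P : ℕ → Mem → Prop)
    (h0 : ∀ s₀ : Mem, (∀ a, a ≠ v → s₀ a = s a) → P 0 s₀)
    (hs : ∀ i < s 0 k, ∀ s₁ : Mem, (∀ a ∉ (loop v k c).writes, s₁ a = s a) → s₁ v 0 = i →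
      P i s₁ → ∀ s₂ : Mem, (∀ a, a ≠ v → s₂ a = c.run wt s₁ a) → P (i + 1) s₂) :
    P (s 0 k) ((loop v k c).run wt s) := by
  have key : ∀ i ≤ s 0 k, P i (iter (c.run wt) v s i) := by
    intro i
    induction i with
    | zero => exact fun _ => h0 _ fun a ha => store_of_ne _ _ _ ha
    | succ i ih =>
      intro hi
      refine hs i (by omega) _ ?_ (iter_counter _ _ _ _) (ih (by omega)) _ fun a ha =>
        store_of_ne _ _ _ ha
      intro a ha
      simp only [writes, List.mem_cons, not_or] at ha
      exact iter_frame s i ha.1 ha.2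
  exact key _ le_rfl

/-- Fill consecutive cells of an array. -/
def fill (a : ℕ) (base : Expr) (v : ℕ) (x : Expr) : Prg :=
  loop v 0 (set a (.add base (.get v (.const 0))) x)

theorem run_fill (wt : ℕ → ℝ) {a v : ℕ} {base x : Expr} (ha : 3 ≤ a) (hv : 3 ≤ v) (hav : a ≠ v)
    (s : Mem) (o : ℕ) (val : ℕ → ℕ)
    (hbase : ∀ s' : Mem, (∀ b, b ≠ a → b ≠ v → s' b = s b) → base.eval s' = o)
    (hx : ∀ i < s 0 0, ∀ s' : Mem, (∀ b, b ≠ a → b ≠ v → s' b = s b) →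
      (∀ j, (j < o ∨ o + i ≤ j) → s' a j = s a j) → s' v 0 = i → x.eval s' = val i)
    (hval : ∀ i < s 0 0, val i ≤ memBound s) :
    (∀ i < s 0 0, (fill a base v x).run wt s a (o + i) = val i) ∧
      ∀ j, (j < o ∨ o + s 0 0 ≤ j) → (fill a base v x).run wt s a j = s a j := by
  refine run_loop_induction wt s
    (fun i s' => (∀ l < i, s' a (o + l) = val l) ∧ ∀ j, (j < o ∨ o + i ≤ j) → s' a j = s a j)
    ?_ ?_
  · intro s₀ h0
    exact ⟨fun l hl => absurd hl (by omega), fun j _ => by rw [h0 a hav]⟩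
  · intro i hi s₁ hfr hcnt ⟨ih1, ih2⟩ s₂ hs₂
    have hfr' : ∀ b, b ≠ a → b ≠ v → s₁ b = s b := fun b hb hbv =>
      hfr b (by simp [writes, hb, hbv])
    have e : s₂ a = store s₁ a (o + i) (val i) a := by
      rw [hs₂ a hav, run]
      simp only [Expr.eval]
      rw [hbase s₁ hfr', hcnt, hx i hi s₁ hfr' ih2 hcnt, memBound,
        hfr' 0 (by omega) (by omega), ← memBound, min_eq_left (hval i hi)]
    rw [e]
    refine ⟨fun l hl => ?_, fun j hj => ?_⟩
    · rcases Nat.lt_succ_iff_lt_or_eq.1 hl with hl | rfl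
      · rw [store_self_of_ne _ _ _ (by omega)]; exact ih1 l hl
      · exact store_self _ _ _ _
    · rw [store_self_of_ne _ _ _ (by omega)]; exact ih2 j (by omega)

/-- Fill a square table. -/
def fill2 (a v₁ v₂ : ℕ) (x : Expr) : Prg :=
  loop v₁ 0 (fill a (.mul (.get v₁ (.const 0)) (.get 0 (.const 0))) v₂ x)

/-- The table is stored by rows, and filling row `i` leaves the earlier rows alone since they end
before cell `i * n`. -/
theorem run_fill2 (wt : ℕ → ℝ) {a v₁ v₂ : ℕ} {x : Expr} (ha : 3 ≤ a) (hv₁ : 3 ≤ v₁)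
    (hv₂ : 3 ≤ v₂) (hav₁ : a ≠ v₁) (hav₂ : a ≠ v₂) (hv : v₁ ≠ v₂)
    (s : Mem) (val : ℕ → ℕ → ℕ)
    (hx : ∀ i < s 0 0, ∀ j < s 0 0, ∀ s' : Mem,
      (∀ b, b ≠ a → b ≠ v₁ → b ≠ v₂ → s' b = s b) → s' v₁ 0 = i → s' v₂ 0 = j →
      x.eval s' = val i j)
    (hval : ∀ i < s 0 0, ∀ j < s 0 0, val i j ≤ memBound s) :
    ∀ i < s 0 0, ∀ j < s 0 0, (fill2 a v₁ v₂ x).run wt s a (i * s 0 0 + j) = val i j := by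
  refine run_loop_induction wt s
    (fun i s' => ∀ l < i, ∀ j < s 0 0, s' a (l * s 0 0 + j) = val l j) ?_ ?_
  · intro s₀ _ l hl
    exact absurd hl (by omega)
  · intro i hi s₁ hfr hcnt ih s₂ hs₂ l hl j hj
    have hfr' : ∀ b, b ≠ a → b ≠ v₁ → b ≠ v₂ → s₁ b = s b := fun b hb hb1 hb2 =>
      hfr b (by simp [fill, writes, hb, hb1, hb2])
    have h0 : s₁ 0 = s 0 := hfr' 0 (by omega) (by omega) (by omega)
    obtain ⟨h1, h2⟩ := run_fill wt (base := .mul (.get v₁ (.const 0)) (.get 0 (.const 0)))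
      (x := x) ha hv₂ hav₂ s₁ (i * s 0 0) (val i)
      (fun s' h => by
        simp only [Expr.eval]
        rw [h v₁ hav₁.symm hv, h 0 (by omega) (by omega), hcnt, h0])
      (fun j hj s' h _ hj' => by
        rw [h0] at hj
        refine hx i hi j hj s' (fun b hb hb1 hb2 => ?_) ?_ hj'
        · rw [h b hb hb2, hfr' b hb hb1 hb2]
        · rw [h v₁ hav₁.symm hv, hcnt])
      (fun j hj => by
        rw [h0] at hj
        rw [memBound, h0]
        exact hval i hi j hj)
    rw [h0] at h1 h2
    rw [hs₂ a hav₁]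
    rcases Nat.lt_succ_iff_lt_or_eq.1 hl with hl | rfl
    · rw [h2]
      · exact ih l hl j hj
      · left
        calc l * s 0 0 + j < l * s 0 0 + s 0 0 := by omega
          _ = (l + 1) * s 0 0 := by ring
          _ ≤ i * s 0 0 := Nat.mul_le_mul_right _ hl
    · exact h1 j hj

/-- Sum an expression that takes the values `0` and `1`. -/
def sum (a v : ℕ) (x : Expr) : Prg :=
  seq (set a (.const 0) (.const 0)) (loop v 0 (set a (.const 0) (.add (.get a (.const 0)) x)))

/-- With summands at most `1`, partial sums stay below the memory bound and the cap never takes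
effect. -/
theorem run_sum (wt : ℕ → ℝ) {a v : ℕ} {x : Expr} (ha : 3 ≤ a) (hv : 3 ≤ v) (hav : a ≠ v)
    (s : Mem) (val : ℕ → ℕ)
    (hx : ∀ i < s 0 0, ∀ s' : Mem, (∀ b, b ≠ a → b ≠ v → s' b = s b) → s' v 0 = i →
      x.eval s' = val i)
    (hval : ∀ i < s 0 0, val i ≤ 1) :
    (sum a v x).run wt s a 0 = ∑ i ∈ Finset.range (s 0 0), val i := by
  have hle : ∀ i ≤ s 0 0, ∑ j ∈ Finset.range i, val j ≤ memBound s := by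
    intro i hi
    have : ∑ j ∈ Finset.range i, val j ≤ ∑ j ∈ Finset.range i, 1 :=
      Finset.sum_le_sum fun j hj => hval j ((Finset.mem_range.1 hj).trans_le hi)
    rw [Finset.sum_const, Finset.card_range, smul_eq_mul, mul_one] at this
    rw [memBound]
    omega
  rw [sum, run]
  set s₀ := (set a (.const 0) (.const 0)).run wt s with hs₀
  have hs0 : s₀ 0 = s 0 := store_of_ne _ _ _ (by omega)
  have := run_loop_induction wt
    (c := set a (.const 0) (.add (.get a (.const 0)) x)) (v := v) (k := 0)
    s₀
    (fun i s' => s' a 0 = ∑ j ∈ Finset.range i, val j) ?_ ?_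
  · rwa [hs0] at this
  · intro s₁ h
    rw [h a hav, hs₀, run, Finset.sum_range_zero]
    simp only [Expr.eval]
    rw [store_self, Nat.zero_min]
  · intro i hi s₁ hfr hcnt ih s₂ hs₂
    rw [hs0] at hi
    have hfr' : ∀ b, b ≠ a → b ≠ v → s₁ b = s b := fun b hb hbv => by
      rw [hfr b (by simp [writes, hb, hbv]), hs₀]
      exact store_of_ne _ _ _ hb
    rw [hs₂ a hav, run]
    simp only [Expr.eval]
    rw [store_self, ih, hx i hi s₁ hfr' hcnt, ← Finset.sum_range_succ, memBound,
      hfr' 0 (by omega) (by omega), ← memBound, min_eq_left (hle _ hi)]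

end Prg

end

end RootedCycleBasis

/-! ### Programs for comparing permutations and for the assignment problem -/

namespace RootedCycleBasis

noncomputable section

/-! ### Comparing candidate permutations by program

The programs below use the arrays as follows: `3` and `4` output; `5` edge indices of pairs of
vertices; `6` marks of covered edges; `7` codes of the choices for the current target edge; `8` the
current permutation; `9` and `10` permutations ending alternating paths, by rows; `11` and `12` lists
of codes to be compared, with counts in `14` to `17`; `13` the best list of codes so far; `25` and
`26` permutations to be compared; `18` to `24` loop counters; `28` the row that is left out. -/

/-! #### Expressions and tests -/

namespace Expr

/-- The number of vertices. -/
def numV : Expr := get 0 (const 0)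

/-- The number of edges. -/
def numE : Expr := get 0 (const 1)

/-- The first cell of an array. -/
def cell (a : ℕ) : Expr := get a (const 0)

/-- A choice by the order of two numbers. -/
def ifLe (x y a b : Expr) : Expr :=
  add (mul (sub (const 1) (sub x y)) a) (mul (sub (const 1) (sub (const 1) (sub x y))) b)

/-- A choice by the equality of two numbers. -/
def ifEq (x y a b : Expr) : Expr := ifLe x y (ifLe y x a b) b

variable (s : Mem)

@[simp] theorem eval_numV : numV.eval s = s 0 0 := rfl

@[simp] theorem eval_numE : numE.eval s = s 0 1 := rfl

@[simp] theorem eval_cell (a : ℕ) : (cell a).eval s = s a 0 := rfl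

@[simp] theorem eval_const (k : ℕ) : (const k).eval s = k := rfl

@[simp] theorem eval_get (a : ℕ) (i : Expr) : (get a i).eval s = s a (i.eval s) := rfl

@[simp] theorem eval_add (x y : Expr) : (add x y).eval s = x.eval s + y.eval s := rfl

@[simp] theorem eval_sub (x y : Expr) : (sub x y).eval s = x.eval s - y.eval s := rfl

@[simp] theorem eval_mul (x y : Expr) : (mul x y).eval s = x.eval s * y.eval s := rfl

@[simp] theorem eval_ifLe (x y a b : Expr) :
    (ifLe x y a b).eval s = if x.eval s ≤ y.eval s then a.eval s else b.eval s := by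
  simp only [ifLe, eval]
  split_ifs with h
  · rw [Nat.sub_eq_zero_of_le h]; simp
  · obtain ⟨d, hd⟩ : ∃ d, x.eval s - y.eval s = d + 1 := ⟨x.eval s - y.eval s - 1, by omega⟩
    rw [hd]; simp

@[simp] theorem eval_ifEq (x y a b : Expr) :
    (ifEq x y a b).eval s = if x.eval s = y.eval s then a.eval s else b.eval s := by
  simp only [ifEq, eval_ifLe]
  split_ifs <;> first | rfl | omega

end Expr

namespace Test

/-- Equality of two numbers. -/
def eq (x y : Expr) : Test := and (le x y) (le y x)

/-- Disjunction. -/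
def or (p q : Test) : Test := not (and (not p) (not q))

variable (wt : ℕ → ℝ) (s : Mem)

@[simp] theorem holds_le (x y : Expr) : (le x y).Holds wt s ↔ x.eval s ≤ y.eval s := Iff.rfl

@[simp] theorem holds_weightLe (a b : ℕ) (x y : Expr) : (weightLe a x b y).Holds wt s ↔
    ∑ i ∈ Finset.range (x.eval s), wt (s a i) ≤ ∑ i ∈ Finset.range (y.eval s), wt (s b i) :=
  Iff.rfl

@[simp] theorem holds_not (p : Test) : (not p).Holds wt s ↔ ¬ p.Holds wt s := Iff.rfl

@[simp] theorem holds_and (p q : Test) :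
    (and p q).Holds wt s ↔ p.Holds wt s ∧ q.Holds wt s := Iff.rfl

@[simp] theorem holds_eq (x y : Expr) : (eq x y).Holds wt s ↔ x.eval s = y.eval s := by
  simp [eq, le_antisymm_iff]

@[simp] theorem holds_or (p q : Test) :
    (or p q).Holds wt s ↔ p.Holds wt s ∨ q.Holds wt s := by
  simp only [or, holds_not, holds_and]; tauto

end Test

namespace Prg

theorem run_seq (wt : ℕ → ℝ) (c d : Prg) (s : Mem) :
    (seq c d).run wt s = d.run wt (c.run wt s) := rfl

theorem run_cond_pos {wt : ℕ → ℝ} {q : Test} {s : Mem} (c d : Prg) (h : q.Holds wt s) :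
    (cond q c d).run wt s = c.run wt s := if_pos h

theorem run_cond_neg {wt : ℕ → ℝ} {q : Test} {s : Mem} (c d : Prg) (h : ¬ q.Holds wt s) :
    (cond q c d).run wt s = d.run wt s := if_neg h

theorem run_skip (wt : ℕ → ℝ) (s : Mem) : skip.run wt s = s := rfl

theorem run_set (wt : ℕ → ℝ) (a : ℕ) (i x : Expr) (s : Mem) (h : x.eval s ≤ memBound s) :
    (set a i x).run wt s = store s a (i.eval s) (x.eval s) := by
  rw [run, min_eq_left h]

/-- Induction over the rounds of a loop, for bounded memories. -/
theorem run_loop_bounded (wt : ℕ → ℝ) {v k : ℕ} {c : Prg} (hc : (loop v k c).WF) {s : Mem}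
    (hb : Bounded s) (P : ℕ → Mem → Prop)
    (h0 : ∀ s₀ : Mem, (∀ a, a ≠ v → s₀ a = s a) → P 0 s₀)
    (hs : ∀ i < s 0 k, ∀ s₁ : Mem, Bounded s₁ → (∀ a ∉ (loop v k c).writes, s₁ a = s a) →
      s₁ v 0 = i → P i s₁ → ∀ s₂ : Mem, (∀ a, a ≠ v → s₂ a = c.run wt s₁ a) → P (i + 1) s₂) :
    P (s 0 k) ((loop v k c).run wt s) := by
  have h0' : ∀ i, iter (c.run wt) v s i 0 = s 0 := fun i =>
    iter_frame s i (by have := hc.1; omega) fun h => absurd (hc.2.2.2.le_of_mem h) (by omega)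
  have hbd : ∀ i ≤ s 0 k, Bounded (iter (c.run wt) v s i) := by
    intro i
    induction i with
    | zero => exact fun _ => hb.store hc.1 (Nat.zero_le _)
    | succ i ih =>
      intro hi
      refine ((ih (by omega)).run hc.2.2.2 wt).store hc.1 ?_
      rw [hc.2.2.2.memBound_run, memBound, h0', ← memBound]
      exact hi.trans (hb 0 k)
  have key : ∀ i ≤ s 0 k, P i (iter (c.run wt) v s i) := by
    intro i
    induction i with
    | zero => exact fun _ => h0 _ fun a ha => store_of_ne _ _ _ ha
    | succ i ih =>
      intro hi
      refine hs i (by omega) _ (hbd i (by omega)) ?_ (iter_counter _ _ _ _) (ih (by omega)) _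
        fun a ha => store_of_ne _ _ _ ha
      intro a ha
      simp only [writes, List.mem_cons, not_or] at ha
      exact iter_frame s i ha.1 ha.2
  exact key _ le_rfl

theorem run_fill_zero (wt : ℕ → ℝ) {a v : ℕ} {x : Expr} (ha : 3 ≤ a) (hv : 3 ≤ v) (hav : a ≠ v)
    (s : Mem) (val : ℕ → ℕ)
    (hx : ∀ i < s 0 0, ∀ s' : Mem, (∀ b, b ≠ a → b ≠ v → s' b = s b) → s' v 0 = i →
      x.eval s' = val i)
    (hval : ∀ i < s 0 0, val i ≤ memBound s) :
    ∀ i < s 0 0, (fill a (.const 0) v x).run wt s a i = val i := by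
  intro i hi
  have := (run_fill wt (base := .const 0) ha hv hav s 0 val (fun _ _ => rfl)
    (fun i hi s' h _ => hx i hi s' h) hval).1 i hi
  rwa [zero_add] at this

/-! #### Comparing two lists of codes

The numbers below the number `m` of edges are codes for the edges, `m` stands for no edge and `m + 1`
for a forbidden choice. -/

/-- The cost of a code: forbidden choices come first, then weights, then uncovered edges. -/
abbrev Cost := ℤ ×ₗ (ℝ ×ₗ ℤ)

/-- The cost of a code. -/
def codeCost (wt : ℕ → ℝ) (s : Mem) (j : ℕ) : Cost :=
  toLex ((if j = s 0 1 + 1 then 1 else 0 : ℤ), toLex (wt j, ((1 - s 6 j : ℕ) : ℤ)))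

theorem sum_toLex {ι α β γ : Type*} [AddCommMonoid α] [AddCommMonoid β] [AddCommMonoid γ]
    (S : Finset ι) (f : ι → α) (g : ι → β) (h : ι → γ) :
    ∑ i ∈ S, (toLex (f i, toLex (g i, h i)) : α ×ₗ (β ×ₗ γ)) =
      toLex (∑ i ∈ S, f i, toLex (∑ i ∈ S, g i, ∑ i ∈ S, h i)) := by
  classical
  induction S using Finset.induction_on with
  | empty => rfl
  | insert a S ha ih => simp only [Finset.sum_insert ha, ih]; rfl

/-- Count the forbidden choices and the uncovered edges in the lists of codes `11` and `12`. -/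
def counts : Prg :=
  seq (sum 14 24 (.ifEq (.get 11 (.cell 24)) (.add .numE (.const 1)) (.const 1) (.const 0)))
    (seq (sum 15 24 (.sub (.const 1) (.get 6 (.get 11 (.cell 24)))))
      (seq (sum 16 24 (.ifEq (.get 12 (.cell 24)) (.add .numE (.const 1)) (.const 1) (.const 0)))
        (sum 17 24 (.sub (.const 1) (.get 6 (.get 12 (.cell 24)))))))

/-- After counting, test whether the list of codes `11` is at most as expensive as `12`. -/
def leTest : Test :=
  .or (.le (.add (.cell 14) (.const 1)) (.cell 16))
    (.and (.le (.cell 14) (.cell 16))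
      (.or (.not (.weightLe 12 .numV 11 .numV))
        (.and (.weightLe 11 .numV 12 .numV) (.le (.cell 15) (.cell 17)))))

/-- A sum of lexicographic triples is the triple of the sums. The integer parts are counted in
memory; the real part is available only as a comparison, and strict inequality is the negation of
the reverse comparison. -/
theorem counts_leTest (wt : ℕ → ℝ) (s : Mem) : leTest.Holds wt (counts.run wt s) ↔
    ∑ b ∈ Finset.range (s 0 0), codeCost wt s (s 11 b) ≤
      ∑ b ∈ Finset.range (s 0 0), codeCost wt s (s 12 b) := by
  have fr : ∀ a, a ∉ counts.writes → counts.run wt s a = s a := fun a h => run_frame wt _ s h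
  set s' := counts.run wt s with hs'
  have h0 : s' 0 = s 0 := fr 0 (by decide)
  have h11 : s' 11 = s 11 := fr 11 (by decide)
  have h12 : s' 12 = s 12 := fr 12 (by decide)
  set s₁ := (sum 14 24 (.ifEq (.get 11 (.cell 24)) (.add .numE (.const 1)) (.const 1)
    (.const 0))).run wt s with hs₁
  set s₂ := (sum 15 24 (.sub (.const 1) (.get 6 (.get 11 (.cell 24))))).run wt s₁ with hs₂
  set s₃ := (sum 16 24 (.ifEq (.get 12 (.cell 24)) (.add .numE (.const 1)) (.const 1)
    (.const 0))).run wt s₂ with hs₃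
  have e' : s' = (sum 17 24 (.sub (.const 1) (.get 6 (.get 12 (.cell 24))))).run wt s₃ := rfl
  have f1 : ∀ a, a ≠ 14 → a ≠ 24 → s₁ a = s a := fun a h h' => run_frame wt _ s (by
    simp [sum, writes, h, h'])
  have f2 : ∀ a, a ≠ 15 → a ≠ 24 → s₂ a = s₁ a := fun a h h' => run_frame wt _ _ (by
    simp [sum, writes, h, h'])
  have f3 : ∀ a, a ≠ 16 → a ≠ 24 → s₃ a = s₂ a := fun a h h' => run_frame wt _ _ (by
    simp [sum, writes, h, h'])
  have f4 : ∀ a, a ≠ 17 → a ≠ 24 → s' a = s₃ a := fun a h h' => (congrFun e' a).trans (run_frame wt _ _ (by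
    simp [sum, writes, h, h']))
  have e14 : s' 14 0 = ∑ b ∈ Finset.range (s 0 0), if s 11 b = s 0 1 + 1 then 1 else 0 := by
    rw [f4 14 (by decide) (by decide), f3 14 (by decide) (by decide), f2 14 (by decide) (by decide)]
    exact run_sum wt (a := 14) (v := 24) (x := .ifEq (.get 11 (.cell 24))
      (.add .numE (.const 1)) (.const 1) (.const 0)) (by decide) (by decide) (by decide) s
      (fun b => if s 11 b = s 0 1 + 1 then 1 else 0)
      (fun i _ s' h hi => by simp [hi, h 11, h 0]) fun i _ => by split_ifs <;> simp
  have e15 : s' 15 0 = ∑ b ∈ Finset.range (s 0 0), (1 - s 6 (s 11 b)) := by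
    rw [f4 15 (by decide) (by decide), f3 15 (by decide) (by decide)]
    have := run_sum wt (a := 15) (v := 24) (x := .sub (.const 1) (.get 6 (.get 11 (.cell 24))))
      (by decide) (by decide) (by decide) s₁ (fun b => 1 - s 6 (s 11 b)) (fun i _ s' h hi => by
        simp [hi, h 11, h 6, f1 11, f1 6]) (fun i _ => by omega)
    rwa [f1 0 (by decide) (by decide)] at this
  have e16 : s' 16 0 = ∑ b ∈ Finset.range (s 0 0), if s 12 b = s 0 1 + 1 then 1 else 0 := by
    rw [f4 16 (by decide) (by decide)]
    have := run_sum wt (a := 16) (v := 24) (x := .ifEq (.get 12 (.cell 24))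
      (.add .numE (.const 1)) (.const 1) (.const 0))
      (by decide) (by decide) (by decide) s₂ (fun b => if s 12 b = s 0 1 + 1 then 1 else 0)
      (fun i _ s' h hi => by
        simp [hi, h 12, h 0, f2 12, f1 12, f2 0, f1 0]) (fun i _ => by split_ifs <;> simp)
    rwa [f2 0 (by decide) (by decide), f1 0 (by decide) (by decide)] at this
  have e17 : s' 17 0 = ∑ b ∈ Finset.range (s 0 0), (1 - s 6 (s 12 b)) := by
    rw [e']
    have := run_sum wt (a := 17) (v := 24) (x := .sub (.const 1) (.get 6 (.get 12 (.cell 24))))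
      (by decide) (by decide) (by decide) s₃ (fun b => 1 - s 6 (s 12 b)) (fun i _ s' h hi => by
        simp [hi, h 12, h 6, f3 12, f3 6, f2 12, f2 6, f1 12, f1 6]) (fun i _ => by omega)
    rw [f3 0 (by decide) (by decide), f2 0 (by decide) (by decide),
      f1 0 (by decide) (by decide)] at this
    exact this
  simp only [leTest, Test.holds_or, Test.holds_and, Test.holds_not, Test.holds_le,
    Test.holds_weightLe, Expr.eval_add, Expr.eval_cell, Expr.eval_const, Expr.eval_numV, h0, h11,
    h12]
  simp only [codeCost, sum_toLex, Prod.Lex.toLex_le_toLex]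
  have c1 : ∀ A, (∑ b ∈ Finset.range (s 0 0), (if s A b = s 0 1 + 1 then 1 else 0 : ℤ)) =
      ((∑ b ∈ Finset.range (s 0 0), if s A b = s 0 1 + 1 then 1 else 0 : ℕ) : ℤ) := by
    intro A; push_cast; rfl
  have c2 : ∀ A, (∑ b ∈ Finset.range (s 0 0), (((1 - s 6 (s A b)) : ℕ) : ℤ)) =
      ((∑ b ∈ Finset.range (s 0 0), (1 - s 6 (s A b)) : ℕ) : ℤ) := by
    intro A; rw [Nat.cast_sum]
  rw [c1, c1, c2, c2, ← e14, ← e15, ← e16, ← e17, Nat.cast_lt, Nat.cast_inj, Nat.cast_le, not_le]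
  constructor
  · rintro (h | ⟨h, h' | ⟨h', h''⟩⟩)
    · exact Or.inl h
    · rcases h.lt_or_eq with h | h
      exacts [Or.inl h, Or.inr ⟨h, Or.inl h'⟩]
    · rcases h.lt_or_eq with h | h
      · exact Or.inl h
      · rcases h'.lt_or_eq with h' | h'
        exacts [Or.inr ⟨h, Or.inl h'⟩, Or.inr ⟨h, Or.inr ⟨h', h''⟩⟩]
  · rintro (h | ⟨h, h' | ⟨h', h''⟩⟩)
    · exact Or.inl h
    · exact Or.inr ⟨h.le, Or.inl h'⟩
    · exact Or.inr ⟨h.le, Or.inr ⟨h'.le, h''⟩⟩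

/-! #### Improving the current permutation -/

/-- The code of the choice of row `b` according to the array `A`; only the rows up to the one in
array `20` count, except for the one in array `28`. -/
def rowCode (s : Mem) (A b : ℕ) : ℕ :=
  if b ≤ s 20 0 then if b = s 28 0 then s 0 1 else s 7 (b * s 0 0 + s A b) else s 0 1

/-- The cost of the choices in array `A`. -/
def rowsCost (wt : ℕ → ℝ) (s : Mem) (A : ℕ) : Cost :=
  ∑ b ∈ Finset.range (s 0 0), codeCost wt s (rowCode s A b)

/-- List the codes of the choices in array `X`. -/
def listCodes (A X : ℕ) : Prg :=
  fill A (.const 0) 24 (.ifLe (.cell 24) (.cell 20) (.ifEq (.cell 24) (.cell 28) .numE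
    (.get 7 (.add (.mul (.cell 24) .numV) (.get X (.cell 24))))) .numE)

/-- Replace the choices in array `25` by those in array `26` unless these are more expensive. -/
def improve : Prg :=
  seq (listCodes 11 26) (seq (listCodes 12 25) (seq counts
    (cond leTest (fill 25 (.const 0) 24 (.get 26 (.cell 24))) skip)))

theorem rowCode_le {s : Mem} (hb : Bounded s) (A b : ℕ) : rowCode s A b ≤ memBound s := by
  rw [rowCode]
  split_ifs
  exacts [hb _ _, hb _ _, hb _ _]

theorem run_listCodes (wt : ℕ → ℝ) {s : Mem} (hb : Bounded s) {A X : ℕ} (hA : A = 11 ∨ A = 12)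
    (hX : X = 25 ∨ X = 26) : ∀ b < s 0 0, (listCodes A X).run wt s A b = rowCode s X b := by
  refine run_fill_zero wt (by omega) (by omega) (by omega) s _ (fun i _ s' h hi => ?_)
    fun i _ => rowCode_le hb X i
  have e : ∀ a, a ≠ 11 → a ≠ 12 → a ≠ 24 → s' a = s a := fun a h1 h2 h3 =>
    h a (by omega) h3
  simp only [Expr.eval_ifLe, Expr.eval_ifEq, Expr.eval_get, Expr.eval_add, Expr.eval_mul,
    Expr.eval_cell, Expr.eval_numE, Expr.eval_numV, hi, rowCode]
  rw [e 20 (by decide) (by decide) (by decide), e 28 (by decide) (by decide) (by decide),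
    e 0 (by decide) (by decide) (by decide), e 7 (by decide) (by decide) (by decide),
    e X (by omega) (by omega) (by omega)]

theorem improve_wf : improve.WF := by
  simp [improve, listCodes, counts, fill, sum, WF, writes]

open Classical in
theorem run_improve (wt : ℕ → ℝ) {s : Mem} (hb : Bounded s) : ∀ b < s 0 0,
    improve.run wt s 25 b = if rowsCost wt s 26 ≤ rowsCost wt s 25 then s 26 b else s 25 b := by
  intro b hbn
  have w1 : (listCodes 11 26).WF := by simp [listCodes, fill, WF, writes]
  have w2 : (listCodes 12 25).WF := by simp [listCodes, fill, WF, writes]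
  set s₁ := (listCodes 11 26).run wt s with hs₁
  set s₂ := (listCodes 12 25).run wt s₁ with hs₂
  have b1 : Bounded s₁ := hb.run w1 wt
  have f1 : ∀ a, a ≠ 11 → a ≠ 24 → s₁ a = s a := fun a h h' => run_frame wt _ s (by
    simp [listCodes, fill, writes, h, h'])
  have f2 : ∀ a, a ≠ 12 → a ≠ 24 → s₂ a = s₁ a := fun a h h' => run_frame wt _ _ (by
    simp [listCodes, fill, writes, h, h'])
  have f12 : ∀ a, a ≠ 11 → a ≠ 12 → a ≠ 24 → s₂ a = s a := fun a h h' h'' => by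
    rw [f2 a h' h'', f1 a h h'']
  have e0 : s₂ 0 = s 0 := f12 0 (by decide) (by decide) (by decide)
  have e6 : s₂ 6 = s 6 := f12 6 (by decide) (by decide) (by decide)
  have e11 : ∀ b < s 0 0, s₂ 11 b = rowCode s 26 b := by
    rw [f2 11 (by decide) (by decide)]
    exact run_listCodes wt hb (by decide) (by decide)
  have e12 : ∀ b < s 0 0, s₂ 12 b = rowCode s 25 b := by
    intro b hb'
    have := run_listCodes wt b1 (A := 12) (X := 25) (by decide) (by decide) b
      (by rwa [f1 0 (by decide) (by decide)])
    rw [hs₂, this]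
    simp [rowCode, f1]
  have hc : leTest.Holds wt (counts.run wt s₂) ↔ rowsCost wt s 26 ≤ rowsCost wt s 25 := by
    rw [counts_leTest, rowsCost, rowsCost, e0,
      Finset.sum_congr rfl fun b hb => by rw [e11 b (Finset.mem_range.1 hb)],
      Finset.sum_congr (f := fun b => codeCost wt s₂ (s₂ 12 b)) rfl
        fun b hb => by rw [e12 b (Finset.mem_range.1 hb)]]
    simp only [codeCost, e0, e6]
  have g : ∀ a, a ∉ counts.writes → counts.run wt s₂ a = s₂ a := fun a h => run_frame wt _ _ h
  have e25 : counts.run wt s₂ 25 = s 25 := by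
    rw [g 25 (by decide), f12 25 (by decide) (by decide) (by decide)]
  have e26 : counts.run wt s₂ 26 = s 26 := by
    rw [g 26 (by decide), f12 26 (by decide) (by decide) (by decide)]
  have e00 : counts.run wt s₂ 0 = s 0 := by rw [g 0 (by decide), e0]
  rw [improve, run_seq, run_seq, run_seq]
  split_ifs with h
  · rw [run_cond_pos _ _ (hc.2 h)]
    refine run_fill_zero wt (by decide) (by decide) (by decide) _ (fun b => s 26 b)
      (fun i _ s' h hi => ?_) (fun i _ => ?_) b (by rwa [e00])
    · simp only [Expr.eval_get, Expr.eval_cell, hi]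
      rw [h 26 (by decide) (by decide), e26]
    · rw [memBound, e00, ← memBound]
      exact hb _ _
  · rw [run_cond_neg _ _ (fun h' => h (hc.1 h')), run_skip, e25]

end Prg

end

end RootedCycleBasis

namespace RootedCycleBasis

noncomputable section

namespace Prg

open Equiv

/-! ### Minimum-cost permutations by program -/

/-- The array `f` contains the values of the permutation `τ`. -/
def Encodes {n : ℕ} (f : ℕ → ℕ) (τ : Perm (Fin n)) : Prop := ∀ b : Fin n, f b = τ b

/-- The rows of length `n` of the table `f` contain the values of the permutations `D z`. -/
def EncodesRows {n : ℕ} (f : ℕ → ℕ) (D : Fin n → Perm (Fin n)) : Prop :=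
  ∀ z b : Fin n, f (z * n + b) = D z b

/-- The codes in array `7` have the costs `K`. -/
structure HasCosts (wt : ℕ → ℝ) (s : Mem) {n : ℕ} (K : Fin n → Fin n → Cost) : Prop where
  card : s 0 0 = n
  zero : codeCost wt s (s 0 1) = 0
  code : ∀ a b : Fin n, codeCost wt s (s 7 (a * n + b)) = K a b

/-- The costs of the rows up to `p`. -/
def upTo {n : ℕ} (K : Fin n → Fin n → Cost) (p : ℕ) (a b : Fin n) : Cost :=
  if a ≤ p then K a b else 0

variable {wt : ℕ → ℝ} {s : Mem} {n : ℕ} {K : Fin n → Fin n → Cost}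

theorem HasCosts.congr {s' : Mem} (h : HasCosts wt s K) (h0 : s' 0 = s 0) (h6 : s' 6 = s 6)
    (h7 : s' 7 = s 7) : HasCosts wt s' K := by
  obtain ⟨h1, h2, h3⟩ := h
  refine ⟨by rw [h0, h1], ?_, fun a b => ?_⟩
  · simpa only [codeCost, h0, h6] using h2
  · simpa only [codeCost, h0, h6, h7] using h3 a b

/-- The row left out and the rows beyond `p` are listed with the code `m`, whose cost is zero, so
every list has the same length `n`. -/
theorem rowsCost_eq_holeCost (h : HasCosts wt s K) {A p : ℕ} {z : Fin n} {τ : Perm (Fin n)}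
    (hp : s 20 0 = p) (hz : s 28 0 = z) (hτ : Encodes (s A) τ) :
    rowsCost wt s A = holeCost (upTo K p) τ z := by
  rw [rowsCost, h.card, Finset.sum_range, holeCost, ← Finset.add_sum_erase _ _ (Finset.mem_univ z)]
  have e : codeCost wt s (rowCode s A z) = 0 := by
    rw [rowCode, hz, if_pos rfl, ite_self, h.zero]
  rw [e, zero_add]
  refine Finset.sum_congr rfl fun b hb => ?_
  rw [rowCode, hp, hz, if_neg fun h => (Finset.mem_erase.1 hb).1 (Fin.ext h), h.card, hτ b, upTo]
  split_ifs
  exacts [h.code _ _, h.zero]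

/-- The number `n` is not the index of a row, so with this entry in array `28` nothing is left out.
-/
theorem rowsCost_eq_permCost (h : HasCosts wt s K) {A p : ℕ} {τ : Perm (Fin n)}
    (hp : s 20 0 = p) (hz : s 28 0 = n) (hτ : Encodes (s A) τ) :
    rowsCost wt s A = permCost (upTo K p) τ := by
  rw [rowsCost, h.card, Finset.sum_range, permCost]
  refine Finset.sum_congr rfl fun b _ => ?_
  rw [rowCode, hp, hz, if_neg b.2.ne, h.card, hτ b, upTo]
  split_ifs
  exacts [h.code _ _, h.zero]

theorem exists_run_improve (hb : Bounded s) (hn : s 0 0 = n) {τ τ' : Perm (Fin n)}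
    (h25 : Encodes (s 25) τ) (h26 : Encodes (s 26) τ') (f : Perm (Fin n) → Cost)
    (hτ : rowsCost wt s 25 = f τ) (hτ' : rowsCost wt s 26 = f τ') :
    ∃ ρ, Encodes (improve.run wt s 25) ρ ∧ (ρ = τ ∨ ρ = τ') ∧ f ρ ≤ f τ ∧ f ρ ≤ f τ' := by
  have h := run_improve wt hb
  rw [hτ, hτ', hn] at h
  by_cases hle : f τ' ≤ f τ
  · exact ⟨τ', fun b => by rw [h b b.2, if_pos hle, h26], Or.inr rfl, hle, le_rfl⟩
  · exact ⟨τ, fun b => by rw [h b b.2, if_neg hle, h25], Or.inl rfl, le_rfl, (not_le.1 hle).le⟩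

/-! #### One relaxation -/

/-- Use the permutation in the row of array `9` given by array `22` for the one in array `23`. -/
def relaxStep : Prg :=
  cond (.and (.eq (.get 9 (.add (.mul (.cell 22) .numV) (.cell 23))) (.get 8 (.cell 23)))
      (.not (.eq (.cell 23) (.cell 20))))
    (seq (fill 26 (.const 0) 24 (.get 9 (.add (.mul (.cell 22) .numV)
      (.ifEq (.cell 24) (.cell 22) (.cell 23) (.ifEq (.cell 24) (.cell 23) (.cell 22)
        (.cell 24)))))) improve)
    skip

/-- Compute the row of array `10` given by array `23` from the rows of array `9`. -/
def relaxRow : Prg :=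
  seq (fill 25 (.const 0) 24 (.get 9 (.add (.mul (.cell 23) .numV) (.cell 24))))
    (seq (set 28 (.const 0) (.cell 23))
      (seq (loop 22 0 relaxStep)
        (fill 10 (.mul (.cell 23) .numV) 24 (.get 25 (.cell 24)))))

theorem relaxStep_wf : relaxStep.WF := by
  simp [relaxStep, improve_wf, fill, WF, writes]

theorem relaxRow_wf : relaxRow.WF := by
  simp [relaxRow, relaxStep_wf, fill, WF, writes]
  decide

theorem exists_run_relaxStep (hb : Bounded s) (hK : HasCosts wt s K) {p z y : Fin n}
    {σ τ : Perm (Fin n)} {D : Fin n → Perm (Fin n)} (hp : s 20 0 = p) (hz : s 23 0 = z)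
    (hy : s 22 0 = y) (h28 : s 28 0 = z) (hσ : Encodes (s 8) σ) (hD : EncodesRows (s 9) D)
    (hτ : Encodes (s 25) τ) :
    ∃ ρ, Encodes (relaxStep.run wt s 25) ρ ∧
      (ρ = τ ∨ D y z = σ z ∧ z ≠ p ∧ ρ = D y * swap y z) ∧
      holeCost (upTo K p) ρ z ≤ holeCost (upTo K p) τ z ∧
      (D y z = σ z → z ≠ p →
        holeCost (upTo K p) ρ z ≤ holeCost (upTo K p) (D y * swap y z) z) := by
  have hT : (Test.and (.eq (.get 9 (.add (.mul (.cell 22) .numV) (.cell 23))) (.get 8 (.cell 23)))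
      (.not (.eq (.cell 23) (.cell 20)))).Holds wt s ↔ D y z = σ z ∧ z ≠ p := by
    simp [hz, hy, hp, hK.card, hD y z, hσ z, Fin.ext_iff]
  by_cases h : D y z = σ z ∧ z ≠ p
  · rw [relaxStep, run_cond_pos _ _ (hT.2 h), run_seq]
    set s₁ := (fill 26 (.const 0) 24 (.get 9 (.add (.mul (.cell 22) .numV)
      (.ifEq (.cell 24) (.cell 22) (.cell 23) (.ifEq (.cell 24) (.cell 23) (.cell 22)
        (.cell 24)))))).run wt s with hs₁
    have f1 : ∀ a, a ≠ 26 → a ≠ 24 → s₁ a = s a := fun a h h' => run_frame wt _ _ (by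
      simp [fill, writes, h, h'])
    have h26 : Encodes (s₁ 26) (D y * swap y z) := by
      intro b
      have := run_fill_zero wt (a := 26) (v := 24) (x := .get 9 (.add (.mul (.cell 22) .numV)
        (.ifEq (.cell 24) (.cell 22) (.cell 23) (.ifEq (.cell 24) (.cell 23) (.cell 22)
        (.cell 24))))) (by decide) (by decide) (by decide) s
        (fun i => s 9 (y * n + if i = y then (z : ℕ) else if i = z then (y : ℕ) else i))
        (fun i _ s' h hi => by simp [hi, h 9, h 22, h 23, h 0, hy, hz, hK.card])
        (fun i _ => hb _ _) b (by rw [hK.card]; exact b.2)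
      rw [hs₁, this]
      have e : (if (b : ℕ) = y then (z : ℕ) else if (b : ℕ) = z then (y : ℕ) else b) =
          (swap y z b : Fin n) := by
        rw [swap_apply_def]
        simp only [Fin.ext_iff]
        split_ifs <;> rfl
      rw [e, hD]; rfl
    have K1 := hK.congr (f1 0 (by decide) (by decide)) (f1 6 (by decide) (by decide))
      (f1 7 (by decide) (by decide))
    have e20 : s₁ 20 0 = p := by rw [f1 20 (by decide) (by decide), hp]
    have e28 : s₁ 28 0 = z := by rw [f1 28 (by decide) (by decide), h28]
    have h25 : Encodes (s₁ 25) τ := by rwa [f1 25 (by decide) (by decide)]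
    obtain ⟨ρ, h1, h2, h3, h4⟩ := exists_run_improve (wt := wt)
      (hb.run (by simp [fill, WF, writes]) wt : Bounded s₁) K1.card h25 h26
      (fun τ => holeCost (upTo K p) τ z)
      (rowsCost_eq_holeCost K1 e20 e28 h25) (rowsCost_eq_holeCost K1 e20 e28 h26)
    exact ⟨ρ, h1, h2.imp_right fun h' => ⟨h.1, h.2, h'⟩, h3, fun _ _ => h4⟩
  · rw [relaxStep, run_cond_neg _ _ (fun h' => h (hT.1 h')), run_skip]
    exact ⟨τ, hτ, Or.inl rfl, le_rfl, fun h1 h2 => absurd ⟨h1, h2⟩ h⟩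

/-- The candidate in array `25` starts as the old path to `z` and competes with its extension from
each `y` in turn. The result goes to array `10`, so later rows are still relaxed from the old table.
-/
theorem exists_run_relaxRow (hb : Bounded s) (hK : HasCosts wt s K) {p z : Fin n}
    {σ : Perm (Fin n)} {D : Fin n → Perm (Fin n)} (hp : s 20 0 = p) (hz : s 23 0 = z)
    (hσ : Encodes (s 8) σ) (hD : EncodesRows (s 9) D) :
    ∃ ρ : Perm (Fin n), (∀ b : Fin n, relaxRow.run wt s 10 (z * n + b) = ρ b) ∧
      (∀ j, (j < z * n ∨ z * n + n ≤ j) → relaxRow.run wt s 10 j = s 10 j) ∧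
      (ρ = D z ∨ ∃ y, D y z = σ z ∧ z ≠ p ∧ ρ = D y * swap y z) ∧
      holeCost (upTo K p) ρ z ≤ holeCost (upTo K p) (D z) z ∧
      ∀ y, D y z = σ z → z ≠ p →
        holeCost (upTo K p) ρ z ≤ holeCost (upTo K p) (D y * swap y z) z := by
  set s₁ := (fill 25 (.const 0) 24 (.get 9 (.add (.mul (.cell 23) .numV) (.cell 24)))).run wt s
    with hs₁
  have f1 : ∀ a, a ≠ 25 → a ≠ 24 → s₁ a = s a := fun a h h' => run_frame wt _ _ (by
    simp [fill, writes, h, h'])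
  have b1 : Bounded s₁ := hb.run (by simp [fill, WF, writes]) wt
  have h25 : Encodes (s₁ 25) (D z) := by
    intro b
    have := run_fill_zero wt (a := 25) (v := 24)
      (x := .get 9 (.add (.mul (.cell 23) .numV) (.cell 24))) (by decide) (by decide) (by decide) s
      (fun i => s 9 (z * n + i)) (fun i _ s' h hi => by simp [hi, h 9, h 23, h 0, hz, hK.card])
      (fun i _ => hb _ _) b (by rw [hK.card]; exact b.2)
    rw [hs₁, this, hD]
  set s₂ := (set 28 (.const 0) (.cell 23)).run wt s₁ with hs₂
  have e23 : s₁ 23 0 = z := by rw [f1 23 (by decide) (by decide), hz]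
  have e2 : s₂ = store s₁ 28 0 z := by
    rw [hs₂, run_set wt 28 (.const 0) (.cell 23) s₁ (b1 23 0)]
    simp [e23]
  have f2 : ∀ a, a ≠ 28 → s₂ a = s₁ a := fun a h => run_frame wt _ _ (by simp [writes, h])
  have b2 : Bounded s₂ := b1.run (by simp [WF]) wt
  set s₃ := (loop 22 0 relaxStep).run wt s₂ with hs₃
  have b3 : Bounded s₃ := b2.run (c := loop 22 0 relaxStep) ⟨by decide, by decide, by decide, relaxStep_wf⟩ wt
  have f3 : ∀ a, a ∉ (loop 22 0 relaxStep).writes → s₃ a = s₂ a := fun a h => run_frame wt _ _ h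
  have hn2 : s₂ 0 0 = n := by rw [f2 0 (by decide), f1 0 (by decide) (by decide), hK.card]
  have main := run_loop_bounded wt (v := 22) (k := 0) (c := relaxStep)
    ⟨by decide, by decide, by decide, relaxStep_wf⟩ b2
    (fun i s' => ∃ ρ : Perm (Fin n), Encodes (s' 25) ρ ∧
      (ρ = D z ∨ ∃ y, D y z = σ z ∧ z ≠ p ∧ ρ = D y * swap y z) ∧
      holeCost (upTo K p) ρ z ≤ holeCost (upTo K p) (D z) z ∧
      ∀ y : Fin n, (y : ℕ) < i → D y z = σ z → z ≠ p →
        holeCost (upTo K p) ρ z ≤ holeCost (upTo K p) (D y * swap y z) z)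
    (fun s₀ h => ⟨D z, by rwa [h 25 (by decide), f2 25 (by decide)], Or.inl rfl, le_rfl,
      fun y hy => absurd hy (by omega)⟩) ?_
  · rw [hn2] at main
    obtain ⟨ρ, h1, h2, h3, h4⟩ := main
    have hn3 : s₃ 0 0 = n := by rw [f3 0 (by decide), hn2]
    have e23' : s₃ 23 0 = z := by rw [f3 23 (by decide), f2 23 (by decide), e23]
    obtain ⟨g1, g2⟩ := run_fill wt (a := 10) (v := 24) (base := .mul (.cell 23) .numV)
      (x := .get 25 (.cell 24)) (by decide) (by decide) (by decide) s₃ (z * n) (fun i => s₃ 25 i)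
      (fun s' h => by simp [h 23, h 0, e23', hn3])
      (fun i _ s' h _ hi => by simp [hi, h 25]) (fun i _ => b3 _ _)
    rw [hn3] at g1 g2
    refine ⟨ρ, fun b => (g1 b b.2).trans (h1 b), fun j hj => (g2 j hj).trans ?_, h2, h3,
      fun y => h4 y y.2⟩
    rw [f3 10 (by decide), f2 10 (by decide), f1 10 (by decide) (by decide)]
  · rintro i hi s' hb' hfr hcnt ⟨ρ, h1, h2, h3, h4⟩ s'' hs''
    rw [hn2] at hi
    have fr : ∀ a, a ∉ (loop 22 0 relaxStep).writes → a ≠ 28 → a ≠ 25 → a ≠ 24 → s' a = s a :=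
      fun a h h' h'' h''' => by rw [hfr a h, f2 a h', f1 a h'' h''']
    have e28 : s' 28 0 = z := by rw [hfr 28 (by decide), e2, store_self]
    obtain ⟨ρ', k1, k2, k3, k4⟩ := exists_run_relaxStep (y := ⟨i, hi⟩) hb'
      (hK.congr (fr 0 (by decide) (by decide) (by decide) (by decide))
        (fr 6 (by decide) (by decide) (by decide) (by decide))
        (fr 7 (by decide) (by decide) (by decide) (by decide)))
      ((congrFun (fr 20 (by decide) (by decide) (by decide) (by decide)) 0).trans hp)
      ((congrFun (fr 23 (by decide) (by decide) (by decide) (by decide)) 0).trans hz)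
      hcnt e28 (by rwa [fr 8 (by decide) (by decide) (by decide) (by decide)])
      (by rwa [fr 9 (by decide) (by decide) (by decide) (by decide)]) h1
    refine ⟨ρ', by rwa [hs'' 25 (by decide)], ?_, k3.trans h3, fun y hy hyz hzp => ?_⟩
    · rcases k2 with rfl | k2
      exacts [h2, Or.inr ⟨_, k2⟩]
    · rcases Nat.lt_succ_iff_lt_or_eq.1 hy with hy | hy
      · exact k3.trans (h4 y hy hyz hzp)
      · obtain rfl : y = ⟨i, hi⟩ := Fin.ext hy
        exact k4 hyz hzp

end Prg

end

end RootedCycleBasis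

namespace RootedCycleBasis

noncomputable section

namespace Prg

open Equiv

variable {wt : ℕ → ℝ} {s : Mem} {n : ℕ} {K : Fin n → Fin n → Cost}

/-! #### Stages of the assignment algorithm -/

/-- Relax all rows of array `9`. -/
def relaxAll : Prg :=
  seq (loop 23 0 relaxRow) (fill2 9 23 24 (.get 10 (.add (.mul (.cell 23) .numV) (.cell 24))))

/-- Compare the row of array `9` given by array `23` with the current permutation. -/
def selectRow : Prg :=
  seq (fill 26 (.const 0) 24 (.get 9 (.add (.mul (.cell 23) .numV) (.cell 24)))) improve

/-- Compute the shortest alternating paths. -/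
def findPaths : Prg :=
  seq (fill2 9 23 24 (.ifEq (.cell 24) (.cell 20) (.get 8 (.cell 23))
      (.ifEq (.cell 24) (.cell 23) (.get 8 (.cell 20)) (.get 8 (.cell 24)))))
    (loop 21 0 relaxAll)

/-- Replace the permutation in array `8` by the best one in array `9`, if that is better. -/
def select : Prg :=
  seq (fill 25 (.const 0) 24 (.get 8 (.cell 24)))
    (seq (set 28 (.const 0) .numV)
      (seq (loop 23 0 selectRow) (fill 8 (.const 0) 24 (.get 25 (.cell 24)))))

/-- Improve the permutation in array `8`, taking the costs of one more row into account. -/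
def stage : Prg := seq findPaths select

/-- Compute a permutation of minimum cost. -/
def solve : Prg := seq (fill 8 (.const 0) 24 (.cell 24)) (loop 20 0 stage)

theorem relaxLoop_wf : (loop 23 0 relaxRow).WF :=
  ⟨by decide, by decide, by decide, relaxRow_wf⟩

theorem relaxAll_wf : relaxAll.WF := ⟨relaxLoop_wf, by simp [fill2, fill, WF, writes]⟩

theorem selectRow_wf : selectRow.WF := ⟨by simp [fill, WF, writes], improve_wf⟩

theorem findPaths_wf : findPaths.WF :=
  ⟨by simp [fill2, fill, WF, writes], by decide, by decide, by decide, relaxAll_wf⟩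

theorem selectLoop_wf : (loop 23 0 selectRow).WF :=
  ⟨by decide, by decide, by decide, selectRow_wf⟩

theorem select_wf : select.WF :=
  ⟨by simp [fill, WF, writes], by simp [WF], selectLoop_wf, by simp [fill, WF, writes]⟩

theorem stage_wf : stage.WF := ⟨findPaths_wf, select_wf⟩

theorem solve_wf : solve.WF :=
  ⟨by simp [fill, WF, writes], by decide, by decide, by decide, stage_wf⟩

theorem exists_run_relaxAll (hb : Bounded s) (hK : HasCosts wt s K) {p : Fin n}
    {σ : Perm (Fin n)} {D : Fin n → Perm (Fin n)} (hp : s 20 0 = p)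
    (hσ : Encodes (s 8) σ) (hD : EncodesRows (s 9) D) :
    ∃ D', EncodesRows (relaxAll.run wt s 9) D' ∧ IsRelaxation (upTo K p) σ p D D' := by
  set s₁ := (loop 23 0 relaxRow).run wt s with hs₁
  have b1 : Bounded s₁ := hb.run relaxLoop_wf wt
  have f1 : ∀ a, a ∉ (loop 23 0 relaxRow).writes → s₁ a = s a := fun a h => run_frame wt _ _ h
  have main := run_loop_bounded wt relaxLoop_wf hb
    (fun i s' => ∀ z : Fin n, (z : ℕ) < i → ∃ ρ : Perm (Fin n),
      (∀ b : Fin n, s' 10 (z * n + b) = ρ b) ∧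
      (ρ = D z ∨ ∃ y, D y z = σ z ∧ z ≠ p ∧ ρ = D y * swap y z) ∧
      holeCost (upTo K p) ρ z ≤ holeCost (upTo K p) (D z) z ∧
      ∀ y, D y z = σ z → z ≠ p →
        holeCost (upTo K p) ρ z ≤ holeCost (upTo K p) (D y * swap y z) z)
    (fun s₀ h z hz => absurd hz (by omega)) ?_
  · rw [hK.card] at main
    choose D' h1 h2 using fun z : Fin n => main z z.2
    refine ⟨D', fun z b => ?_, h2⟩
    have hn1 : s₁ 0 0 = n := by rw [f1 0 (by decide), hK.card]
    have := run_fill2 wt (a := 9) (v₁ := 23) (v₂ := 24)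
      (x := .get 10 (.add (.mul (.cell 23) .numV) (.cell 24))) (by decide) (by decide) (by decide)
      (by decide) (by decide) (by decide) s₁ (fun i j => s₁ 10 (i * n + j))
      (fun i _ j _ s' h hi hj => by simp [hi, hj, h 10, h 0, hn1]) (fun i _ j _ => b1 _ _)
      z (by rw [hn1]; exact z.2) b (by rw [hn1]; exact b.2)
    rw [hn1] at this
    exact this.trans (h1 z b)
  · intro i hi s' hb' hfr hcnt ih s'' hs'' z hz
    rw [hK.card] at hi
    obtain ⟨ρ, k1, k2, k3⟩ := exists_run_relaxRow (z := ⟨i, hi⟩) hb'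
      (hK.congr (hfr 0 (by decide)) (hfr 6 (by decide)) (hfr 7 (by decide)))
      ((congrFun (hfr 20 (by decide)) 0).trans hp) hcnt (by rwa [hfr 8 (by decide)])
      (by rwa [hfr 9 (by decide)])
    rcases Nat.lt_succ_iff_lt_or_eq.1 hz with hz | hz
    · obtain ⟨ρ', l1, l2⟩ := ih z hz
      refine ⟨ρ', fun b => ?_, l2⟩
      rw [hs'' 10 (by decide), k2 _ (Or.inl ?_), l1]
      calc (z : ℕ) * n + b < z * n + n := by omega
        _ = (z + 1) * n := by ring
        _ ≤ i * n := Nat.mul_le_mul_right _ hz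
    · obtain rfl : z = ⟨i, hi⟩ := Fin.ext hz
      exact ⟨ρ, fun b => by rw [hs'' 10 (by decide), k1], k3⟩

/-- The table starts with paths of at most one arc and is relaxed `n` times, which is enough for all
simple paths. -/
theorem exists_run_findPaths (hb : Bounded s) (hK : HasCosts wt s K) {p : Fin n}
    {σ : Perm (Fin n)} (hp : s 20 0 = p) (hσ : Encodes (s 8) σ)
    (hmin : ∀ τ : Perm (Fin n), τ p = σ p → permCost (upTo K p) σ ≤ permCost (upTo K p) τ) :
    ∃ D, EncodesRows (findPaths.run wt s 9) D ∧ IsShortest (upTo K p) σ p (n + 1) D := by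
  set s₁ := (fill2 9 23 24 (.ifEq (.cell 24) (.cell 20) (.get 8 (.cell 23))
      (.ifEq (.cell 24) (.cell 23) (.get 8 (.cell 20)) (.get 8 (.cell 24))))).run wt s with hs₁
  have b1 : Bounded s₁ := hb.run findPaths_wf.1 wt
  have f1 : ∀ a, a ≠ 9 → a ≠ 23 → a ≠ 24 → s₁ a = s a := fun a h h' h'' => run_frame wt _ _ (by
      simp [fill2, fill, writes, h, h', h''])
  have h9 : EncodesRows (s₁ 9) (fun z => σ * swap p z) := by
    intro z b
    have := run_fill2 wt (a := 9) (v₁ := 23) (v₂ := 24)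
      (x := .ifEq (.cell 24) (.cell 20) (.get 8 (.cell 23))
        (.ifEq (.cell 24) (.cell 23) (.get 8 (.cell 20)) (.get 8 (.cell 24)))) (by decide)
      (by decide) (by decide) (by decide) (by decide) (by decide) s
      (fun i j => s 8 (if j = p then i else if j = i then p else j))
      (fun i _ j _ s' h hi hj => by
        simp only [Expr.eval_ifEq, Expr.eval_cell, Expr.eval_get, hi, hj,
          h 20 (by decide) (by decide) (by decide), h 8 (by decide) (by decide) (by decide), hp]
        split_ifs <;> rfl)
      (fun i _ j _ => hb _ _) z (by rw [hK.card]; exact z.2) b (by rw [hK.card]; exact b.2)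
    rw [hK.card] at this
    have e : (if (b : ℕ) = p then (z : ℕ) else if (b : ℕ) = z then (p : ℕ) else b) =
        (swap p z b : Fin n) := by
      rw [swap_apply_def]
      simp only [Fin.ext_iff]
      split_ifs <;> rfl
    rw [hs₁, this, e, hσ]; rfl
  have hn1 : s₁ 0 0 = n := by rw [f1 0 (by decide) (by decide) (by decide), hK.card]
  have main := run_loop_bounded wt findPaths_wf.2 b1
    (fun i s' => ∃ D, EncodesRows (s' 9) D ∧ IsShortest (upTo K p) σ p (i + 1) D)
    (fun s₀ h => ⟨_, by rwa [h 9 (by decide)], by simpa using isShortest_swap _ _ _⟩) ?_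
  · rw [hn1] at main
    exact main
  · rintro i hi s' hb' hfr hcnt ⟨D, h1, h2⟩ s'' hs''
    have fr : ∀ a, a ∉ (loop 21 0 relaxAll).writes → a ≠ 9 → a ≠ 23 → a ≠ 24 → s' a = s a :=
      fun a h h' h'' h''' => by rw [hfr a h, f1 a h' h'' h''']
    obtain ⟨D', k1, k2⟩ := exists_run_relaxAll hb'
      (hK.congr (fr 0 (by decide) (by decide) (by decide) (by decide))
        (fr 6 (by decide) (by decide) (by decide) (by decide))
        (fr 7 (by decide) (by decide) (by decide) (by decide)))
      ((congrFun (fr 20 (by decide) (by decide) (by decide) (by decide)) 0).trans hp)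
      (by rwa [fr 8 (by decide) (by decide) (by decide) (by decide)]) h1
    exact ⟨D', by rwa [hs'' 9 (by decide)], h2.relax hmin k2⟩

theorem exists_run_select (hb : Bounded s) (hK : HasCosts wt s K) {p : Fin n}
    {σ : Perm (Fin n)} {D : Fin n → Perm (Fin n)} (hp : s 20 0 = p) (hσ : Encodes (s 8) σ)
    (hD : EncodesRows (s 9) D) :
    ∃ ρ : Perm (Fin n), Encodes (select.run wt s 8) ρ ∧
      ∀ z, permCost (upTo K p) ρ ≤ permCost (upTo K p) (D z) := by
  set s₁ := (fill 25 (.const 0) 24 (.get 8 (.cell 24))).run wt s with hs₁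
  have f1 : ∀ a, a ≠ 25 → a ≠ 24 → s₁ a = s a := fun a h h' => run_frame wt _ _ (by
    simp [fill, writes, h, h'])
  have b1 : Bounded s₁ := hb.run select_wf.1 wt
  have hn1 : s₁ 0 0 = n := by rw [f1 0 (by decide) (by decide), hK.card]
  have h25 : Encodes (s₁ 25) σ := by
    intro b
    have := run_fill_zero wt (a := 25) (v := 24) (x := .get 8 (.cell 24)) (by decide) (by decide)
      (by decide) s (fun i => s 8 i) (fun i _ s' h hi => by simp [hi, h 8])
      (fun i _ => hb _ _) b (by rw [hK.card]; exact b.2)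
    rw [hs₁, this, hσ]
  set s₂ := (set 28 (.const 0) .numV).run wt s₁ with hs₂
  have e2 : s₂ = store s₁ 28 0 n := by
    rw [hs₂, run_set wt 28 (.const 0) .numV s₁ (b1 0 0)]
    simp [hn1]
  have f2 : ∀ a, a ≠ 28 → s₂ a = s₁ a := fun a h => run_frame wt _ _ (by simp [writes, h])
  have b2 : Bounded s₂ := b1.run select_wf.2.1 wt
  have hn2 : s₂ 0 0 = n := by rw [f2 0 (by decide), hn1]
  set s₃ := (loop 23 0 selectRow).run wt s₂ with hs₃
  have b3 : Bounded s₃ := b2.run selectLoop_wf wt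
  have hn3 : s₃ 0 0 = n := (congrFun (selectLoop_wf.run_zero wt s₂) 0).trans hn2
  have main := run_loop_bounded wt selectLoop_wf b2
    (fun i s' => ∃ ρ : Perm (Fin n), Encodes (s' 25) ρ ∧
      ∀ z : Fin n, (z : ℕ) < i → permCost (upTo K p) ρ ≤ permCost (upTo K p) (D z))
    (fun s₀ h => ⟨σ, by rwa [h 25 (by decide), f2 25 (by decide)],
      fun y hy => absurd hy (by omega)⟩) ?_
  · rw [hn2] at main
    obtain ⟨ρ, h1, h2⟩ := main
    refine ⟨ρ, fun b => ?_, fun z => h2 z z.2⟩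
    have := run_fill_zero wt (a := 8) (v := 24) (x := .get 25 (.cell 24)) (by decide) (by decide)
      (by decide) s₃ (fun i => s₃ 25 i) (fun i _ s' h hi => by simp [hi, h 25])
      (fun i _ => b3 _ _) b (by rw [hn3]; exact b.2)
    exact this.trans (h1 b)
  · rintro i hi s' hb' hfr hcnt ⟨ρ, h1, h2⟩ s'' hs''
    rw [hn2] at hi
    have fr : ∀ a, a ∉ (loop 23 0 selectRow).writes → a ≠ 28 → a ≠ 25 → a ≠ 24 → s' a = s a :=
      fun a h h' h'' h''' => by rw [hfr a h, f2 a h', f1 a h'' h''']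
    set t := (fill 26 (.const 0) 24 (.get 9 (.add (.mul (.cell 23) .numV) (.cell 24)))).run wt s'
      with ht
    have ft : ∀ a, a ≠ 26 → a ≠ 24 → t a = s' a := fun a h h' => run_frame wt _ _ (by
      simp [fill, writes, h, h'])
    have Ks := hK.congr (fr 0 (by decide) (by decide) (by decide) (by decide))
      (fr 6 (by decide) (by decide) (by decide) (by decide))
      (fr 7 (by decide) (by decide) (by decide) (by decide))
    have Kt := Ks.congr (ft 0 (by decide) (by decide)) (ft 6 (by decide) (by decide))
      (ft 7 (by decide) (by decide))
    have h26 : Encodes (t 26) (D ⟨i, hi⟩) := by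
      intro b
      have := run_fill_zero wt (a := 26) (v := 24)
        (x := .get 9 (.add (.mul (.cell 23) .numV) (.cell 24))) (by decide) (by decide) (by decide)
        s' (fun j => s 9 (i * n + j)) (fun j _ u h hj => by
          simp [hj, h 9, h 23, h 0, hcnt, Ks.card,
            fr 9 (by decide) (by decide) (by decide) (by decide)])
        (fun i _ => by
          rw [memBound, fr 0 (by decide) (by decide) (by decide) (by decide), ← memBound]
          exact hb _ _) b (by rw [Ks.card]; exact b.2)
      rw [ht, this]
      exact hD ⟨i, hi⟩ b
    have h25' : Encodes (t 25) ρ := by rwa [ft 25 (by decide) (by decide)]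
    have e20 : t 20 0 = p := by
      rw [ft 20 (by decide) (by decide),
        fr 20 (by decide) (by decide) (by decide) (by decide), hp]
    have e28 : t 28 0 = n := by
      rw [ft 28 (by decide) (by decide), hfr 28 (by decide), e2, store_self]
    obtain ⟨ρ', k1, -, k3, k4⟩ := exists_run_improve (wt := wt)
      (hb'.run selectRow_wf.1 wt : Bounded t) Kt.card h25' h26 (fun τ => permCost (upTo K p) τ)
      (rowsCost_eq_permCost Kt e20 e28 h25') (rowsCost_eq_permCost Kt e20 e28 h26)
    refine ⟨ρ', by rw [hs'' 25 (by decide)]; exact k1, fun z hz => ?_⟩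
    rcases Nat.lt_succ_iff_lt_or_eq.1 hz with hz | hz
    · exact k3.trans (h2 z hz)
    · obtain rfl : z = ⟨i, hi⟩ := Fin.ext hz
      exact k4

theorem exists_run_stage (hb : Bounded s) (hK : HasCosts wt s K) {p : Fin n}
    {σ : Perm (Fin n)} (hp : s 20 0 = p) (hσ : Encodes (s 8) σ)
    (hmin : ∀ τ : Perm (Fin n), τ p = σ p → permCost (upTo K p) σ ≤ permCost (upTo K p) τ) :
    ∃ ρ : Perm (Fin n), Encodes (stage.run wt s 8) ρ ∧
      ∀ τ, permCost (upTo K p) ρ ≤ permCost (upTo K p) τ := by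
  have fr : ∀ a, a ∉ findPaths.writes → findPaths.run wt s a = s a :=
    fun a h => run_frame wt _ _ h
  obtain ⟨D, h1, h2⟩ := exists_run_findPaths hb hK hp hσ hmin
  obtain ⟨ρ, h3, h4⟩ := exists_run_select (wt := wt) (hb.run findPaths_wf wt)
    (hK.congr (fr 0 (by decide)) (fr 6 (by decide)) (fr 7 (by decide)))
    ((congrFun (fr 20 (by decide)) 0).trans hp)
    (by rw [fr 8 (by decide)]; exact hσ) h1
  refine ⟨ρ, h3, fun τ => ?_⟩
  obtain ⟨z, hz⟩ := h2.permCost_le hmin (by simp) τ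
  exact (h4 z).trans hz

/-- The rows are charged one after the other; before the first stage all costs vanish and the
identity is optimal. -/
theorem exists_run_solve (hb : Bounded s) (hK : HasCosts wt s K) :
    ∃ ρ : Perm (Fin n), Encodes (solve.run wt s 8) ρ ∧ ∀ τ, permCost K ρ ≤ permCost K τ := by
  set s₁ := (fill 8 (.const 0) 24 (.cell 24)).run wt s with hs₁
  have f1 : ∀ a, a ≠ 8 → a ≠ 24 → s₁ a = s a := fun a h h' => run_frame wt _ _ (by
    simp [fill, writes, h, h'])
  have b1 : Bounded s₁ := hb.run solve_wf.1 wt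
  have hn1 : s₁ 0 0 = n := by rw [f1 0 (by decide) (by decide), hK.card]
  let before (i : ℕ) (a b : Fin n) : Cost := if (a : ℕ) < i then K a b else 0
  have main := run_loop_bounded wt solve_wf.2 b1
    (fun i s' => ∃ ρ : Perm (Fin n), Encodes (s' 8) ρ ∧
      ∀ τ, permCost (before i) ρ ≤ permCost (before i) τ)
    (fun s₀ h => ⟨1, fun b => ?_, fun τ => by simp [permCost, before]⟩) ?_
  · rw [hn1] at main
    obtain ⟨ρ, h1, h2⟩ := main
    have e : before n = K := by
      funext a b
      exact if_pos a.2
    exact ⟨ρ, h1, e ▸ h2⟩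
  · rw [h 8 (by decide), hs₁]
    exact run_fill_zero wt (a := 8) (v := 24) (x := .cell 24) (by decide) (by decide)
      (by decide) s (fun i => i) (fun i _ s' _ hi => by simp [hi])
      (fun i hi => hi.le.trans (hb _ _)) b (by rw [hK.card]; exact b.2)
  · rintro i hi s' hb' hfr hcnt ⟨ρ, h1, h2⟩ s'' hs''
    rw [hn1] at hi
    have fr : ∀ a, a ∉ (loop 20 0 stage).writes → a ≠ 8 → a ≠ 24 → s' a = s a :=
      fun a h h' h'' => by rw [hfr a h, f1 a h' h'']
    -- Permutations with the same value in row `i` pay the same for it. So a permutation optimal for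
    -- the rows before `i` is optimal among those that agree with it in row `i` once that row is
    -- charged, as the path method requires.
    have split : ∀ τ : Perm (Fin n), permCost (upTo K i) τ =
        K ⟨i, hi⟩ (τ ⟨i, hi⟩) + permCost (before i) τ := by
      intro τ
      rw [permCost, permCost, ← Finset.add_sum_erase _ _ (Finset.mem_univ (⟨i, hi⟩ : Fin n)),
        ← Finset.add_sum_erase _ (fun b => before i b (τ b))
          (Finset.mem_univ (⟨i, hi⟩ : Fin n))]
      have e1 : upTo K i ⟨i, hi⟩ (τ ⟨i, hi⟩) = K ⟨i, hi⟩ (τ ⟨i, hi⟩) := if_pos le_rfl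
      have e2 : before i ⟨i, hi⟩ (τ ⟨i, hi⟩) = 0 := if_neg (lt_irrefl _)
      rw [e1, e2, zero_add]
      congr 1
      refine Finset.sum_congr rfl fun b hb => ?_
      have hne : (b : ℕ) ≠ i := fun h => (Finset.mem_erase.1 hb).1 (Fin.ext h)
      simp only [upTo, before, Nat.lt_iff_le_and_ne, hne, ne_eq, not_false_eq_true, and_true]
    obtain ⟨ρ', k1, k2⟩ := exists_run_stage (p := ⟨i, hi⟩) hb'
      (hK.congr (fr 0 (by decide) (by decide) (by decide)) (fr 6 (by decide) (by decide)
        (by decide)) (fr 7 (by decide) (by decide) (by decide))) hcnt h1 (fun τ hτ => by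
      rw [split, split, hτ]
      exact add_le_add_right (h2 τ) _)
    refine ⟨ρ', by rwa [hs'' 8 (by decide)], fun τ => ?_⟩
    have e : before (i + 1) = upTo K i := by
      funext a b
      simp only [before, upTo, Nat.lt_succ_iff]
    rw [e]
    exact k2 τ

end Prg

end

end RootedCycleBasis

/-! ### The cheapest rooted cycle and the greedy algorithm on the machine -/

namespace RootedCycleBasis

noncomputable section

open Equiv Prg

variable {n : ℕ} {G : SimpleGraph (Fin n)}

/-! ### The cost table of a target edge -/

namespace EdgeList

variable (L : EdgeList G)

theorem edge_injective : Function.Injective L.edge := L.inj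

theorem edge_mem (j : Fin L.m) : L.edge j ∈ G.edgeSet := by
  rw [← L.range_eq]; exact ⟨j, rfl⟩

theorem exists_edge_eq {f : Sym2 (Fin n)} (hf : f ∈ G.edgeSet) : ∃ j, L.edge j = f := by
  rw [← L.range_eq] at hf; exact hf

theorem adj (j : Fin L.m) : G.Adj (L.fst j) (L.snd j) := L.edge_mem j

open Classical in
/-- The index of an edge; other pairs of vertices get the code for forbidden choices. -/
def code (f : Sym2 (Fin n)) : ℕ := if h : ∃ j, L.edge j = f then (h.choose : ℕ) else L.m + 1

theorem code_edge (j : Fin L.m) : L.code (L.edge j) = j := by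
  have h : ∃ i, L.edge i = L.edge j := ⟨j, rfl⟩
  rw [code, dif_pos h, L.edge_injective h.choose_spec]

theorem code_of_notMem {f : Sym2 (Fin n)} (hf : f ∉ G.edgeSet) : L.code f = L.m + 1 :=
  dif_neg fun ⟨j, hj⟩ => hf (hj ▸ L.edge_mem j)

theorem wt_edge (w : Sym2 (Fin n) → ℝ) (j : Fin L.m) : L.wt w j = w (L.edge j) := by
  rw [wt, dif_pos j.2]

theorem wt_of_le (w : Sym2 (Fin n) → ℝ) {j : ℕ} (hj : L.m ≤ j) : L.wt w j = 0 :=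
  dif_neg hj.not_gt

end EdgeList

open Classical in
/-- The cost of an edge when the edges in `S` are covered. -/
def edgeCost (w : Sym2 (Fin n) → ℝ) (S : Set (Sym2 (Fin n))) (f : Sym2 (Fin n)) : Cost :=
  toLex (0, toLex (w f, if f ∈ S then 0 else 1))

theorem edgeCost_pos {w : Sym2 (Fin n) → ℝ} (S : Set (Sym2 (Fin n))) {f : Sym2 (Fin n)}
    (hf : 0 < w f) : 0 < edgeCost w S f := by
  change toLex ((0 : ℤ), toLex ((0 : ℝ), (0 : ℤ))) < _
  rw [edgeCost, Prod.Lex.toLex_lt_toLex]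
  refine Or.inr ⟨rfl, ?_⟩
  rw [Prod.Lex.toLex_lt_toLex]
  exact Or.inl hf

theorem finsum_edgeCost (w : Sym2 (Fin n) → ℝ) (S : Set (Sym2 (Fin n))) (D : G.Subgraph) :
    ∑ᶠ f ∈ D.edgeSet, edgeCost w S f =
      toLex ((0 : ℤ), toLex (weight w D, ((D.edgeSet \ S).ncard : ℤ))) := by
  classical
  have hfin : D.edgeSet.Finite := Set.toFinite _
  rw [finsum_mem_eq_finite_toFinset_sum _ hfin, weight, finsum_mem_eq_finite_toFinset_sum _ hfin]
  simp only [edgeCost]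
  rw [sum_toLex]
  congr 3
  · simp
  · rw [Finset.sum_ite, Finset.sum_const_zero, zero_add, Finset.sum_const, nsmul_eq_mul, mul_one,
      Set.ncard_eq_toFinset_card _ (hfin.subset Set.sdiff_subset)]
    refine congrArg (fun A : Finset (Sym2 (Fin n)) => (_, (A.card : ℤ))) ?_
    ext f
    simp

/-- The lexicographic cost of a cycle consists of `0`, its weight and its number of uncovered edges,
so its minimum expresses the greedy choice together with the rule for ties. -/
theorem IsBest.of_edgeCost_le {w : Sym2 (Fin n) → ℝ} {e : Sym2 (Fin n)} {S : Set (Sym2 (Fin n))}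
    {D : G.Subgraph} (hD : IsRootedCycle e D) (hnew : (D.edgeSet \ S).Nonempty)
    (h : ∀ D' : G.Subgraph, IsRootedCycle e D' → (D'.edgeSet \ S).Nonempty →
      ∑ᶠ f ∈ D.edgeSet, edgeCost w S f ≤ ∑ᶠ f ∈ D'.edgeSet, edgeCost w S f) :
    IsBest w e S D := by
  have key : ∀ D' : G.Subgraph, IsRootedCycle e D' → (D'.edgeSet \ S).Nonempty →
      weight w D < weight w D' ∨ weight w D = weight w D' ∧
        (D.edgeSet \ S).ncard ≤ (D'.edgeSet \ S).ncard := by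
    intro D' hD' hnew'
    have := h D' hD' hnew'
    rw [finsum_edgeCost, finsum_edgeCost, Prod.Lex.toLex_le_toLex] at this
    have := (this.resolve_left (lt_irrefl _)).2
    rw [Prod.Lex.toLex_le_toLex] at this
    exact this.imp_right fun h => ⟨h.1, Nat.cast_le.1 h.2⟩
  refine ⟨hD, hnew, fun D' h1 h2 => ?_, fun D' h1 h2 h3 => ?_⟩
  · rcases key D' h1 h2 with h | h
    exacts [h.le, h.1.le]
  · rcases key D' h1 h2 with h | h
    exacts [absurd h3 h.ne, h.2]

open Classical in
/-- The memory contains the input, the adjacency table with edge indices in array `5`, and in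
array `6` the marks of the edges in `S`. -/
structure Ready (L : EdgeList G) (r : Fin L.m) (S : Set (Sym2 (Fin n))) (s : Mem) : Prop where
  input_zero : s 0 = L.input r 0
  input_one : s 1 = L.input r 1
  input_two : s 2 = L.input r 2
  adj : ∀ a b : Fin n, s 5 (a * n + b) = L.code s(a, b)
  none : s 6 L.m = 1
  cov : ∀ j : Fin L.m, s 6 j = if L.edge j ∈ S then 1 else 0

namespace Ready

variable {L : EdgeList G} {r : Fin L.m} {S : Set (Sym2 (Fin n))} {s : Mem}

theorem congr (h : Ready L r S s) {s' : Mem} (h0 : s' 0 = s 0) (h1 : s' 1 = s 1) (h2 : s' 2 = s 2)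
    (h5 : s' 5 = s 5) (h6 : s' 6 = s 6) : Ready L r S s' := by
  obtain ⟨a, b, c, d, e, f⟩ := h
  exact ⟨h0.trans a, h1.trans b, h2.trans c, by rwa [h5], by rwa [h6], by rwa [h6]⟩

theorem card (h : Ready L r S s) : s 0 0 = n := by rw [h.input_zero]; rfl

theorem size (h : Ready L r S s) : s 0 1 = L.m := by rw [h.input_zero]; rfl

theorem root (h : Ready L r S s) : s 0 2 = r := by rw [h.input_zero]; rfl

theorem fst (h : Ready L r S s) (j : Fin L.m) : s 1 j = L.fst j := by
  rw [h.input_one]; exact dif_pos j.2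

theorem snd (h : Ready L r S s) (j : Fin L.m) : s 2 j = L.snd j := by
  rw [h.input_two]; exact dif_pos j.2

theorem codeCost_edge (h : Ready L r S s) (w : Sym2 (Fin n) → ℝ) (j : Fin L.m) :
    codeCost (L.wt w) s j = edgeCost w S (L.edge j) := by
  have hj : (j : ℕ) ≠ L.m + 1 := by have := j.2; omega
  rw [codeCost, h.size, if_neg hj, L.wt_edge, h.cov, edgeCost]
  split_ifs <;> rfl

theorem codeCost_none (h : Ready L r S s) (w : Sym2 (Fin n) → ℝ) :
    codeCost (L.wt w) s L.m = 0 := by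
  rw [codeCost, h.size, if_neg (by omega), L.wt_of_le w le_rfl, h.none]
  rfl

end Ready

/-- The code of the choice of column `b` in row `a` for the target edge `F`. -/
def arcCode (L : EdgeList G) (r F : Fin L.m) (a b : Fin n) : ℕ :=
  if a = L.fst F then if b = L.fst r ∨ b = L.snd r then F else L.m + 1
  else if a = L.snd F then if b = L.fst r ∨ b = L.snd r then r else L.m + 1
  else if a = b then L.m else L.code s(a, b)

section ArcCode

variable {L : EdgeList G} {r F : Fin L.m} {S : Set (Sym2 (Fin n))} {s : Mem}

theorem arcCode_of_not_isArc {a b : Fin n}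
    (h : ¬ IsArc G (L.fst r) (L.snd r) (L.fst F) (L.snd F) a b) : arcCode L r F a b = L.m + 1 := by
  rw [IsArc] at h
  rw [arcCode]
  by_cases h1 : a = L.fst F
  · rw [if_pos (Or.inl h1)] at h
    rw [if_pos h1, if_neg h]
  by_cases h2 : a = L.snd F
  · rw [if_pos (Or.inr h2)] at h
    rw [if_neg h1, if_pos h2, if_neg h]
  · rw [if_neg (by tauto), not_or] at h
    rw [if_neg h1, if_neg h2, if_neg (Ne.symm h.1), L.code_of_notMem h.2]

theorem arcCode_le_of_isArc {a b : Fin n}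
    (h : IsArc G (L.fst r) (L.snd r) (L.fst F) (L.snd F) a b) : arcCode L r F a b ≤ L.m := by
  rw [IsArc] at h
  rw [arcCode]
  by_cases h1 : a = L.fst F
  · rw [if_pos (Or.inl h1)] at h
    rw [if_pos h1, if_pos h]
    exact F.2.le
  by_cases h2 : a = L.snd F
  · rw [if_pos (Or.inr h2)] at h
    rw [if_neg h1, if_pos h2, if_pos h]
    exact r.2.le
  · rw [if_neg (by tauto)] at h
    rw [if_neg h1, if_neg h2]
    split_ifs with h3
    · exact le_rfl
    · obtain ⟨j, hj⟩ := L.exists_edge_eq (G.mem_edgeSet.2 (h.resolve_left (Ne.symm h3)))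
      rw [← hj, L.code_edge]
      exact j.2.le

theorem Ready.codeCost_arcCode (hs : Ready L r S s) (w : Sym2 (Fin n) → ℝ) {a b : Fin n}
    (h : IsArc G (L.fst r) (L.snd r) (L.fst F) (L.snd F) a b) :
    codeCost (L.wt w) s (arcCode L r F a b) =
      arcCost (edgeCost w S) (L.fst r) (L.snd r) (L.fst F) (L.snd F) a b := by
  rw [IsArc] at h
  rw [arcCode, arcCost]
  by_cases h1 : a = L.fst F
  · rw [if_pos (Or.inl h1)] at h
    rw [if_pos h1, if_pos h, if_pos h1, hs.codeCost_edge]; rfl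
  by_cases h2 : a = L.snd F
  · rw [if_pos (Or.inr h2)] at h
    rw [if_neg h1, if_pos h2, if_pos h, if_neg h1, if_pos h2, hs.codeCost_edge]; rfl
  · rw [if_neg (by tauto)] at h
    rw [if_neg h1, if_neg h2, if_neg h1, if_neg h2]
    by_cases h3 : a = b
    · rw [if_pos h3, if_pos h3.symm, hs.codeCost_none]
    · obtain ⟨j, hj⟩ := L.exists_edge_eq (G.mem_edgeSet.2 (h.resolve_left (Ne.symm h3)))
      rw [if_neg h3, if_neg (Ne.symm h3), ← hj, L.code_edge, hs.codeCost_edge]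

/-- The costs of the choices for the target edge `F`. -/
def arcTable (L : EdgeList G) (r F : Fin L.m) (w : Sym2 (Fin n) → ℝ) (s : Mem) (a b : Fin n) :
    Cost := codeCost (L.wt w) s (arcCode L r F a b)

/-- Forbidden choices dominate the cost, and by 2-connectivity some permutation avoids them
altogether. Hence an optimal permutation has none, and on permutations without them the table agrees
with `arcCost`. -/
theorem Ready.isBestPerm (hs : Ready L r S s) (hG : IsBiconnected G) {w : Sym2 (Fin n) → ℝ}
    {ρ : Perm (Fin n)}
    (hρ : ∀ τ, permCost (arcTable L r F w s) ρ ≤ permCost (arcTable L r F w s) τ) :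
    IsBestPerm G (edgeCost w S) (L.fst r) (L.snd r) (L.fst F) (L.snd F) ρ := by
  have hcost : ∀ τ : Perm (Fin n),
      (∀ a, IsArc G (L.fst r) (L.snd r) (L.fst F) (L.snd F) a (τ a)) →
      permCost (arcTable L r F w s) τ =
        permCost (arcCost (edgeCost w S) (L.fst r) (L.snd r) (L.fst F) (L.snd F)) τ :=
    fun τ hτ => Finset.sum_congr rfl fun a _ => hs.codeCost_arcCode w (hτ a)
  have harc : ∀ a, IsArc G (L.fst r) (L.snd r) (L.fst F) (L.snd F) a (ρ a) := by
    obtain ⟨τ, hτ⟩ := hG.exists_arcPerm (L.adj r).ne (L.adj F).ne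
    have h := hρ τ
    simp only [permCost, arcTable, codeCost, hs.size] at h
    rw [sum_toLex, sum_toLex, Prod.Lex.toLex_le_toLex] at h
    have h1 : ∑ b, (if arcCode L r F b (τ b) = L.m + 1 then 1 else 0 : ℤ) = 0 :=
      Finset.sum_eq_zero fun b _ => if_neg (by have := arcCode_le_of_isArc (hτ b); omega)
    have h2 : ∑ b, (if arcCode L r F b (ρ b) = L.m + 1 then 1 else 0 : ℤ) ≤ 0 := by
      refine le_trans ?_ h1.le
      rcases h with h | h
      exacts [h.le, h.1.le]
    have h3 : ∀ b, 0 ≤ (if arcCode L r F b (ρ b) = L.m + 1 then 1 else 0 : ℤ) := fun b => by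
      split_ifs <;> simp
    intro a
    by_contra ha
    have h4 := (Finset.sum_eq_zero_iff_of_nonneg fun b _ => h3 b).1
      (le_antisymm h2 (Finset.sum_nonneg fun b _ => h3 b)) a (Finset.mem_univ a)
    rw [if_pos (arcCode_of_not_isArc ha)] at h4
    exact one_ne_zero h4
  refine ⟨harc, fun τ hτ => ?_⟩
  rw [← hcost ρ harc, ← hcost τ hτ]
  exact hρ τ

/-- The cycle can be read off from the codes of the rows: the target rows list the target and root
edges, moved rows their edge, and fixed rows the filler `m`. -/
theorem edge_mem_permEdges_iff {ρ : Perm (Fin n)}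
    (hρ : ∀ a, IsArc G (L.fst r) (L.snd r) (L.fst F) (L.snd F) a (ρ a)) (i : Fin L.m) :
    L.edge i ∈ permEdges (L.fst r) (L.snd r) (L.fst F) (L.snd F) ρ ↔
      ∃ b, arcCode L r F b (ρ b) = i := by
  have hF := (L.adj F).ne
  have hx : arcCode L r F (L.fst F) (ρ (L.fst F)) = F := by
    have := hρ (L.fst F)
    rw [IsArc, if_pos (Or.inl rfl)] at this
    rw [arcCode, if_pos rfl, if_pos this]
  have hy : arcCode L r F (L.snd F) (ρ (L.snd F)) = r := by
    have := hρ (L.snd F)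
    rw [IsArc, if_pos (Or.inr rfl)] at this
    rw [arcCode, if_neg hF.symm, if_pos rfl, if_pos this]
  constructor
  · rintro (h | h | ⟨a, h1, h2, h3, h⟩)
    · exact ⟨_, hy.trans (congrArg _ (L.edge_injective (h : L.edge i = L.edge r)).symm)⟩
    · exact ⟨_, hx.trans (congrArg _ (L.edge_injective (h : L.edge i = L.edge F)).symm)⟩
    · exact ⟨a, by rw [arcCode, if_neg h1, if_neg h2, if_neg h3.symm, ← h, L.code_edge]⟩
  · rintro ⟨b, hb⟩
    by_cases h1 : b = L.fst F
    · rw [h1, hx, Fin.val_inj] at hb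
      exact Or.inr (Or.inl (by rw [← hb]; rfl))
    by_cases h2 : b = L.snd F
    · rw [h2, hy, Fin.val_inj] at hb
      exact Or.inl (by rw [← hb]; rfl)
    have h := hρ b
    rw [IsArc, if_neg (by tauto)] at h
    rw [arcCode, if_neg h1, if_neg h2] at hb
    have hi := i.2
    by_cases h3 : b = ρ b
    · rw [if_pos h3] at hb
      omega
    · obtain ⟨j, hj⟩ := L.exists_edge_eq (G.mem_edgeSet.2 (h.resolve_left (Ne.symm h3)))
      rw [if_neg h3, ← hj, L.code_edge, Fin.val_inj] at hb
      exact Or.inr (Or.inr ⟨b, h1, h2, Ne.symm h3, by rw [← hb, hj]⟩)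

/-- A permutation of minimum cost describes a cheapest rooted cycle through the target edge. -/
theorem Ready.exists_cycle (hs : Ready L r S s) (hG : IsBiconnected G) {w : Sym2 (Fin n) → ℝ}
    (hw : ∀ f ∈ G.edgeSet, 0 < w f) (hF : F ≠ r) {ρ : Perm (Fin n)}
    (hρ : ∀ τ, permCost (arcTable L r F w s) ρ ≤ permCost (arcTable L r F w s) τ) :
    ∃ D : G.Subgraph, IsRootedCycle (L.edge r) D ∧ L.edge F ∈ D.edgeSet ∧
      (∀ i, L.edge i ∈ D.edgeSet ↔ ∃ b, arcCode L r F b (ρ b) = i) ∧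
      (∀ b, arcCode L r F b (ρ b) ≤ L.m) ∧
      ∑ b, codeCost (L.wt w) s (arcCode L r F b (ρ b)) = ∑ᶠ f ∈ D.edgeSet, edgeCost w S f ∧
      ∀ D' : G.Subgraph, IsRootedCycle (L.edge r) D' → L.edge F ∈ D'.edgeSet →
        ∑ᶠ f ∈ D.edgeSet, edgeCost w S f ≤ ∑ᶠ f ∈ D'.edgeSet, edgeCost w S f := by
  have hbest := hs.isBestPerm hG hρ
  have hne : L.edge F ≠ L.edge r := fun h => hF (L.edge_injective h)
  obtain ⟨h1, h2, h3⟩ := hbest.isRootedCycle (fun f hf => edgeCost_pos S (hw f hf)) (L.adj r)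
    (L.adj F) hne
  refine ⟨_, h1, ?_, fun i => ?_, fun b => arcCode_le_of_isArc (hbest.arc b), ?_, ?_⟩
  · rw [h2]; exact Or.inr (Or.inl rfl)
  · rw [h2]; exact edge_mem_permEdges_iff hbest.arc i
  · rw [h2, ← h3]
    exact Finset.sum_congr rfl fun b _ => hs.codeCost_arcCode w (hbest.arc b)
  · intro D' hD' hFD'
    obtain ⟨τ, hτ, hc⟩ := hD'.exists_arcPerm (L.adj r) (L.adj F) hne hFD'
    rw [h2, ← h3, ← hc]
    exact hbest.le τ hτ

end ArcCode

end

end RootedCycleBasis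

namespace RootedCycleBasis

noncomputable section

namespace Prg

open Equiv

/-! ### The cheapest rooted cycle with an uncovered edge, by program -/

/-- The index of the root edge. -/
def rootE : Expr := .get 0 (.const 2)

/-- Compute the codes of the choices for the target edge in array `19`. -/
def codeTable : Prg :=
  fill2 7 23 24
    (.ifEq (.cell 23) (.get 1 (.cell 19))
      (.ifEq (.cell 24) (.get 1 rootE) (.cell 19)
        (.ifEq (.cell 24) (.get 2 rootE) (.cell 19) (.add .numE (.const 1))))
      (.ifEq (.cell 23) (.get 2 (.cell 19))
        (.ifEq (.cell 24) (.get 1 rootE) rootE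
          (.ifEq (.cell 24) (.get 2 rootE) rootE (.add .numE (.const 1))))
        (.ifEq (.cell 23) (.cell 24) .numE (.get 5 (.add (.mul (.cell 23) .numV) (.cell 24))))))

/-- List the codes of the cheapest rooted cycle through the target edge in array `11`. -/
def throughEdge : Prg :=
  seq codeTable (seq solve
    (fill 11 (.const 0) 24 (.get 7 (.add (.mul (.cell 24) .numV) (.get 8 (.cell 24))))))

/-- Replace the list of codes in array `13` by that in array `11` unless this is more expensive. -/
def keepCheaper : Prg :=
  seq (fill 12 (.const 0) 24 (.get 13 (.cell 24))) (seq counts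
    (cond leTest (fill 13 (.const 0) 24 (.get 11 (.cell 24))) skip))

/-- Try the target edge in array `19`. -/
def tryEdge : Prg :=
  cond (.and (.not (.eq (.cell 19) rootE)) (.eq (.get 6 (.cell 19)) (.const 0)))
    (seq throughEdge keepCheaper) skip

theorem codeTable_wf : codeTable.WF := by simp [codeTable, fill2, fill, WF, writes]

theorem throughEdge_wf : throughEdge.WF :=
  ⟨codeTable_wf, solve_wf, by simp [fill, WF, writes]⟩

theorem keepCheaper_wf : keepCheaper.WF := by
  simp [keepCheaper, fill, counts, sum, WF, writes]

theorem tryEdge_wf : tryEdge.WF := ⟨⟨throughEdge_wf, keepCheaper_wf⟩, trivial⟩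

@[simp] theorem eval_rootE (s : Mem) : rootE.eval s = s 0 2 := rfl

theorem codeCost_congr {s s' : Mem} (h0 : s' 0 = s 0) (h6 : s' 6 = s 6) (wt : ℕ → ℝ) (j : ℕ) :
    codeCost wt s' j = codeCost wt s j := by
  simp only [codeCost, h0, h6]

variable {n : ℕ} {G : SimpleGraph (Fin n)} {L : EdgeList G} {r F : Fin L.m}
  {S : Set (Sym2 (Fin n))} {s : Mem} {w : Sym2 (Fin n) → ℝ}

theorem run_codeTable (wt : ℕ → ℝ) (hb : Bounded s) (hs : Ready L r S s) (hF : s 19 0 = F)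
    (a b : Fin n) : codeTable.run wt s 7 (a * n + b) = arcCode L r F a b := by
  have hm : L.m + 1 ≤ memBound s := by rw [memBound, hs.size]; omega
  have := run_fill2 wt (a := 7) (v₁ := 23) (v₂ := 24)
    (x := .ifEq (.cell 23) (.get 1 (.cell 19))
      (.ifEq (.cell 24) (.get 1 rootE) (.cell 19)
        (.ifEq (.cell 24) (.get 2 rootE) (.cell 19) (.add .numE (.const 1))))
      (.ifEq (.cell 23) (.get 2 (.cell 19))
        (.ifEq (.cell 24) (.get 1 rootE) rootE
          (.ifEq (.cell 24) (.get 2 rootE) rootE (.add .numE (.const 1))))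
        (.ifEq (.cell 23) (.cell 24) .numE (.get 5 (.add (.mul (.cell 23) .numV) (.cell 24))))))
    (by decide) (by decide) (by decide) (by decide) (by decide) (by decide) s
    (fun i j => if i = L.fst F then if j = L.fst r then F else if j = L.snd r then F else L.m + 1
      else if i = L.snd F then if j = L.fst r then r else if j = L.snd r then r else L.m + 1
      else if i = j then L.m else s 5 (i * n + j))
    (fun i _ j _ s' h hi hj => by
      simp only [Expr.eval_ifEq, Expr.eval_cell, Expr.eval_get, Expr.eval_add, Expr.eval_mul,
        Expr.eval_numE, Expr.eval_numV, Expr.eval_const, eval_rootE, hi, hj,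
        h 0 (by decide) (by decide) (by decide), h 1 (by decide) (by decide) (by decide),
        h 2 (by decide) (by decide) (by decide), h 5 (by decide) (by decide) (by decide),
        h 19 (by decide) (by decide) (by decide), hF, hs.card, hs.size, hs.root, hs.fst, hs.snd])
    (fun i _ j _ => by
      have h1 := F.2
      have h2 := r.2
      have h3 := hb 5 (i * n + j)
      split_ifs <;> omega)
    a (by rw [hs.card]; exact a.2) b (by rw [hs.card]; exact b.2)
  rw [hs.card] at this
  rw [codeTable, this, arcCode, hs.adj]
  simp only [Fin.val_inj, ite_or]

/-- The list `f` contains the indices of the edges of `D`. -/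
structure Lists (L : EdgeList G) (f : ℕ → ℕ) (D : G.Subgraph) : Prop where
  le : ∀ b < n, f b ≤ L.m
  mem_iff : ∀ i, L.edge i ∈ D.edgeSet ↔ ∃ b < n, f b = i

theorem exists_run_throughEdge (hG : IsBiconnected G) (hw : ∀ f ∈ G.edgeSet, 0 < w f)
    (hb : Bounded s) (hs : Ready L r S s) (hF : s 19 0 = F) (hr : F ≠ r) :
    ∃ D : G.Subgraph, IsRootedCycle (L.edge r) D ∧ L.edge F ∈ D.edgeSet ∧
      Lists L (throughEdge.run (L.wt w) s 11) D ∧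
      ∑ b ∈ Finset.range n, codeCost (L.wt w) s (throughEdge.run (L.wt w) s 11 b) =
        ∑ᶠ f ∈ D.edgeSet, edgeCost w S f ∧
      ∀ D' : G.Subgraph, IsRootedCycle (L.edge r) D' → L.edge F ∈ D'.edgeSet →
        ∑ᶠ f ∈ D.edgeSet, edgeCost w S f ≤ ∑ᶠ f ∈ D'.edgeSet, edgeCost w S f := by
  set s₁ := codeTable.run (L.wt w) s with hs₁
  have f1 : ∀ a, a ∉ codeTable.writes → s₁ a = s a := fun a h => run_frame _ _ _ h
  have b1 : Bounded s₁ := hb.run codeTable_wf _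
  have h7 : ∀ a b : Fin n, s₁ 7 (a * n + b) = arcCode L r F a b :=
    run_codeTable (L.wt w) hb hs hF
  have hK : HasCosts (L.wt w) s₁ (arcTable L r F w s) := by
    refine ⟨by rw [f1 0 (by decide), hs.card], ?_, fun a b => ?_⟩
    · rw [codeCost_congr (f1 0 (by decide)) (f1 6 (by decide)), f1 0 (by decide), hs.size,
        hs.codeCost_none]
    · rw [h7, codeCost_congr (f1 0 (by decide)) (f1 6 (by decide))]; rfl
  obtain ⟨ρ, h8, hρ⟩ := exists_run_solve b1 hK
  obtain ⟨D, h1, h2, h3, h4, h5, h6⟩ := hs.exists_cycle hG hw hr hρ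
  set s₂ := solve.run (L.wt w) s₁ with hs₂
  have f2 : ∀ a, a ∉ solve.writes → s₂ a = s₁ a := fun a h => run_frame _ _ _ h
  have b2 : Bounded s₂ := b1.run solve_wf _
  have hn2 : s₂ 0 0 = n := by rw [f2 0 (by decide), f1 0 (by decide), hs.card]
  have h11 : ∀ b : Fin n, throughEdge.run (L.wt w) s 11 b = arcCode L r F b (ρ b) := by
    intro b
    have := run_fill_zero (L.wt w) (a := 11) (v := 24)
      (x := .get 7 (.add (.mul (.cell 24) .numV) (.get 8 (.cell 24)))) (by decide) (by decide)
      (by decide) s₂ (fun i => s₂ 7 (i * n + s₂ 8 i)) (fun i _ s' h hi => by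
        simp [hi, h 7, h 8, h 0, hn2]) (fun i _ => b2 _ _) b (by rw [hn2]; exact b.2)
    rw [throughEdge, run_seq, run_seq]
    refine this.trans ?_
    rw [h8 b, f2 7 (by decide), h7]
  refine ⟨D, h1, h2, ⟨fun b hb => ?_, fun i => (h3 i).trans ?_⟩, ?_, h6⟩
  · exact (h11 ⟨b, hb⟩).le.trans (h4 _)
  · constructor
    · rintro ⟨b, hb⟩
      exact ⟨b, b.2, (h11 b).trans hb⟩
    · rintro ⟨b, hbn, hb⟩
      exact ⟨⟨b, hbn⟩, (h11 ⟨b, hbn⟩).symm.trans hb⟩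
  · rw [Finset.sum_range, ← h5]
    exact Finset.sum_congr rfl fun b _ => by rw [h11]

open Classical in
theorem run_keepCheaper (wt : ℕ → ℝ) (hb : Bounded s) : ∀ b < s 0 0,
    keepCheaper.run wt s 13 b =
      if ∑ b ∈ Finset.range (s 0 0), codeCost wt s (s 11 b) ≤
        ∑ b ∈ Finset.range (s 0 0), codeCost wt s (s 13 b) then s 11 b else s 13 b := by
  intro b hbn
  set s₁ := (fill 12 (.const 0) 24 (.get 13 (.cell 24))).run wt s with hs₁
  have f1 : ∀ a, a ≠ 12 → a ≠ 24 → s₁ a = s a := fun a h h' => run_frame wt _ _ (by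
    simp [fill, writes, h, h'])
  have h0 : s₁ 0 = s 0 := f1 0 (by decide) (by decide)
  have h6 : s₁ 6 = s 6 := f1 6 (by decide) (by decide)
  have h11 : s₁ 11 = s 11 := f1 11 (by decide) (by decide)
  have h12 : ∀ b < s 0 0, s₁ 12 b = s 13 b :=
    run_fill_zero wt (a := 12) (v := 24) (x := .get 13 (.cell 24)) (by decide) (by decide)
      (by decide) s (fun i => s 13 i) (fun i _ s' h hi => by simp [hi, h 13]) (fun i _ => hb _ _)
  have f2 : ∀ a, a ∉ counts.writes → counts.run wt s₁ a = s₁ a := fun a h => run_frame wt _ _ h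
  have hc : leTest.Holds wt (counts.run wt s₁) ↔
      ∑ b ∈ Finset.range (s 0 0), codeCost wt s (s 11 b) ≤
        ∑ b ∈ Finset.range (s 0 0), codeCost wt s (s 13 b) := by
    rw [counts_leTest, h0, h11,
      Finset.sum_congr (f := fun b => codeCost wt s₁ (s₁ 12 b)) rfl
        fun b hb => by rw [h12 b (Finset.mem_range.1 hb)]]
    simp only [codeCost_congr h0 h6]
  have e0 : counts.run wt s₁ 0 = s 0 := by rw [f2 0 (by decide), h0]
  rw [keepCheaper, run_seq, run_seq]
  split_ifs with h
  · rw [run_cond_pos _ _ (hc.2 h)]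
    refine run_fill_zero wt (by decide) (by decide) (by decide) _ (fun b => s 11 b)
      (fun i _ s' h hi => ?_) (fun i _ => ?_) b (by rwa [e0])
    · simp only [Expr.eval_get, Expr.eval_cell, hi]
      rw [h 11 (by decide) (by decide), f2 11 (by decide), h11]
    · rw [memBound, e0, ← memBound]
      exact hb _ _
  · rw [run_cond_neg _ _ (fun h' => h (hc.1 h')), run_skip, f2 13 (by decide),
      f1 13 (by decide) (by decide)]

/-- The list of codes in array `13` describes a cheapest rooted cycle among those that contain one
of the first `j` edges, provided it is not covered. -/
def BestSoFar (L : EdgeList G) (r : Fin L.m) (S : Set (Sym2 (Fin n))) (w : Sym2 (Fin n) → ℝ)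
    (s : Mem) (j : ℕ) : Prop :=
  ((∀ b < n, s 13 b = L.m + 1) ∧ ∀ F : Fin L.m, (F : ℕ) < j → F = r ∨ L.edge F ∈ S) ∨
    ∃ D : G.Subgraph, IsRootedCycle (L.edge r) D ∧ (D.edgeSet \ S).Nonempty ∧
      Lists L (s 13) D ∧
      ∑ b ∈ Finset.range n, codeCost (L.wt w) s (s 13 b) = ∑ᶠ f ∈ D.edgeSet, edgeCost w S f ∧
      ∀ F : Fin L.m, (F : ℕ) < j → F ≠ r → L.edge F ∉ S →
        ∀ D' : G.Subgraph, IsRootedCycle (L.edge r) D' → L.edge F ∈ D'.edgeSet →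
          ∑ᶠ f ∈ D.edgeSet, edgeCost w S f ≤ ∑ᶠ f ∈ D'.edgeSet, edgeCost w S f

/-- A cycle with an uncovered edge need only be optimal among the cycles through that edge; the
minimum over all target edges is then the global one. -/
theorem BestSoFar.run_tryEdge (hG : IsBiconnected G) (hw : ∀ f ∈ G.edgeSet, 0 < w f)
    (hb : Bounded s) (hs : Ready L r S s) (hF : s 19 0 = F) (h : BestSoFar L r S w s F) :
    BestSoFar L r S w (tryEdge.run (L.wt w) s) (F + 1) := by
  have hlt : ∀ F' : Fin L.m, (F' : ℕ) < F + 1 → (F' : ℕ) < F ∨ F' = F := fun F' h =>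
    (Nat.lt_succ_iff_lt_or_eq.1 h).imp_right Fin.ext
  have hT : (Test.and (.not (.eq (.cell 19) rootE)) (.eq (.get 6 (.cell 19)) (.const 0))).Holds
      (L.wt w) s ↔ F ≠ r ∧ L.edge F ∉ S := by
    simp [hF, hs.root, hs.cov, Fin.val_inj]
  by_cases hc : F ≠ r ∧ L.edge F ∉ S
  swap
  · rw [tryEdge, run_cond_neg _ _ (fun h' => hc (hT.1 h')), run_skip]
    rcases h with ⟨h1, h2⟩ | ⟨D, h1, h2, h3, h4, h5⟩
    · refine Or.inl ⟨h1, fun F' hF' => ?_⟩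
      rcases hlt F' hF' with h | rfl
      exacts [h2 F' h, by tauto]
    · refine Or.inr ⟨D, h1, h2, h3, h4, fun F' hF' => ?_⟩
      rcases hlt F' hF' with h | rfl
      exacts [h5 F' h, fun h h' => absurd ⟨h, h'⟩ hc]
  rw [tryEdge, run_cond_pos _ _ (hT.2 hc), run_seq]
  obtain ⟨D, h1, h2, h3, h4, h5⟩ := exists_run_throughEdge hG hw hb hs hF hc.1
  set s₁ := throughEdge.run (L.wt w) s with hs₁
  have f1 : ∀ a, a ∉ throughEdge.writes → s₁ a = s a := fun a h => run_frame _ _ _ h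
  have b1 : Bounded s₁ := hb.run throughEdge_wf _
  have hn1 : s₁ 0 0 = n := by rw [f1 0 (by decide), hs.card]
  have f2 : ∀ a, a ∉ keepCheaper.writes → keepCheaper.run (L.wt w) s₁ a = s₁ a :=
    fun a h => run_frame _ _ _ h
  have hcc : ∀ j, codeCost (L.wt w) s₁ j = codeCost (L.wt w) s j :=
    codeCost_congr (f1 0 (by decide)) (f1 6 (by decide)) _
  have hcc2 : ∀ j, codeCost (L.wt w) (keepCheaper.run (L.wt w) s₁) j = codeCost (L.wt w) s j :=
    fun j => (codeCost_congr (f2 0 (by decide)) (f2 6 (by decide)) _ j).trans (hcc j)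
  have h13 := run_keepCheaper (L.wt w) b1
  simp only [hn1, hcc, h4, f1 13 (by decide)] at h13
  have new : ∀ (A : ∀ F' : Fin L.m, (F' : ℕ) < F → F' ≠ r → L.edge F' ∉ S →
        ∀ D' : G.Subgraph, IsRootedCycle (L.edge r) D' → L.edge F' ∈ D'.edgeSet →
          ∑ᶠ f ∈ D.edgeSet, edgeCost w S f ≤ ∑ᶠ f ∈ D'.edgeSet, edgeCost w S f)
      (B : ∑ᶠ f ∈ D.edgeSet, edgeCost w S f ≤
        ∑ b ∈ Finset.range n, codeCost (L.wt w) s (s 13 b)),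
      BestSoFar L r S w (keepCheaper.run (L.wt w) s₁) (F + 1) := by
    intro A B
    have e : ∀ b < n, keepCheaper.run (L.wt w) s₁ 13 b = s₁ 11 b := fun b hb => by
      rw [h13 b hb, if_pos B]
    refine Or.inr ⟨D, h1, ⟨_, h2, hc.2⟩, ⟨fun b hb => ?_, fun i => (h3.mem_iff i).trans ?_⟩, ?_,
      fun F' hF' => ?_⟩
    · rw [e b hb]; exact h3.le b hb
    · exact exists_congr fun b => and_congr_right fun hb => by rw [e b hb]
    · rw [← h4]
      exact Finset.sum_congr rfl fun b hb => by rw [hcc2, e b (Finset.mem_range.1 hb)]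
    · rcases hlt F' hF' with h | rfl
      exacts [A F' h, fun _ _ => h5]
  rcases h with ⟨k1, k2⟩ | ⟨D₀, k1, k2, k3, k4, k5⟩
  · refine new (fun F' hF' h h' => absurd (k2 F' hF') (by tauto)) ?_
    have e : ∑ b ∈ Finset.range n, codeCost (L.wt w) s (s 13 b) =
        ∑ b ∈ Finset.range n, codeCost (L.wt w) s (L.m + 1) :=
      Finset.sum_congr rfl fun b hb => by rw [k1 b (Finset.mem_range.1 hb)]
    rw [e, finsum_edgeCost]
    simp only [codeCost, hs.size, if_true]
    rw [sum_toLex, Prod.Lex.toLex_le_toLex]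
    -- The initial list consists of `n > 0` forbidden codes, so the first actual cycle is cheaper in
    -- the leading component.
    left
    have hn : 0 < n := Fin.pos (L.fst r)
    simpa using hn
  · by_cases hle : ∑ᶠ f ∈ D.edgeSet, edgeCost w S f ≤ ∑ᶠ f ∈ D₀.edgeSet, edgeCost w S f
    · exact new (fun F' hF' h h' D' hD' hFD' => hle.trans (k5 F' hF' h h' D' hD' hFD'))
        (by rwa [k4])
    · have e : ∀ b < n, keepCheaper.run (L.wt w) s₁ 13 b = s 13 b := fun b hb => by
        rw [h13 b hb, k4, if_neg hle]
      refine Or.inr ⟨D₀, k1, k2, ⟨fun b hb => ?_, fun i => (k3.mem_iff i).trans ?_⟩, ?_,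
        fun F' hF' => ?_⟩
      · rw [e b hb]; exact k3.le b hb
      · exact exists_congr fun b => and_congr_right fun hb => by rw [e b hb]
      · rw [← k4]
        exact Finset.sum_congr rfl fun b hb => by rw [hcc2, e b (Finset.mem_range.1 hb)]
      · rcases hlt F' hF' with h | rfl
        · exact k5 F' h
        · exact fun _ _ D' hD' hFD' => (not_le.1 hle).le.trans (h5 D' hD' hFD')

end Prg

end

end RootedCycleBasis

namespace RootedCycleBasis

noncomputable section

open Prg

/-! ### The greedy algorithm -/

section Greedy

variable {V : Type*} {G : SimpleGraph V} {C : ℕ → G.Subgraph} {e : Sym2 V} {k : ℕ}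

theorem IsRootedCycle.exists_ne {D : G.Subgraph} (hD : IsRootedCycle e D) :
    ∃ f ∈ D.edgeSet, f ≠ e := by
  induction e using Sym2.ind with
  | _ u v =>
    have huv : D.Adj u v := hD.2
    obtain ⟨z, hz, hne⟩ := Set.exists_ne_of_one_lt_ncard
      (by rw [hD.1.2 u (D.edge_vert huv)]; exact one_lt_two) v
    exact ⟨s(u, z), hz, fun h => hne (Sym2.congr_right.1 h)⟩

theorem covered_zero (C : ℕ → G.Subgraph) : covered C 0 = ∅ := by
  simp [covered]

theorem covered_succ (C : ℕ → G.Subgraph) (k : ℕ) :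
    covered C (k + 1) = covered C k ∪ (C k).edgeSet := by
  ext f
  simp only [covered, Set.mem_ofPred_eq, Set.mem_union, Nat.lt_succ_iff_lt_or_eq, or_and_right,
    exists_or, exists_eq_left]

theorem covered_congr {C C' : ℕ → G.Subgraph} (h : ∀ i < k, C i = C' i) :
    covered C k = covered C' k := by
  ext f
  exact exists_congr fun i => and_congr_right fun hi => by rw [h i hi]

/-- This is why the root edge need not be tried as a target: it is uncovered only before the first
cycle, when every other edge is uncovered too. -/
theorem IsRootedCycle.exists_ne_notMem_covered (hC : ∀ i < k, IsRootedCycle e (C i))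
    {D : G.Subgraph} (hD : IsRootedCycle e D) (hnew : (D.edgeSet \ covered C k).Nonempty) :
    ∃ f ∈ D.edgeSet, f ∉ covered C k ∧ f ≠ e := by
  obtain ⟨f, hf, hfC⟩ := hnew
  by_cases hfe : f = e
  · obtain rfl : k = 0 := by
      by_contra hk
      exact hfC ⟨0, Nat.pos_of_ne_zero hk, hfe ▸ (hC 0 (Nat.pos_of_ne_zero hk)).2⟩
    obtain ⟨f', h1, h2⟩ := hD.exists_ne
    exact ⟨f', h1, by simp [covered_zero], h2⟩
  · exact ⟨f, hf, hfC, hfe⟩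

end Greedy

namespace Prg

/-- The adjacency table with the edge indices, and the mark that makes the code `m` cheap. -/
def setUp : Prg :=
  seq (fill2 5 23 24 (.add .numE (.const 1)))
    (seq (loop 24 1 (seq
      (set 5 (.add (.mul (.get 1 (.cell 24)) .numV) (.get 2 (.cell 24))) (.cell 24))
      (set 5 (.add (.mul (.get 2 (.cell 24)) .numV) (.get 1 (.cell 24))) (.cell 24))))
      (set 6 .numE (.const 1)))

/-- Find the next cycle of the greedy sequence. -/
def findCycle : Prg :=
  seq (fill 13 (.const 0) 24 (.add .numE (.const 1))) (loop 19 1 tryEdge)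

/-- Mark an edge of the new cycle. -/
def markEdge : Prg :=
  cond (.le (.add (.get 13 (.cell 24)) (.const 1)) .numE)
    (seq (set 4 (.add (.mul (.cell 3) .numE) (.get 13 (.cell 24))) (.const 1))
      (set 6 (.get 13 (.cell 24)) (.const 1))) skip

/-- Append the new cycle to the output and mark its edges as covered. -/
def record : Prg := seq (loop 24 0 markEdge) (set 3 (.const 0) (.add (.cell 3) (.const 1)))

/-- One round of the greedy algorithm. -/
def greedyRound : Prg := seq findCycle (cond (.le (.get 13 (.const 0)) .numE) record skip)

/-- The greedy algorithm. -/
def greedy : Prg := seq setUp (loop 18 1 greedyRound)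

theorem setUp_wf : setUp.WF := by simp [setUp, fill2, fill, WF, writes]

theorem findLoop_wf : (loop 19 1 tryEdge).WF :=
  ⟨by decide, by decide, by decide, tryEdge_wf⟩

theorem findCycle_wf : findCycle.WF := ⟨by simp [fill, WF, writes], findLoop_wf⟩

theorem markLoop_wf : (loop 24 0 markEdge).WF := by simp [markEdge, WF, writes]

theorem record_wf : record.WF := ⟨markLoop_wf, by simp [WF]⟩

theorem greedyRound_wf : greedyRound.WF := ⟨findCycle_wf, record_wf, trivial⟩

theorem greedyLoop_wf : (loop 18 1 greedyRound).WF :=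
  ⟨by decide, by decide, by decide, greedyRound_wf⟩

theorem greedy_wf : greedy.WF := ⟨setUp_wf, greedyLoop_wf⟩

variable {n : ℕ} {G : SimpleGraph (Fin n)} {L : EdgeList G} {r : Fin L.m}
  {S : Set (Sym2 (Fin n))} {s : Mem} {w : Sym2 (Fin n) → ℝ}

theorem BestSoFar.congr {j : ℕ} (h : BestSoFar L r S w s j) {s' : Mem} (h0 : s' 0 = s 0)
    (h6 : s' 6 = s 6) (h13 : s' 13 = s 13) : BestSoFar L r S w s' j := by
  simpa only [BestSoFar, h13, codeCost_congr h0 h6] using h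

theorem bestSoFar_findCycle (hG : IsBiconnected G) (hw : ∀ f ∈ G.edgeSet, 0 < w f)
    (hb : Bounded s) (hs : Ready L r S s) :
    BestSoFar L r S w (findCycle.run (L.wt w) s) L.m := by
  set s₁ := (fill 13 (.const 0) 24 (.add .numE (.const 1))).run (L.wt w) s with hs₁
  have f1 : ∀ a, a ≠ 13 → a ≠ 24 → s₁ a = s a := fun a h h' => run_frame _ _ _ (by
    simp [fill, writes, h, h'])
  have b1 : Bounded s₁ := hb.run findCycle_wf.1 _
  have h13 : ∀ b < n, s₁ 13 b = L.m + 1 := by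
    have := run_fill_zero (L.wt w) (a := 13) (v := 24) (x := .add .numE (.const 1)) (by decide)
      (by decide) (by decide) s (fun _ => L.m + 1)
      (fun i _ s' h hi => by simp [h 0, hs.size])
      (fun i _ => by rw [memBound, hs.size]; omega)
    rwa [hs.card] at this
  have hm : s₁ 0 1 = L.m := by rw [f1 0 (by decide) (by decide), hs.size]
  have main := run_loop_bounded (L.wt w) findLoop_wf b1 (fun i s' => BestSoFar L r S w s' i)
    (fun s₀ h => Or.inl ⟨by rwa [h 13 (by decide)], fun F hF => absurd hF (by omega)⟩) ?_
  · rwa [hm] at main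
  · intro i hi s' hb' hfr hcnt ih s'' hs''
    rw [hm] at hi
    have fr : ∀ a, a ∉ (loop 19 1 tryEdge).writes → a ≠ 13 → a ≠ 24 → s' a = s a :=
      fun a h h' h'' => by rw [hfr a h, f1 a h' h'']
    have hr' : Ready L r S s' := hs.congr (fr 0 (by decide) (by decide) (by decide))
      (fr 1 (by decide) (by decide) (by decide)) (fr 2 (by decide) (by decide) (by decide))
      (fr 5 (by decide) (by decide) (by decide)) (fr 6 (by decide) (by decide) (by decide))
    exact (BestSoFar.run_tryEdge (F := ⟨i, hi⟩) hG hw hb' hr' hcnt ih).congr (hs'' 0 (by decide))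
      (hs'' 6 (by decide)) (hs'' 13 (by decide))

/-! #### Recording a cycle -/

-- Only codes below `m` are recorded. The filler `m` is skipped, since in the incidence matrix its
-- cell would belong to the next row.
open Classical in
theorem run_markLoop (wt : ℕ → ℝ) (hb : Bounded s) :
    (∀ x, (loop 24 0 markEdge).run wt s 4 x =
      if ∃ b < s 0 0, s 13 b < s 0 1 ∧ x = s 3 0 * s 0 1 + s 13 b then 1 else s 4 x) ∧
    ∀ x, (loop 24 0 markEdge).run wt s 6 x =
      if ∃ b < s 0 0, s 13 b < s 0 1 ∧ x = s 13 b then 1 else s 6 x := by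
  refine run_loop_bounded wt markLoop_wf hb (fun i s' =>
    (∀ x, s' 4 x = if ∃ b < i, s 13 b < s 0 1 ∧ x = s 3 0 * s 0 1 + s 13 b then 1 else s 4 x) ∧
    ∀ x, s' 6 x = if ∃ b < i, s 13 b < s 0 1 ∧ x = s 13 b then 1 else s 6 x)
    (fun s₀ h => ⟨fun x => by simp [h 4], fun x => by simp [h 6]⟩) ?_
  rintro i hi s' hb' hfr hcnt ⟨ih1, ih2⟩ s'' hs''
  have h0 : s' 0 = s 0 := hfr 0 (by decide)
  have h3 : s' 3 = s 3 := hfr 3 (by decide)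
  have h13 : s' 13 = s 13 := hfr 13 (by decide)
  have hsplit : ∀ P : ℕ → Prop, (∃ b < i + 1, P b) ↔ (∃ b < i, P b) ∨ P i := fun P => by
    simp only [Nat.lt_succ_iff_lt_or_eq, or_and_right, exists_or, exists_eq_left]
  rw [hs'' 4 (by decide), hs'' 6 (by decide)]
  simp only [hsplit]
  have hT : (Test.le (.add (.get 13 (.cell 24)) (.const 1)) .numE).Holds wt s' ↔
      s 13 i < s 0 1 := by
    simp [hcnt, h0, h13]
  by_cases hc : s 13 i < s 0 1
  · have hM : 1 ≤ memBound s' := by rw [memBound]; omega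
    rw [markEdge, run_cond_pos _ _ (hT.2 hc), run_seq, run_set wt 4 _ (.const 1) s' hM]
    rw [run_set wt 6 _ (.const 1) _ (by rw [memBound_store _ _ _ (by decide)]; exact hM)]
    have e1 : Expr.eval s' (.add (.mul (.cell 3) .numE) (.get 13 (.cell 24))) =
        s 3 0 * s 0 1 + s 13 i := by simp [hcnt, h0, h3, h13]
    have e2 : Expr.eval (store s' 4 (Expr.eval s' (.add (.mul (.cell 3) .numE)
        (.get 13 (.cell 24)))) 1) (.get 13 (.cell 24)) = s 13 i := by
      simp [store_of_ne, hcnt, h13]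
    simp only [Expr.eval_const]
    rw [e2, e1]
    constructor
    · intro x
      rw [store_of_ne _ _ _ (by decide)]
      by_cases hx : x = s 3 0 * s 0 1 + s 13 i
      · rw [hx, store_self, if_pos (Or.inr ⟨hc, rfl⟩)]
      · rw [store_self_of_ne _ _ _ hx, ih1]
        simp [hx]
    · intro x
      by_cases hx : x = s 13 i
      · rw [hx, store_self, if_pos (Or.inr ⟨hc, rfl⟩)]
      · rw [store_self_of_ne _ _ _ hx, store_of_ne _ _ _ (by decide), ih2]
        simp [hx]
  · rw [markEdge, run_cond_neg _ _ (fun h => hc (hT.1 h)), run_skip]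
    simp only [hc, false_and, or_false]
    exact ⟨ih1, ih2⟩

theorem run_record (wt : ℕ → ℝ) (hb : Bounded s) (hs : Ready L r S s) {D : G.Subgraph}
    (hD : Lists L (s 13) D) {k : ℕ} (hk : s 3 0 = k) (hkm : k ≤ L.m) :
    Ready L r (S ∪ D.edgeSet) (record.run wt s) ∧ record.run wt s 3 0 = k + 1 ∧
      (∀ j : Fin L.m, record.run wt s 4 (k * L.m + j) = 1 ↔
        L.edge j ∈ D.edgeSet ∨ s 4 (k * L.m + j) = 1) ∧
      (∀ x, (x < k * L.m ∨ k * L.m + L.m ≤ x) → record.run wt s 4 x = s 4 x) := by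
  obtain ⟨h4, h6⟩ := run_markLoop wt hb
  rw [hs.card, hs.size, hk] at h4
  rw [hs.card, hs.size] at h6
  set s₁ := (loop 24 0 markEdge).run wt s with hs₁
  have f1 : ∀ a, a ∉ (loop 24 0 markEdge).writes → s₁ a = s a := fun a h => run_frame _ _ _ h
  have f2 : ∀ a, a ≠ 3 → record.run wt s a = s₁ a := fun a h =>
    run_frame wt (set 3 (.const 0) (.add (.cell 3) (.const 1))) s₁ (by simp [writes, h])
  have hmem : ∀ j : Fin L.m, (∃ b < n, s 13 b < L.m ∧ (j : ℕ) = s 13 b) ↔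
      L.edge j ∈ D.edgeSet := by
    intro j
    rw [hD.mem_iff]
    refine exists_congr fun b => and_congr_right fun hb => ⟨fun h => h.2.symm, fun h => ?_⟩
    exact ⟨h ▸ j.2, h.symm⟩
  refine ⟨⟨?_, ?_, ?_, ?_, ?_, fun j => ?_⟩, ?_, fun j => ?_, fun x hx => ?_⟩
  · rw [f2 0 (by decide), f1 0 (by decide), hs.input_zero]
  · rw [f2 1 (by decide), f1 1 (by decide), hs.input_one]
  · rw [f2 2 (by decide), f1 2 (by decide), hs.input_two]
  · rw [f2 5 (by decide), f1 5 (by decide)]; exact hs.adj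
  · rw [f2 6 (by decide), h6, if_neg, hs.none]
    rintro ⟨b, -, h, h'⟩
    omega
  · rw [f2 6 (by decide), h6, hs.cov]
    by_cases h : L.edge j ∈ D.edgeSet
    · rw [if_pos ((hmem j).2 h), if_pos (Set.mem_union_right S h)]
    · rw [if_neg fun h' => h ((hmem j).1 h')]
      by_cases hS : L.edge j ∈ S
      · rw [if_pos hS, if_pos (Set.mem_union_left _ hS)]
      · rw [if_neg hS, if_neg fun h' => h'.elim hS h]
  · have e3 : s₁ 3 = s 3 := f1 3 (by decide)
    have e0 : s₁ 0 = s 0 := f1 0 (by decide)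
    have := run_set wt 3 (.const 0) (.add (.cell 3) (.const 1)) s₁ (by
      simp only [Expr.eval_add, Expr.eval_cell, Expr.eval_const, e3, hk, memBound, e0, hs.size]
      omega)
    rw [record, run_seq, this, Expr.eval_const, store_self]
    simp [e3, hk]
  · rw [f2 4 (by decide), h4]
    by_cases h : L.edge j ∈ D.edgeSet
    · obtain ⟨b, h1, h2, h3⟩ := (hmem j).2 h
      rw [if_pos ⟨b, h1, h2, by rw [h3]⟩]
      simp [h]
    · rw [if_neg fun ⟨b, h1, h2, h3⟩ => h ((hmem j).1 ⟨b, h1, h2, Nat.add_left_cancel h3⟩)]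
      simp [h]
  · rw [f2 4 (by decide), h4, if_neg]
    rintro ⟨b, -, h, h'⟩
    omega

/-! #### Initialization -/

theorem row_add_inj {a b x y : Fin n} : (a : ℕ) * n + b = x * n + y ↔ a = x ∧ b = y := by
  constructor
  · intro h
    have : finProdFinEquiv (a, b) = finProdFinEquiv (x, y) := by
      apply Fin.ext
      simp only [finProdFinEquiv_apply_val]
      rw [mul_comm n, mul_comm n]
      omega
    simpa using finProdFinEquiv.injective this
  · rintro ⟨rfl, rfl⟩; rfl

theorem bounded_input (L : EdgeList G) (r : Fin L.m) : Bounded (L.input r) := by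
  intro a i
  have hM : memBound (L.input r) = n + L.m + 2 := rfl
  rw [hM]
  have hr := r.2
  unfold EdgeList.input
  split
  · split <;> omega
  · split_ifs with h
    · have := (L.fst ⟨i, h⟩).2; omega
    · omega
  · split_ifs with h
    · have := (L.snd ⟨i, h⟩).2; omega
    · omega
  · omega

theorem code_eq_iff {f : Sym2 (Fin n)} (j : Fin L.m) : L.code f = j ↔ L.edge j = f := by
  constructor
  · intro h
    by_cases hf : f ∈ G.edgeSet
    · obtain ⟨i, rfl⟩ := L.exists_edge_eq hf
      rw [L.code_edge, Fin.val_inj] at h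
      rw [h]
    · rw [L.code_of_notMem hf] at h
      have := j.2
      omega
  · rintro rfl
    exact L.code_edge j

/-- After `i` rounds the table knows the edges of index below `i`, in both orders of their ends. The
mark at `m` prevents the filler from counting as an uncovered edge. -/
theorem run_setUp (wt : ℕ → ℝ) (L : EdgeList G) (r : Fin L.m) :
    Ready L r ∅ (setUp.run wt (L.input r)) ∧ setUp.run wt (L.input r) 3 0 = 0 ∧
      ∀ x, setUp.run wt (L.input r) 4 x = 0 := by
  have hb := bounded_input L r
  set s := L.input r with hs
  have hn : s 0 0 = n := rfl
  have hm : s 0 1 = L.m := rfl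
  set s₁ := (fill2 5 23 24 (.add .numE (.const 1))).run wt s with hs₁
  have f1 : ∀ a, a ≠ 5 → a ≠ 23 → a ≠ 24 → s₁ a = s a := fun a h h' h'' => run_frame _ _ _ (by
    simp [fill2, fill, writes, h, h', h''])
  have b1 : Bounded s₁ := hb.run setUp_wf.1 _
  have h0 : s₁ 0 = s 0 := f1 0 (by decide) (by decide) (by decide)
  have h5 : ∀ a b : Fin n, s₁ 5 (a * n + b) = L.m + 1 := fun a b =>
    run_fill2 wt (a := 5) (v₁ := 23) (v₂ := 24) (x := .add .numE (.const 1)) (by decide)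
      (by decide) (by decide) (by decide) (by decide) (by decide) s (fun _ _ => L.m + 1)
      (fun i _ j _ s' h _ _ => by simp [h 0, hm]) (fun i _ j _ => by rw [memBound, hm]; omega)
      a a.2 b b.2
  set c : Prg := seq
    (set 5 (.add (.mul (.get 1 (.cell 24)) .numV) (.get 2 (.cell 24))) (.cell 24))
    (set 5 (.add (.mul (.get 2 (.cell 24)) .numV) (.get 1 (.cell 24))) (.cell 24)) with hc
  set s₂ := (loop 24 1 c).run wt s₁ with hs₂
  have b2 : Bounded s₂ := b1.run setUp_wf.2.1 _
  have f2 : ∀ a, a ≠ 5 → a ≠ 24 → s₂ a = s₁ a := fun a h h' => run_frame _ _ _ (by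
    simp [hc, writes, h, h'])
  have main := run_loop_bounded wt setUp_wf.2.1 b1 (fun i s' => ∀ a b : Fin n,
      s' 5 (a * n + b) = if L.code s(a, b) < i then L.code s(a, b) else L.m + 1)
    (fun s₀ h a b => by rw [h 5 (by decide), h5, if_neg (by omega)]) ?_
  · have e : setUp.run wt s = store s₂ 6 L.m 1 := by
      have hm2 : s₂ 0 1 = L.m := by rw [f2 0 (by decide) (by decide), h0, hm]
      have := run_set wt 6 .numE (.const 1) s₂ (by
        rw [memBound, Expr.eval_const]; omega)
      rw [Expr.eval_numE, hm2] at this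
      exact this
    have h6 : s₂ 6 = s 6 := by
      rw [f2 6 (by decide) (by decide), f1 6 (by decide) (by decide) (by decide)]
    have fr : ∀ a, a ≠ 5 → a ≠ 6 → a ≠ 23 → a ≠ 24 → setUp.run wt s a = s a :=
      fun a h h' h'' h''' => by
        rw [e, store_of_ne _ _ _ h', f2 a h h''', f1 a h h'' h''']
    refine ⟨⟨?_, ?_, ?_, fun a b => ?_, ?_, fun j => ?_⟩, ?_, fun x => ?_⟩
    · exact fr 0 (by decide) (by decide) (by decide) (by decide)
    · exact fr 1 (by decide) (by decide) (by decide) (by decide)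
    · exact fr 2 (by decide) (by decide) (by decide) (by decide)
    · rw [e, store_of_ne _ _ _ (by decide)]
      refine (main a b).trans ?_
      rw [h0, hm]
      split_ifs with h
      · rfl
      · by_cases hab : s(a, b) ∈ G.edgeSet
        · obtain ⟨j, hj⟩ := L.exists_edge_eq hab
          rw [← hj, L.code_edge] at h
          exact absurd j.2 h
        · rw [L.code_of_notMem hab]
    · rw [e, store_self]
    · rw [e, store_self_of_ne _ _ _ j.2.ne, h6]
      simp [hs, EdgeList.input]
    · rw [fr 3 (by decide) (by decide) (by decide) (by decide)]; rfl
    · rw [fr 4 (by decide) (by decide) (by decide) (by decide)]; rfl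
  · intro i hi s' hb' hfr hcnt ih s'' hs'' a b
    have hi' : i < L.m := by rwa [h0, hm] at hi
    have fr : ∀ a, a ≠ 5 → a ≠ 23 → a ≠ 24 → s' a = s a := fun a h h' h'' => by
      rw [hfr a (by simp [writes, h, h'']), f1 a h h' h'']
    have g0 : s' 0 = s 0 := fr 0 (by decide) (by decide) (by decide)
    have e1 : s' 1 i = L.fst ⟨i, hi'⟩ := by
      rw [fr 1 (by decide) (by decide) (by decide)]; exact dif_pos hi'
    have e2 : s' 2 i = L.snd ⟨i, hi'⟩ := by
      rw [fr 2 (by decide) (by decide) (by decide)]; exact dif_pos hi'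
    have hM : i ≤ memBound s' := by rw [memBound, g0, hm]; omega
    have ec : c.run wt s' = store (store s' 5 (L.fst ⟨i, hi'⟩ * n + L.snd ⟨i, hi'⟩) i) 5
        (L.snd ⟨i, hi'⟩ * n + L.fst ⟨i, hi'⟩) i := by
      rw [hc, run_seq, run_set wt 5 _ _ s' (by rw [Expr.eval_cell, hcnt]; exact hM)]
      rw [run_set wt 5 _ _ _ (by
        rw [memBound_store _ _ _ (by decide), Expr.eval_cell, store_of_ne _ _ _ (by decide), hcnt]
        exact hM)]
      simp [store_of_ne, hcnt, e1, e2, g0, hn]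
    rw [hs'' 5 (by decide)]
    change c.run wt s' 5 _ = _
    rw [ec]
    have hiff := code_eq_iff (f := s(a, b)) (⟨i, hi'⟩ : Fin L.m)
    have hsym : L.edge ⟨i, hi'⟩ = s(a, b) ↔ (a = L.fst ⟨i, hi'⟩ ∧ b = L.snd ⟨i, hi'⟩) ∨
        (a = L.snd ⟨i, hi'⟩ ∧ b = L.fst ⟨i, hi'⟩) := by
      rw [eq_comm, EdgeList.edge, Sym2.eq_iff]
    by_cases h1 : a = L.snd ⟨i, hi'⟩ ∧ b = L.fst ⟨i, hi'⟩
    · have hcode := hiff.2 (hsym.2 (Or.inr h1))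
      rw [row_add_inj.2 h1, store_self, hcode, if_pos (Nat.lt_succ_self i)]
    rw [store_self_of_ne _ _ _ (fun h => h1 (row_add_inj.1 h))]
    by_cases h2 : a = L.fst ⟨i, hi'⟩ ∧ b = L.snd ⟨i, hi'⟩
    · have hcode := hiff.2 (hsym.2 (Or.inl h2))
      rw [row_add_inj.2 h2, store_self, hcode, if_pos (Nat.lt_succ_self i)]
    rw [store_self_of_ne _ _ _ (fun h => h2 (row_add_inj.1 h)), ih]
    have hne : L.code s(a, b) ≠ i := fun h => by
      rcases hsym.1 (hiff.1 h) with h | h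
      exacts [h2 h, h1 h]
    simp only [Nat.lt_succ_iff_lt_or_eq, hne, or_false]

end Prg

end

end RootedCycleBasis

namespace RootedCycleBasis

noncomputable section

namespace Prg

variable {n : ℕ} {G : SimpleGraph (Fin n)} {L : EdgeList G} {r : Fin L.m}
  {S : Set (Sym2 (Fin n))} {s : Mem} {w : Sym2 (Fin n) → ℝ}

/-! #### Correctness of the greedy algorithm -/

/-- After `i` rounds, the memory describes `k` cycles of a greedy sequence. -/
structure GreedyState (L : EdgeList G) (r : Fin L.m) (w : Sym2 (Fin n) → ℝ) (s : Mem) (i k : ℕ)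
    (C : ℕ → G.Subgraph) : Prop where
  le : k ≤ i
  count : s 3 0 = k
  ready : Ready L r (covered C k) s
  best : ∀ l < k, IsBest w (L.edge r) (covered C l) (C l)
  out : ∀ l < k, ∀ j : Fin L.m, L.edge j ∈ (C l).edgeSet ↔ s 4 (l * L.m + j) = 1
  free : ∀ x, k * L.m ≤ x → s 4 x = 0
  progress : k = i ∨ ∀ f ∈ G.edgeSet, f ≠ L.edge r → f ∈ covered C k

/-- If no uncovered target edge is left, the round changes neither output nor marks. Otherwise the
stored list is a greedy choice and is appended; the cells of its row were still `0`, so the row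
marks exactly the edges of the new cycle. -/
theorem GreedyState.exists_succ (hG : IsBiconnected G) (hw : ∀ f ∈ G.edgeSet, 0 < w f)
    (hb : Bounded s) {i k : ℕ} {C : ℕ → G.Subgraph} (h : GreedyState L r w s i k C)
    (hi : i < L.m) : ∃ k' C', GreedyState L r w (greedyRound.run (L.wt w) s) (i + 1) k' C' := by
  have hbest := bestSoFar_findCycle hG hw hb h.ready
  set s₁ := findCycle.run (L.wt w) s with hs₁
  have f1 : ∀ a, a ∉ findCycle.writes → s₁ a = s a := fun a h => run_frame _ _ _ h
  have b1 : Bounded s₁ := hb.run findCycle_wf _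
  have hr1 : Ready L r (covered C k) s₁ := h.ready.congr (f1 0 (by decide)) (f1 1 (by decide))
    (f1 2 (by decide)) (f1 5 (by decide)) (f1 6 (by decide))
  have e3 : s₁ 3 0 = k := by rw [f1 3 (by decide), h.count]
  have e4 : s₁ 4 = s 4 := f1 4 (by decide)
  have hn : 0 < n := Fin.pos (L.fst r)
  rw [greedyRound, run_seq, ← hs₁]
  rcases hbest with ⟨k1, k2⟩ | ⟨D, k1, k2, k3, -, k5⟩
  · rw [run_cond_neg, run_skip]
    · refine ⟨k, C, h.le.trans (Nat.le_succ i), e3, hr1, h.best, by rw [e4]; exact h.out,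
        by rw [e4]; exact h.free, Or.inr fun f hf hfr => ?_⟩
      obtain ⟨F, rfl⟩ := L.exists_edge_eq hf
      exact (k2 F F.2).resolve_left fun h => hfr (by rw [h])
    · simp [k1 0 hn, hr1.size]
  · have hle := k3.le 0 hn
    rw [run_cond_pos _ _ (by simpa [hr1.size] using hle)]
    obtain ⟨l1, l2, l3, l4⟩ := run_record (L.wt w) b1 hr1 k3 e3 (h.le.trans hi.le)
    rw [e4] at l3 l4
    have hC : ∀ l < k, Function.update C k D l = C l := fun l hl =>
      Function.update_of_ne hl.ne _ _
    have hCk : Function.update C k D k = D := Function.update_self _ _ _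
    have hcov : ∀ l ≤ k, covered (Function.update C k D) l = covered C l := fun l hl =>
      covered_congr fun j hj => hC j (hj.trans_le hl)
    have hroot : ∀ l < k, IsRootedCycle (L.edge r) (C l) := fun l hl => (h.best l hl).rooted
    refine ⟨k + 1, Function.update C k D, by have := h.le; omega, l2, ?_, fun l hl => ?_,
      fun l hl j => ?_, fun x hx => ?_, Or.inl ?_⟩
    · rwa [covered_succ, hcov k le_rfl, hCk]
    · rcases Nat.lt_succ_iff_lt_or_eq.1 hl with hl | rfl
      · rw [hcov l hl.le, hC l hl]
        exact h.best l hl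
      · rw [hcov l le_rfl, hCk]
        refine .of_edgeCost_le k1 k2 fun D' hD' hnew => ?_
        obtain ⟨f, hf, hfC, hfe⟩ := hD'.exists_ne_notMem_covered hroot hnew
        obtain ⟨F, rfl⟩ := L.exists_edge_eq (D'.edgeSet_subset hf)
        exact k5 F F.2 (fun h => hfe (by rw [h])) hfC D' hD' hf
    · rcases Nat.lt_succ_iff_lt_or_eq.1 hl with hl | rfl
      · rw [hC l hl, h.out l hl j, l4]
        left
        calc l * L.m + j < l * L.m + L.m := by have := j.2; omega
          _ = (l + 1) * L.m := by ring
          _ ≤ k * L.m := Nat.mul_le_mul_right _ hl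
      · rw [hCk, l3, h.free _ (by omega)]
        simp
    · rw [add_mul, one_mul] at hx
      rw [l4 x (Or.inr hx)]
      exact h.free x (by omega)
    · rcases h.progress with h' | h'
      · rw [h']
      · obtain ⟨f, hf, hfC, hfe⟩ := k1.exists_ne_notMem_covered hroot k2
        exact absurd (h' f (D.edgeSet_subset hf) hfe) hfC

/-- Choosing a new edge for each of `m` cycles gives an injection of `m` indices into the `m` edges,
which is onto. Hence `m` rounds suffice. -/
theorem mem_covered_of_isBest {C : ℕ → G.Subgraph}
    (hC : ∀ l < L.m, IsBest w (L.edge r) (covered C l) (C l)) {f : Sym2 (Fin n)}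
    (hf : f ∈ G.edgeSet) : f ∈ covered C L.m := by
  have hnew : ∀ l : Fin L.m, ∃ j : Fin L.m, L.edge j ∈ (C l).edgeSet \ covered C l := by
    intro l
    obtain ⟨f, hf, hfC⟩ := (hC l l.2).new
    obtain ⟨j, rfl⟩ := L.exists_edge_eq ((C l).edgeSet_subset hf)
    exact ⟨j, hf, hfC⟩
  choose g hg using hnew
  have hinj : Function.Injective g := by
    intro a b hab
    rcases lt_trichotomy a b with h | h | h
    · exact absurd ⟨a, h, hab ▸ (hg a).1⟩ (hg b).2
    · exact h
    · exact absurd ⟨b, h, hab ▸ (hg b).1⟩ (hg a).2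
  obtain ⟨j, rfl⟩ := L.exists_edge_eq hf
  obtain ⟨l, rfl⟩ := Finite.surjective_of_injective hinj j
  exact ⟨l, l.2, (hg l).1⟩

theorem exists_run_greedy (hG : IsBiconnected G) (hw : ∀ f ∈ G.edgeSet, 0 < w f)
    (L : EdgeList G) (r : Fin L.m) :
    ∃ (k : ℕ) (C : ℕ → G.Subgraph),
      L.Outputs (greedy.run (L.wt w) (L.input r)) (fun i : Fin k => C i) ∧
      (∀ l < k, IsBest w (L.edge r) (covered C l) (C l)) ∧
      ∀ f ∈ G.edgeSet, f ≠ L.edge r → f ∈ covered C k := by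
  have hb := bounded_input L r
  obtain ⟨h1, h2, h3⟩ := run_setUp (L.wt w) L r
  set s₁ := setUp.run (L.wt w) (L.input r) with hs₁
  have b1 : Bounded s₁ := hb.run setUp_wf _
  have main := run_loop_bounded (L.wt w) greedyLoop_wf b1
    (fun i s' => ∃ k C, GreedyState L r w s' i k C)
    (fun s₀ h => ⟨0, fun _ => ⊥, le_rfl, by rw [h 3 (by decide), h2], ?_,
      fun l hl => absurd hl (by omega), fun l hl => absurd hl (by omega),
      fun x _ => by rw [h 4 (by decide), h3], Or.inl rfl⟩) ?_
  · obtain ⟨k, C, hk⟩ := main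
    refine ⟨k, C, ⟨hk.count, fun i j => hk.out i i.2 j⟩, hk.best, ?_⟩
    rcases hk.progress with h | h
    · rw [h1.size] at h
      subst h
      exact fun f hf _ => mem_covered_of_isBest hk.best hf
    · exact h
  · rw [covered_zero]
    exact h1.congr (h 0 (by decide)) (h 1 (by decide)) (h 2 (by decide)) (h 5 (by decide))
      (h 6 (by decide))
  · rintro i hi s' hb' hfr hcnt ⟨k, C, hk⟩ s'' hs''
    rw [h1.size] at hi
    obtain ⟨k', C', hk'⟩ := hk.exists_succ hG hw hb' hi
    refine ⟨k', C', hk'.le, by rw [hs'' 3 (by decide), hk'.count], ?_, hk'.best,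
      by rw [hs'' 4 (by decide)]; exact hk'.out, by rw [hs'' 4 (by decide)]; exact hk'.free,
      hk'.progress⟩
    exact hk'.ready.congr (hs'' 0 (by decide)) (hs'' 1 (by decide)) (hs'' 2 (by decide))
      (hs'' 5 (by decide)) (hs'' 6 (by decide))

end Prg

end

end RootedCycleBasis

theorem theorem2 :
    ∃ (c : RootedCycleBasis.Cmd) (p : Polynomial ℕ),
      ∀ (n : ℕ) (G : SimpleGraph (Fin n)) (w : Sym2 (Fin n) → ℝ)
        (L : RootedCycleBasis.EdgeList G) (r : Fin L.m),
        RootedCycleBasis.IsBiconnected G →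
        (∀ f ∈ G.edgeSet, 0 < w f) →
        ∃ (t : ℕ) (s : RootedCycleBasis.Mem) (k : ℕ) (C : Fin k → G.Subgraph),
          RootedCycleBasis.Exec (L.wt w) (p.eval (n + L.m)) c (L.input r) t s ∧
          t ≤ p.eval (n + L.m) ∧
          L.Outputs s C ∧
          Function.Injective C ∧
          RootedCycleBasis.IsMinRootedCycleBasis w (L.edge r) (Set.range C) ∧
          RootedCycleBasis.IsGreedySequence w (L.edge r) C ∧
          RootedCycleBasis.IsWeaklyFundamental C ∧
          RootedCycleBasis.IsOpenEarDecomposition (RootedCycleBasis.ears (L.edge r) C) := by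
  classical
  obtain ⟨q, hq⟩ := RootedCycleBasis.Prg.exists_exec RootedCycleBasis.Prg.greedy_wf
  -- The resource bound is a polynomial in `memBound`, which is `n + m + 2` for the input.
  refine ⟨RootedCycleBasis.Prg.greedy.compile, q.comp (Polynomial.X + 2), ?_⟩
  intro n G w L r hG hw
  obtain ⟨k, C, hout, hC, hcov⟩ := RootedCycleBasis.Prg.exists_run_greedy hG hw L r
  have hp : (q.comp (Polynomial.X + 2)).eval (n + L.m) =
      q.eval (RootedCycleBasis.memBound (L.input r)) := by
    rw [Polynomial.eval_comp, Polynomial.eval_add, Polynomial.eval_X, Polynomial.eval_ofNat]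
    rfl
  rw [hp]
  obtain ⟨t, ht, e⟩ := hq (L.wt w) (L.input r) _ (RootedCycleBasis.Prg.bounded_input L r) le_rfl
  have huv := L.adj r
  exact ⟨t, _, k, fun i => C i, e, ht, hout, RootedCycleBasis.injective_of_isBest hC,
    RootedCycleBasis.isMinRootedCycleBasis_of_isBest huv hw hC hcov,
    RootedCycleBasis.isGreedySequence_of_isBest hC hcov,
    fun i => by rw [RootedCycleBasis.newEdges_eq]; exact (hC i i.2).new,
    RootedCycleBasis.isOpenEarDecomposition_ears hG.1 huv hw hC hcov⟩
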